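/- Let $k$ be an algebraically closed field of characteristic $p$ with $p=0$ or $p\ge 5$. For each $s\in\{2,3,4,5\}$ there exists a non-singular projective curve $H$ over $k$ of genus $5$ such that $H$ is not hyperelliptic, the group $\mathrm{Aut}(H)$ of $k$-automorphisms of $H$ contains a subgroup isomorphic to the Klein four-group $\mathbf V_4$, and $H$ is birational over $k$ to a plane curve $\{F=0\}\subset\mathbb P^2$, with $F\in k[x_0,x_1,x_2]$ an irreducible form of degree $6$, that has exactly $s$ singular points, each of which is a double point (a point of multiplicity $2$). -/

import Mathlib

universe u

open CategoryTheory AlgebraicGeometry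

noncomputable section

namespace PlaneSextic

attribute [local instance] MvPolynomial.gradedAlgebra

/-- The structure morphism of the projective `n`-space `Proj k[x₀, …, xₙ]` over `k`. -/
def projectiveSpaceHom (k : Type u) [Field k] (n : ℕ) :
    Proj (MvPolynomial.homogeneousSubmodule (Fin (n + 1)) k) ⟶ Spec (.of k) :=
  Proj.toSpecZero (MvPolynomial.homogeneousSubmodule (Fin (n + 1)) k) ≫
    Spec.map (CommRingCat.ofHom
      (algebraMap k (MvPolynomial.homogeneousSubmodule (Fin (n + 1)) k 0)))

/-- The projective `n`-space over `k`, as a `k`-scheme. -/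
def projectiveSpace (k : Type u) [Field k] (n : ℕ) : Over (Spec (.of k)) :=
  Over.mk (projectiveSpaceHom k n)

/-- A non-singular (projective, integral) curve over `k`: an integral scheme that is smooth of
relative dimension one over `k` and is isomorphic over `k` to a closed subscheme of some
projective space. -/
class IsNonsingularCurve {k : Type u} [Field k] (X : Over (Spec (.of k))) : Prop where
  isIntegral : IsIntegral X.left
  smooth : SmoothOfRelativeDimension 1 X.hom
  projective : ∃ (n : ℕ) (i : X ⟶ projectiveSpace k n), IsClosedImmersion i.left

attribute [instance] IsNonsingularCurve.isIntegral

section Genus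

variable {k : Type u} [Field k] (X : Over (Spec (.of k))) [IrreducibleSpace X.left]

/-- The canonical map from `k` to the function field of a `k`-scheme. -/
def toFunctionField : k →+* X.left.functionField :=
  ((Scheme.ΓSpecIso (.of k)).inv ≫ X.hom.appTop ≫
    X.left.presheaf.germ ⊤ (genericPoint X.left) trivial).hom

/-- The function field of a `k`-scheme is a `k`-algebra. -/
instance functionFieldAlgebra : Algebra k X.left.functionField :=
  (toFunctionField X).toAlgebra

/-- The local ring of `X` at `x`, as a `k`-subalgebra of the function field. -/
def localRing (x : X.left) : Subalgebra k X.left.functionField where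
  toSubsemiring := (algebraMap (X.left.presheaf.stalk x) X.left.functionField).rangeS
  algebraMap_mem' c :=
    have : Nonempty (⊤ : X.left.Opens) := ⟨⟨x, trivial⟩⟩
    ⟨X.left.presheaf.germ ⊤ x trivial (((Scheme.ΓSpecIso (.of k)).inv ≫ X.hom.appTop).hom c),
      Scheme.algebraMap_germ_eq_germToFunctionField (X := X.left) (U := ⊤) trivial _⟩

/-- The rational differentials (elements of `Ω` of the function field over `k`) that are regular
at `x`: those of the form `∑ aᵢ dbᵢ` with `aᵢ, bᵢ` in the local ring at `x`. -/
def differentialsRegularAt (x : X.left) : Submodule k (Ω[X.left.functionField⁄k]) :=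
  (Submodule.span (localRing X x)
    (Set.range fun b : localRing X x =>
      KaehlerDifferential.D k X.left.functionField b)).restrictScalars k

/-- The space of global regular differentials `H⁰(X, Ω)` of a non-singular curve: the rational
differentials that are regular at every point. -/
def regularDifferentials : Submodule k (Ω[X.left.functionField⁄k]) :=
  ⨅ x : X.left, differentialsRegularAt X x

/-- The genus of a non-singular curve: the dimension of its space of regular differentials. -/
def genus : ℕ := Module.finrank k (regularDifferentials X)

end Genus

/-- `X` is hyperelliptic (for curves of genus at least two): it has a dominant morphism of degree
two to the projective line over `k`, the degree being that of the extension of function fields,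
i.e. of the residue fields at the generic points. -/
def IsHyperelliptic {k : Type u} [Field k] (X : Over (Spec (.of k))) [IrreducibleSpace X.left] :
    Prop :=
  ∃ f : X ⟶ projectiveSpace k 1,
    IsDominant f.left ∧ f.left.residueDegree (genericPoint X.left) = 2

/-- The closed subset `F = 0` of the projective plane. -/
def planeZeroLocus {k : Type u} [Field k] (F : MvPolynomial (Fin 3) k) :
    TopologicalSpace.Closeds (Proj (MvPolynomial.homogeneousSubmodule (Fin 3) k)) where
  carrier := ProjectiveSpectrum.zeroLocus (MvPolynomial.homogeneousSubmodule (Fin 3) k) {F}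
  isClosed' := ProjectiveSpectrum.isClosed_zeroLocus _ _

/-- The projective plane curve `F = 0` (for an irreducible form `F`) as a `k`-scheme: the closed
subset `F = 0` of the projective plane with its reduced scheme structure. -/
def planeCurve {k : Type u} [Field k] (F : MvPolynomial (Fin 3) k) : Over (Spec (.of k)) :=
  Over.mk ((Scheme.IdealSheafData.vanishingIdeal (planeZeroLocus F)).subschemeι ≫
    projectiveSpaceHom k 2)

/-- The multiplicity of the plane curve `F = 0` at the point `P`: the lowest degree of a
term in the Taylor expansion `F (v + x)` of the form `F` at a representative `v` of `P`. As `F` is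
homogeneous, it does not depend on `v`, and it is the order of vanishing at `P` of the
dehomogenization of `F` in any affine chart around `P`. -/
def multiplicityAt {k : Type u} [Field k] (F : MvPolynomial (Fin 3) k)
    (P : Projectivization k (Fin 3 → k)) : ℕ∞ :=
  MvPowerSeries.order
    (MvPolynomial.aeval (fun i => MvPolynomial.C (P.rep i) + MvPolynomial.X i) F :
      MvPolynomial (Fin 3) k).toMvPowerSeries

/-- The singular points of the plane curve `F = 0`: the points of multiplicity at least two. -/
def singularPoints {k : Type u} [Field k] (F : MvPolynomial (Fin 3) k) :
    Set (Projectivization k (Fin 3 → k)) :=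
  {P | 2 ≤ multiplicityAt F P}

end PlaneSextic

end

/-! The curve is always a biquadratic cover of the line: `y² = f(x)`, `z² = g(x)`, with `f`, `g`
coprime separable monic quartics without cubic term and with nonzero constant term. It is realised
as the closure in `ℙ⁴` of the point `(1 : x : x² : y : z)` with values in its function field `k(x,
y, z)`; this is its canonical model. Two affine pieces cover it, `k[x, y, z]` and `k[1/x, y/x²,
z/x²]`, and both have the same biquadratic shape, so each affine statement is proved once, for
`IsBiquadratic`.

Everything rests on the independence of `1, y, z, yz` over `k(x)` (`IsBiquadratic.coeff_eq_zero`).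
By Bézout relations for `(f, f')`, `(g, g')` and `(f, g)`, the differentials of each piece are
generated by `dx/(yz)`, up to a unit and the change of coordinate
(`IsBiquadratic.mem_differentialSpan_iff`); the same relations give smoothness. Comparing degrees in
`x` on the two pieces leaves exactly `(1, x, x², y, z) · dx/(yz)` as a basis of the regular
differentials, so the genus is 5. The sign changes of `y` and `z` are induced by diagonal maps of
`ℙ⁴` and generate a Klein four-group.

The curve is not hyperelliptic because its canonical functions generate the function field. If the
field `L` had degree 2 over `k(t)`, write `L = k(t, s)` with `s² = d(t)`. The part of a regular
differential invariant under `s ↦ -s` would be a regular differential on the line, hence zero; so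
every regular differential is `v s dt` with `v ∈ k(t)`, and all ratios of regular differentials lie
in `k(t)`. But `x, y, z` are such ratios (`finrank_adjoin_ne_two`).

The plane sextics are quadratic in the square of one affine coordinate, `α V⁴ + β V² + γ`. For `s =
2, 3, 4` write `f, g = x⁴ + m ± 2N` with `N = p x² + q`, and take `V = (y + z)/2` and `x` as
coordinates. Since `V · (y - z)/2 = N`, the equation is `V⁴ - (x⁴ + m) V² + N² = 0`. Its singular
points are two points at infinity and one point `(V, x) = (0, ρ)` for each distinct root `ρ` of `N`;
so `N` is chosen with 0, 1 or 2 of them. For `s = 5` take `f, g = x⁴ ± r x + 1` and the coordinates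
`V = (y + z - 2x² - 2)/x`, `b = (y - z)/x`; there are three singular points at infinity and two on
`V = 0`. In all cases a pure second partial derivative is nonzero at each singular point, so all are
double points. -/

noncomputable section

namespace PlaneSextic

attribute [local instance] MvPolynomial.gradedAlgebra

/-! ### Points of projective space with values in a field, given by homogeneous coordinates. -/

section ProjectivePoint

open HomogeneousLocalization

variable {k K : Type u} [Field k] [Field K] [Algebra k K] {n : ℕ} (c : Fin (n + 1) → K)

/-- The evaluation at `c` of the degree zero fractions with denominator a power of `F`. -/
def evalAway (F : MvPolynomial (Fin (n + 1)) k) (hF : MvPolynomial.aeval c F ≠ 0) :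
    Away (MvPolynomial.homogeneousSubmodule (Fin (n + 1)) k) F →+* K :=
  (IsLocalization.Away.lift (S := Localization.Away F) F
    (g := (MvPolynomial.aeval c : MvPolynomial (Fin (n + 1)) k →ₐ[k] K).toRingHom)
    (isUnit_iff_ne_zero.mpr hF)).comp (algebraMap (Away (MvPolynomial.homogeneousSubmodule (Fin (n + 1)) k) F) (Localization.Away F))

lemma evalAway_mk (F : MvPolynomial (Fin (n + 1)) k) (hF : MvPolynomial.aeval c F ≠ 0)
    {d : ℕ} (hd : F ∈ (MvPolynomial.homogeneousSubmodule (Fin (n + 1)) k) d) (m : ℕ) (G : MvPolynomial (Fin (n + 1)) k) (hG : G ∈ (MvPolynomial.homogeneousSubmodule (Fin (n + 1)) k) (m • d)) :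
    evalAway c F hF (Away.mk (MvPolynomial.homogeneousSubmodule (Fin (n + 1)) k) hd m G hG) =
      MvPolynomial.aeval c G / MvPolynomial.aeval c F ^ m := by
  simp only [evalAway, RingHom.comp_apply, HomogeneousLocalization.algebraMap_apply,
    Away.val_mk]
  rw [Localization.mk_eq_mk', IsLocalization.Away.lift, IsLocalization.lift_mk'_spec,
    mul_div_assoc', eq_div_iff (pow_ne_zero _ hF)]
  simp [mul_comm]

lemma evalAway_awayMap {F G P : MvPolynomial (Fin (n + 1)) k} {d e : ℕ} (hd : F ∈ (MvPolynomial.homogeneousSubmodule (Fin (n + 1)) k) d)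
    (he : G ∈ (MvPolynomial.homogeneousSubmodule (Fin (n + 1)) k) e) (hP : P = F * G) (hF : MvPolynomial.aeval c F ≠ 0)
    (hPc : MvPolynomial.aeval c P ≠ 0) :
    (evalAway c P hPc).comp (awayMap (MvPolynomial.homogeneousSubmodule (Fin (n + 1)) k) he hP) = evalAway c F hF := by
  ext a
  obtain ⟨m, G', hG', rfl⟩ := Away.mk_surjective (MvPolynomial.homogeneousSubmodule (Fin (n + 1)) k) hd a
  have hG0 : MvPolynomial.aeval c G ≠ 0 := by
    rintro h; apply hPc; rw [hP, map_mul, h, mul_zero]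
  subst hP
  rw [RingHom.comp_apply, awayMap_mk, evalAway_mk, evalAway_mk]
  rw [map_mul, map_pow, map_mul, mul_pow, mul_div_mul_right _ _ (pow_ne_zero _ hG0)]

lemma evalAway_fromZero (F : MvPolynomial (Fin (n + 1)) k) (hF : MvPolynomial.aeval c F ≠ 0) :
    ((evalAway c F hF).comp (fromZeroRingHom (MvPolynomial.homogeneousSubmodule (Fin (n + 1)) k) _)).comp (algebraMap k ((MvPolynomial.homogeneousSubmodule (Fin (n + 1)) k) 0)) =
      algebraMap k K := by
  ext a
  have h : (fromZeroRingHom (MvPolynomial.homogeneousSubmodule (Fin (n + 1)) k) (.powers F) (algebraMap k ((MvPolynomial.homogeneousSubmodule (Fin (n + 1)) k) 0) a)).val =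
      algebraMap _ (Localization.Away F) (MvPolynomial.C a) := Localization.mk_one_eq_algebraMap _
  simp only [evalAway, RingHom.comp_apply, HomogeneousLocalization.algebraMap_apply, h]
  rw [IsLocalization.Away.lift_eq]
  simp

/-- The point of projective space with homogeneous coordinates `c`, through the chart `F ≠ 0`. -/
def pointOfChart (F : MvPolynomial (Fin (n + 1)) k) (hF : MvPolynomial.aeval c F ≠ 0)
    {d : ℕ} (hd : F ∈ (MvPolynomial.homogeneousSubmodule (Fin (n + 1)) k) d) (hd0 : 0 < d) : Spec (.of K) ⟶ Proj (MvPolynomial.homogeneousSubmodule (Fin (n + 1)) k) :=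
  Spec.map (CommRingCat.ofHom (evalAway c F hF)) ≫ Proj.awayι (MvPolynomial.homogeneousSubmodule (Fin (n + 1)) k) F hd hd0

lemma pointOfChart_mul {F G : MvPolynomial (Fin (n + 1)) k} {d e : ℕ} (hd : F ∈ (MvPolynomial.homogeneousSubmodule (Fin (n + 1)) k) d)
    (he : G ∈ (MvPolynomial.homogeneousSubmodule (Fin (n + 1)) k) e) (hd0 : 0 < d) (hF : MvPolynomial.aeval c F ≠ 0)
    (hP : MvPolynomial.aeval c (F * G) ≠ 0) (hde : F * G ∈ (MvPolynomial.homogeneousSubmodule (Fin (n + 1)) k) (d + e)) (hde0 : 0 < d + e) :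
    pointOfChart c (F * G) hP hde hde0 = pointOfChart c F hF hd hd0 := by
  rw [pointOfChart, pointOfChart, ← evalAway_awayMap c hd he rfl hF hP, CommRingCat.ofHom_comp,
    Spec.map_comp, Category.assoc, Proj.SpecMap_awayMap_awayι (MvPolynomial.homogeneousSubmodule (Fin (n + 1)) k) hd hd0 he rfl]

/-- Both charts restrict to the chart of `F * G`, so the point depends only on `c`. -/
lemma pointOfChart_eq {F G : MvPolynomial (Fin (n + 1)) k} {d e : ℕ} (hd : F ∈ (MvPolynomial.homogeneousSubmodule (Fin (n + 1)) k) d)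
    (he : G ∈ (MvPolynomial.homogeneousSubmodule (Fin (n + 1)) k) e) (hd0 : 0 < d) (he0 : 0 < e) (hF : MvPolynomial.aeval c F ≠ 0)
    (hG : MvPolynomial.aeval c G ≠ 0) :
    pointOfChart c F hF hd hd0 = pointOfChart c G hG he he0 := by
  have h1 : MvPolynomial.aeval c (F * G) ≠ 0 := by
    rw [map_mul]; exact mul_ne_zero hF hG
  have h2 : MvPolynomial.aeval c (G * F) ≠ 0 := by
    rw [map_mul]; exact mul_ne_zero hG hF
  rw [← pointOfChart_mul c hd he hd0 hF h1 (SetLike.mul_mem_graded hd he) (by omega),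
    ← pointOfChart_mul c he hd he0 hG h2 (SetLike.mul_mem_graded he hd) (by omega)]
  congr 1
  · exact mul_comm _ _
  · exact add_comm _ _

lemma X_mem (i : Fin (n + 1)) : (MvPolynomial.X i : MvPolynomial (Fin (n + 1)) k) ∈ (MvPolynomial.homogeneousSubmodule (Fin (n + 1)) k) 1 :=
  MvPolynomial.isHomogeneous_X k i

lemma aeval_X_ne {i : Fin (n + 1)} (hi : c i ≠ 0) :
    MvPolynomial.aeval c (MvPolynomial.X i : MvPolynomial (Fin (n + 1)) k) ≠ 0 := by
  simpa using hi

/-- The point of projective space with homogeneous coordinates `c`. -/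
def projectivePoint (k : Type u) [Field k] [Algebra k K] (hc : ∃ i, c i ≠ 0) :
    Spec (.of K) ⟶ Proj (MvPolynomial.homogeneousSubmodule (Fin (n + 1)) k) :=
  pointOfChart c (MvPolynomial.X hc.choose) (aeval_X_ne c hc.choose_spec) (X_mem _) one_pos

variable (hc : ∃ i, c i ≠ 0)

lemma projectivePoint_eq {F : MvPolynomial (Fin (n + 1)) k} {d : ℕ} (hd : F ∈ (MvPolynomial.homogeneousSubmodule (Fin (n + 1)) k) d) (hd0 : 0 < d)
    (hF : MvPolynomial.aeval c F ≠ 0) :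
    projectivePoint c k hc =
      Spec.map (CommRingCat.ofHom (evalAway c F hF)) ≫ Proj.awayι (MvPolynomial.homogeneousSubmodule (Fin (n + 1)) k) F hd hd0 :=
  pointOfChart_eq c _ hd one_pos hd0 _ hF

lemma projectivePoint_hom :
    projectivePoint c k hc ≫ projectiveSpaceHom k n =
      Spec.map (CommRingCat.ofHom (algebraMap k K)) := by
  obtain ⟨i, hi⟩ := hc
  rw [projectivePoint_eq c _ (X_mem i) one_pos (aeval_X_ne c hi), projectiveSpaceHom,
    Category.assoc, Proj.awayι_toSpecZero_assoc, ← Spec.map_comp, ← Spec.map_comp,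
    ← CommRingCat.ofHom_comp, ← CommRingCat.ofHom_comp, ← evalAway_fromZero c _ (aeval_X_ne c hi),
    RingHom.comp_assoc]

lemma projectivePoint_mem_basicOpen (x : Spec (.of K)) {F : MvPolynomial (Fin (n + 1)) k} {d : ℕ}
    (hd : F ∈ (MvPolynomial.homogeneousSubmodule (Fin (n + 1)) k) d) (hd0 : 0 < d) :
    projectivePoint c k hc x ∈ Proj.basicOpen (MvPolynomial.homogeneousSubmodule (Fin (n + 1)) k) F ↔ MvPolynomial.aeval c F ≠ 0 := by
  constructor
  · intro h hF
    obtain ⟨i, hi⟩ := hc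
    rw [projectivePoint_eq c _ (X_mem i) one_pos (aeval_X_ne c hi)] at h
    have h' : (Spec.map (CommRingCat.ofHom (evalAway c _ (aeval_X_ne c hi)))) x ∈
      Proj.awayι (MvPolynomial.homogeneousSubmodule (Fin (n + 1)) k) (MvPolynomial.X i) (X_mem i) one_pos ⁻¹ᵁ Proj.basicOpen (MvPolynomial.homogeneousSubmodule (Fin (n + 1)) k) F := h
    -- Inside the chart of `X i`, the locus `F ≠ 0` is where the fraction `F / X i ^ d` lies outside
    -- the prime; here that fraction evaluates to zero.
    rw [Proj.awayι_preimage_basicOpen (MvPolynomial.homogeneousSubmodule (Fin (n + 1)) k) (X_mem i) one_pos hd hd0] at h'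
    have h'' : evalAway c _ (aeval_X_ne c hi) (Away.isLocalizationElem (X_mem i) hd) ∉
      x.asIdeal := h'
    apply h''
    rw [Away.isLocalizationElem, evalAway_mk, map_pow, hF]
    simp
  · intro h
    rw [projectivePoint_eq c _ hd hd0 h, ← Proj.opensRange_awayι (MvPolynomial.homogeneousSubmodule (Fin (n + 1)) k) F hd hd0]
    exact ⟨_, rfl⟩

end ProjectivePoint

end PlaneSextic
end

noncomputable section

namespace PlaneSextic

/-! ### The function field of an integral scheme embedded in a field by a dominant point. -/

section FunctionField

open IsLocalRing

section Eval

variable {R : CommRingCat.{u}} {X Y : Scheme.{u}}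

/-- The value at an `R`-point of a section over an open subset containing the point. -/
def pointEval (f : Spec R ⟶ X) (U : X.Opens) (hU : ⊤ ≤ f ⁻¹ᵁ U) : Γ(X, U) ⟶ R :=
  f.appLE U ⊤ hU ≫ (Scheme.ΓSpecIso R).hom

lemma pointEval_comp (f : Spec R ⟶ X) (g : X ⟶ Y) (U : Y.Opens) (hU : ⊤ ≤ f ⁻¹ᵁ g ⁻¹ᵁ U) :
    pointEval (f ≫ g) U hU = g.app U ≫ pointEval f (g ⁻¹ᵁ U) hU := by
  have h := Scheme.Hom.comp_appLE f g U ⊤ hU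
  exact congr($h ≫ (Scheme.ΓSpecIso R).hom).trans (Category.assoc _ _ _)

lemma pointEval_congr {f f' : Spec R ⟶ X} (h : f = f') (U : X.Opens) (hU : ⊤ ≤ f ⁻¹ᵁ U) :
    pointEval f U hU = pointEval f' U (h ▸ hU) := by
  subst h; rfl

lemma pointEval_SpecMap {S : CommRingCat.{u}} (ψ : S ⟶ R) :
    pointEval (Spec.map ψ) ⊤ le_rfl = (Scheme.ΓSpecIso S).hom ≫ ψ := by
  refine Eq.trans ?_ (Scheme.ΓSpecIso_naturality ψ)
  exact congr($(Scheme.Hom.appLE_eq_app (f := Spec.map ψ) (U := ⊤)) ≫ (Scheme.ΓSpecIso R).hom)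

lemma pointEval_map (f : Spec R ⟶ X) {U V : X.Opens} (h : V ≤ U) (hV : ⊤ ≤ f ⁻¹ᵁ V) :
    X.presheaf.map (homOfLE h).op ≫ pointEval f V hV = pointEval f U (hV.trans (f.preimage_mono h)) := by
  simp [pointEval, Scheme.Hom.map_appLE_assoc]

lemma germ_comp_stalkClosedPointTo [IsLocalRing R] (f : Spec R ⟶ X) (U : X.Opens)
    (hU : f (closedPoint R) ∈ U) :
    X.presheaf.germ U _ hU ≫ Scheme.stalkClosedPointTo f =
      pointEval f U (Scheme.preimage_eq_top_of_closedPoint_mem f hU).ge := by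
  rw [Scheme.germ_stalkClosedPointTo, pointEval, Scheme.Hom.appLE, Category.assoc]
  rfl

end Eval

variable {K : Type u} [Field K] {X : Scheme.{u}} [IsIntegral X] (e : Spec (.of K) ⟶ X)
  [IsDominant e]

/-- The spectrum of a field has a single point, and its image is dense. -/
lemma apply_closedPoint_eq_genericPoint : e (closedPoint K) = genericPoint X := by
  refine ((genericPoint_spec X).eq ?_).symm
  have h := e.denseRange.closure_range
  rwa [show Set.range e = {e (closedPoint K)} by
    rw [Set.range_eq_singleton_iff]
    intro y
    rw [Subsingleton.elim y (closedPoint K)]] at h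

/-- The embedding of the function field into `K` induced by a dominant `K`-point. -/
def functionFieldHom : X.functionField →+* K :=
  (X.presheaf.stalkSpecializes (specializes_of_eq (apply_closedPoint_eq_genericPoint e)) ≫
    Scheme.stalkClosedPointTo (R := .of K) e).hom

lemma functionFieldHom_germ (U : X.Opens) [h : Nonempty U] (hU : ⊤ ≤ e ⁻¹ᵁ U)
    (s : Γ(X, U)) :
    functionFieldHom e (X.germToFunctionField U s) = pointEval e U hU s := by
  have hU' : e (closedPoint (CommRingCat.of K)) ∈ U := hU (x := closedPoint K) trivial
  have h1 := TopCat.Presheaf.germ_stalkSpecializes X.presheaf (U := U)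
    (apply_closedPoint_eq_genericPoint e ▸ hU') (specializes_of_eq (apply_closedPoint_eq_genericPoint e))
  have h2 := germ_comp_stalkClosedPointTo (R := .of K) e U hU'
  rw [← h2]
  exact congr((Scheme.stalkClosedPointTo (R := .of K) e).hom ($(h1).hom s))

lemma functionFieldHom_toFunctionField {k : Type u} [Field k] [Algebra k K]
    (p : X ⟶ Spec (.of k))
    (he : e ≫ p = Spec.map (CommRingCat.ofHom (algebraMap k K))) (a : k) :
    have : IsIntegral (Over.mk p).left := ‹_›
    functionFieldHom e (toFunctionField (Over.mk p) a) = algebraMap k K a := by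
  have : Nonempty (⊤ : X.Opens) := ⟨⟨genericPoint X, trivial⟩⟩
  have h1 := functionFieldHom_germ e ⊤ le_rfl
    (((Scheme.ΓSpecIso (.of k)).inv ≫ p.appTop).hom a)
  have h2 : (Scheme.ΓSpecIso (.of k)).inv ≫ p.appTop ≫ pointEval e ⊤ le_rfl =
      CommRingCat.ofHom (algebraMap k K) := by
    rw [Iso.inv_comp_eq, ← pointEval_SpecMap, ← pointEval_congr he ⊤ le_rfl]
    exact (pointEval_comp e p ⊤ le_rfl).symm
  refine h1.trans ?_
  exact congr($(h2).hom a)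

variable {P : Scheme.{u}}  {A : Type u} [CommRing A]
  (g : Spec (.of A) ⟶ P) [IsOpenImmersion g] (ψ : A →+* K)

-- The sections over the image of the chart `g` form a copy of `A`, and evaluating them at a point
-- that factors through `g` is `ψ`.
omit [IsIntegral X] [IsDominant e] in
lemma exists_pointEval_eq_iff {h : Spec (.of K) ⟶ P} (hg : h = Spec.map (CommRingCat.ofHom ψ) ≫ g)
    (hU : ⊤ ≤ h ⁻¹ᵁ g.opensRange) (z : K) :
    (∃ s : Γ(P, g.opensRange), pointEval h g.opensRange hU s = z) ↔ z ∈ ψ.range := by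
  subst hg
  have htop : ⊤ ≤ g ⁻¹ᵁ g.opensRange := fun x _ => ⟨x, rfl⟩
  let θ := g.app g.opensRange ≫ (Spec (.of A)).presheaf.map (homOfLE htop).op ≫
        (Scheme.ΓSpecIso (.of A)).hom
  have key : ∀ s : Γ(P, g.opensRange), pointEval (Spec.map (CommRingCat.ofHom ψ) ≫ g) g.opensRange
      hU s = ψ (θ.hom s) := by
    intro s
    have h2 := pointEval_comp (Spec.map (CommRingCat.ofHom ψ)) g g.opensRange hU
    have h3 := pointEval_map (Spec.map (CommRingCat.ofHom ψ)) htop le_rfl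
    have h4 := pointEval_SpecMap (CommRingCat.ofHom ψ)
    refine congr($(h2).hom s).trans ?_
    refine congr($(h3).hom (g.app g.opensRange s)).symm.trans ?_
    exact congr($(h4).hom _)
  constructor
  · rintro ⟨s, rfl⟩
    rw [key]
    exact ⟨_, rfl⟩
  · rintro ⟨a, rfl⟩
    have hiso : IsIso (g.app g.opensRange) := g.isIso_app _ le_rfl
    have hiso' : IsIso ((Spec (.of A)).presheaf.map (homOfLE htop).op) := by
      rw [show homOfLE htop = eqToHom (top_le_iff.mp htop).symm from rfl]
      infer_instance
    obtain ⟨s, hs⟩ := (ConcreteCategory.bijective_of_isIso θ).2 a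
    refine ⟨s, ?_⟩
    rw [key]
    exact congr(ψ $hs)

variable (ι : X ⟶ P) [IsClosedImmersion ι] (he : e ≫ ι = Spec.map (CommRingCat.ofHom ψ) ≫ g)

include he

omit [IsIntegral X] [IsDominant e] [IsClosedImmersion ι] in
lemma top_le_preimage_opensRange : ⊤ ≤ e ⁻¹ᵁ ι ⁻¹ᵁ g.opensRange := by
  rw [← Scheme.Hom.comp_preimage, he]
  exact fun _ _ => ⟨_, rfl⟩

/-- Sections of a closed subscheme over an affine open lift to the ambient scheme, so they take the
same values at the point as the ambient sections do. -/
lemma exists_germ_eq_iff [h : Nonempty (ι ⁻¹ᵁ g.opensRange)] (z : K) :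
    (∃ s : Γ(X, ι ⁻¹ᵁ g.opensRange), functionFieldHom e (X.germToFunctionField _ s) = z) ↔
      z ∈ ψ.range := by
  have hmem := top_le_preimage_opensRange e g ψ ι he
  rw [← exists_pointEval_eq_iff g ψ he hmem]
  have key : ∀ s : Γ(P, g.opensRange), functionFieldHom e (X.germToFunctionField _
      (ι.app g.opensRange s)) = pointEval (e ≫ ι) g.opensRange hmem s := by
    intro s
    rw [functionFieldHom_germ e _ hmem]
    exact congr($(pointEval_comp e ι g.opensRange hmem).hom s).symm
  constructor
  · rintro ⟨s, rfl⟩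
    obtain ⟨t, rfl⟩ : ∃ t, ι.app g.opensRange t = s :=
      ι.app_surjective _ (isAffineOpen_opensRange g) s
    exact ⟨t, (key t).symm⟩
  · rintro ⟨s, rfl⟩
    exact ⟨_, key s⟩

end FunctionField

end PlaneSextic
end

noncomputable section

namespace PlaneSextic

/-! ### Scheme-theoretic images of integral schemes. -/

section Image

variable {X Y : Scheme.{u}} (f : X ⟶ Y) [QuasiCompact f]

/-- Injectivity is known over preimages of affine opens; these form a basis, so the sheaf property
spreads it to every open set. -/
lemma toImage_app_injective (U : f.image.Opens) : Function.Injective (f.toImage.app U) := by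
  rw [injective_iff_map_eq_zero]
  intro s hs
  refine f.image.IsSheaf.section_ext fun x hx ↦ ?_
  obtain ⟨_, ⟨_, ⟨V, hV, rfl⟩, rfl⟩, hxV, hVU⟩ :=
    (Y.isBasis_affineOpens.of_isInducing f.imageι.isEmbedding.isInducing).exists_subset_of_mem_open
      hx U.isOpen
  have hVU' : f.imageι ⁻¹ᵁ V ≤ U := hVU
  refine ⟨f.imageι ⁻¹ᵁ V, hVU', hxV, f.toImage_app_injective ⟨V, hV⟩ ?_⟩
  rw [← ConcreteCategory.comp_apply, f.toImage.naturality]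
  simp [hs]

instance isReduced_image [IsReduced X] : IsReduced f.image :=
  ⟨fun U => isReduced_of_injective (f.toImage.app U).hom (toImage_app_injective f U)⟩

instance isIntegral_image [IsIntegral X] : IsIntegral f.image := by
  have : IrreducibleSpace f.image := by
    have h : IsIrreducible (Set.univ : Set f.image) := by
      rw [← f.toImage.denseRange.closure_eq, isIrreducible_iff_closure, ← Set.image_univ]
      exact (IrreducibleSpace.isIrreducible_univ X).image _ f.toImage.continuous.continuousOn
    have := h.1
    exact { isPreirreducible_univ := h.2, toNonempty := ⟨h.1.some⟩ }
  exact isIntegral_of_irreducibleSpace_of_isReduced _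

end Image

/-! ### Closures of field-valued points in projective space: charts, functions, equations. -/

section CurveOf

attribute [local instance] MvPolynomial.gradedAlgebra

open HomogeneousLocalization

variable {k K : Type u} [Field k] [Field K] [Algebra k K] {n : ℕ} (c : Fin (n + 1) → K)
  (hc : ∃ i, c i ≠ 0)

/-- The closure of the point of projective space with homogeneous coordinates `c`. -/
def closureOfPoint (k : Type u) [Field k] [Algebra k K] : Over (Spec (.of k)) :=
  Over.mk ((projectivePoint c k hc).imageι ≫ projectiveSpaceHom k n)

instance : IsIntegral (closureOfPoint c hc k).left :=
  inferInstanceAs (IsIntegral (projectivePoint c k hc).image)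

/-- The embedding into projective space. -/
def closureOfPointι : (closureOfPoint c hc k).left ⟶
    Proj (MvPolynomial.homogeneousSubmodule (Fin (n + 1)) k) :=
  (projectivePoint c k hc).imageι

instance : IsClosedImmersion (closureOfPointι (k := k) c hc) :=
  inferInstanceAs (IsClosedImmersion (projectivePoint c k hc).imageι)

/-- The generic point. -/
def toClosureOfPoint : Spec (.of K) ⟶ (closureOfPoint c hc k).left :=
  (projectivePoint c k hc).toImage

instance : IsDominant (toClosureOfPoint (k := k) c hc) :=
  inferInstanceAs (IsDominant (projectivePoint c k hc).toImage)

lemma toClosureOfPoint_ι : toClosureOfPoint (k := k) c hc ≫ closureOfPointι c hc =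
    projectivePoint c k hc :=
  (projectivePoint c k hc).toImage_imageι

lemma closureOfPointι_hom : closureOfPointι c hc ≫ projectiveSpaceHom k n =
    (closureOfPoint c hc k).hom := rfl

/-- The embedding of the function field of the closure of a `K`-point into `K`. -/
def functionFieldAlgHom : (closureOfPoint c hc k).left.functionField →ₐ[k] K where
  __ := functionFieldHom (toClosureOfPoint (k := k) c hc)
  commutes' a := functionFieldHom_toFunctionField (toClosureOfPoint (k := k) c hc)
    (closureOfPoint c hc k).hom (by
      rw [← closureOfPointι_hom, ← Category.assoc, toClosureOfPoint_ι, projectivePoint_hom]) a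

/-- The affine chart where the `j`-th coordinate does not vanish. -/
def coordinateChart (j : Fin (n + 1)) : (closureOfPoint c hc k).left.Opens :=
  closureOfPointι c hc ⁻¹ᵁ Proj.basicOpen _ (MvPolynomial.X j)

lemma isAffineOpen_coordinateChart (j : Fin (n + 1)) :
    IsAffineOpen (coordinateChart (k := k) c hc j) :=
  (Proj.isAffineOpen_basicOpen _ _ (X_mem j) one_pos).preimage _

lemma aeval_mul_of_isHomogeneous {S : Type*} [CommRing S] [Algebra k S] (c : Fin (n + 1) → S)
    {G : MvPolynomial (Fin (n + 1)) k} {m : ℕ} (hG : G.IsHomogeneous m) (r : S) :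
    MvPolynomial.aeval (fun i => r * c i) G = r ^ m * MvPolynomial.aeval c G := by
  rw [MvPolynomial.aeval_def, MvPolynomial.aeval_def, MvPolynomial.eval₂_eq, MvPolynomial.eval₂_eq,
    Finset.mul_sum]
  refine Finset.sum_congr rfl fun d hd => ?_
  have hm : ∑ i ∈ d.support, d i = m := by
    simpa [Finsupp.weight_apply, Finsupp.sum] using hG (MvPolynomial.mem_support_iff.mp hd)
  simp only [mul_pow, Finset.prod_mul_distrib, Finset.prod_pow_eq_pow_sum, hm]
  ring

/-- For a form `G` of degree `m`, the value of `G / X j ^ m` at `c` is `G` evaluated at the affine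
coordinates `c l / c j`. -/
lemma range_evalAway_X (j : Fin (n + 1)) (hj : c j ≠ 0) :
    Set.range (evalAway (k := k) c (MvPolynomial.X j) (aeval_X_ne c hj)) =
      (Algebra.adjoin k (Set.range fun l => c l / c j) : Set K) := by
  apply subset_antisymm
  · rintro _ ⟨a, rfl⟩
    obtain ⟨m, G, hG, rfl⟩ := Away.mk_surjective _ (X_mem j) a
    rw [evalAway_mk, Algebra.adjoin_range_eq_range_aeval]
    refine ⟨G, ?_⟩
    rw [smul_eq_mul, mul_one] at hG
    have := aeval_mul_of_isHomogeneous c hG (c j)⁻¹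
    rw [MvPolynomial.aeval_X, div_eq_inv_mul, ← inv_pow, ← this]
    simp only [div_eq_inv_mul]
    rfl
  · let A : Subalgebra k K :=
      { (evalAway (k := k) c (MvPolynomial.X j) (aeval_X_ne c hj)).range with
        algebraMap_mem' := fun a =>
          ⟨_, congr($(evalAway_fromZero c (MvPolynomial.X j) (aeval_X_ne c hj)) a)⟩ }
    have : Algebra.adjoin k (Set.range fun l => c l / c j) ≤ A := by
      rw [Algebra.adjoin_le_iff]
      rintro _ ⟨l, rfl⟩
      refine ⟨Away.mk _ (X_mem j) 1 (MvPolynomial.X l) (by simpa using X_mem l), ?_⟩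
      rw [evalAway_mk]
      simp
    exact this

lemma nonempty_coordinateChart (j : Fin (n + 1)) (hj : c j ≠ 0) :
    Nonempty (coordinateChart (k := k) c hc j) := by
  refine ⟨⟨toClosureOfPoint (k := k) c hc (IsLocalRing.closedPoint K), ?_⟩⟩
  have h := (projectivePoint_mem_basicOpen c hc (IsLocalRing.closedPoint K) (X_mem (k := k) j)
    one_pos).mpr (aeval_X_ne c hj)
  rwa [← toClosureOfPoint_ι] at h

lemma exists_functionFieldAlgHom_eq_iff (j : Fin (n + 1)) (hj : c j ≠ 0)
    [Nonempty (coordinateChart (k := k) c hc j)] (z : K) :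
    (∃ s : Γ((closureOfPoint c hc k).left, coordinateChart c hc j),
      functionFieldAlgHom c hc ((closureOfPoint c hc k).left.germToFunctionField _ s) = z) ↔
      z ∈ Algebra.adjoin k (Set.range fun l => c l / c j) := by
  rw [← SetLike.mem_coe, ← range_evalAway_X c j hj]
  have hU : coordinateChart (k := k) c hc j = closureOfPointι c hc ⁻¹ᵁ
      (Proj.awayι (MvPolynomial.homogeneousSubmodule (Fin (n + 1)) k) (MvPolynomial.X j)
        (X_mem j) one_pos).opensRange := by
    rw [Proj.opensRange_awayι]; rfl
  have he : toClosureOfPoint (k := k) c hc ≫ closureOfPointι c hc =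
      Spec.map (CommRingCat.ofHom (evalAway (k := k) c (MvPolynomial.X j) (aeval_X_ne c hj))) ≫
        Proj.awayι _ (MvPolynomial.X j) (X_mem j) one_pos := by
    rw [toClosureOfPoint_ι, projectivePoint_eq c hc (X_mem j) one_pos (aeval_X_ne c hj)]
  have h : Nonempty (closureOfPointι (k := k) c hc ⁻¹ᵁ
      (Proj.awayι (MvPolynomial.homogeneousSubmodule (Fin (n + 1)) k) (MvPolynomial.X j)
        (X_mem j) one_pos).opensRange) := hU ▸ ‹_›
  have key := exists_germ_eq_iff (toClosureOfPoint (k := k) c hc) _ _ (closureOfPointι c hc) he z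
  refine Iff.trans ?_ key
  generalize closureOfPointι (k := k) c hc ⁻¹ᵁ _ = V at hU h
  subst hU
  rfl

lemma functionFieldAlgHom_surjective (j : Fin (n + 1)) (hj : c j ≠ 0)
    (hgen : IntermediateField.adjoin k (Set.range fun l => c l / c j) = ⊤) :
    Function.Surjective (functionFieldAlgHom (k := k) c hc) := by
  have := nonempty_coordinateChart (k := k) c hc j hj
  rw [← AlgHom.fieldRange_eq_top, ← top_le_iff, ← hgen, IntermediateField.adjoin_le_iff]
  rintro z hz
  obtain ⟨s, hs⟩ := (exists_functionFieldAlgHom_eq_iff (k := k) c hc j hj z).mpr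
    (Algebra.subset_adjoin hz)
  exact ⟨_, hs⟩

/-- The function field of the closure of a `K`-point whose affine coordinates generate `K`. -/
def functionFieldEquiv (j : Fin (n + 1)) (hj : c j ≠ 0)
    (hgen : IntermediateField.adjoin k (Set.range fun l => c l / c j) = ⊤) :
    (closureOfPoint c hc k).left.functionField ≃ₐ[k] K :=
  AlgEquiv.ofBijective (functionFieldAlgHom c hc)
    ⟨(functionFieldAlgHom c hc).injective, functionFieldAlgHom_surjective c hc j hj hgen⟩

lemma exists_mem_basicOpen_X (x : Proj (MvPolynomial.homogeneousSubmodule (Fin (n + 1)) k)) :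
    ∃ i, x ∈ Proj.basicOpen (MvPolynomial.homogeneousSubmodule (Fin (n + 1)) k)
      (MvPolynomial.X i) := by
  have h := Proj.iSup_basicOpen_eq_top' (MvPolynomial.homogeneousSubmodule (Fin (n + 1)) k)
    (fun i : Fin (n + 1) => (MvPolynomial.X i : MvPolynomial (Fin (n + 1)) k))
    (fun i => ⟨1, X_mem i⟩) (by
      rw [eq_top_iff]
      intro P _
      induction P using MvPolynomial.induction_on with
      | C a =>
        exact Subalgebra.algebraMap_mem _ (⟨MvPolynomial.C a, MvPolynomial.isHomogeneous_C _ _⟩ :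
          MvPolynomial.homogeneousSubmodule (Fin (n + 1)) k 0)
      | add P Q hP hQ => exact add_mem (hP trivial) (hQ trivial)
      | mul_X P i hP => exact mul_mem (hP trivial) (Algebra.subset_adjoin ⟨i, rfl⟩))
  have hx : x ∈ (⊤ : (Proj _).Opens) := trivial
  rwa [← h, TopologicalSpace.Opens.mem_iSup] at hx

lemma exists_mem_coordinateChart (x : (closureOfPoint c hc k).left) :
    ∃ i, x ∈ coordinateChart (k := k) c hc i :=
  exists_mem_basicOpen_X (closureOfPointι c hc x)

lemma mem_coordinateChart_iff (x : (closureOfPoint c hc k).left) (j : Fin (n + 1)) :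
    x ∈ coordinateChart (k := k) c hc j ↔
      MvPolynomial.X j ∉ (closureOfPointι c hc x).asHomogeneousIdeal := Iff.rfl

/-- The point `c` is dense in its closure, so a form that vanishes at `c` vanishes at every point.
This supplies the equations of the closure. -/
lemma mem_asHomogeneousIdeal_of_aeval_eq_zero (x : (closureOfPoint c hc k).left)
    {G : MvPolynomial (Fin (n + 1)) k} {d : ℕ} (hG : G.IsHomogeneous d) (hd : 0 < d)
    (h : MvPolynomial.aeval c G = 0) : G ∈ (closureOfPointι c hc x).asHomogeneousIdeal := by
  by_contra hx
  have hx' : x ∈ closureOfPointι c hc ⁻¹ᵁ Proj.basicOpen _ G := hx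
  obtain ⟨_, hy, y, rfl⟩ := (toClosureOfPoint (k := k) c hc).denseRange.inter_open_nonempty _
    (closureOfPointι c hc ⁻¹ᵁ Proj.basicOpen _ G).isOpen ⟨x, hx'⟩
  refine (projectivePoint_mem_basicOpen c hc y hG hd).mp ?_ h
  rwa [← toClosureOfPoint_ι]

end CurveOf

end PlaneSextic
end

noncomputable section

namespace PlaneSextic

/-! ### Differentials regular over a subring of a field, and localization. -/

section DifferentialSpan

variable {k L : Type*} [Field k] [Field L] [Algebra k L]

/-- The differentials `∑ aᵢ dbᵢ` with `aᵢ, bᵢ` in a subring `R` of the field `L`. -/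
def differentialSpan (R : Subalgebra k L) : Submodule R (Ω[L⁄k]) :=
  Submodule.span R (Set.range fun b : R => KaehlerDifferential.D k L b)

lemma D_mem_differentialSpan {R : Subalgebra k L} {b : L} (hb : b ∈ R) :
    KaehlerDifferential.D k L b ∈ differentialSpan R :=
  Submodule.subset_span ⟨⟨b, hb⟩, rfl⟩

lemma smul_mem_differentialSpan {R : Subalgebra k L} {a : L} (ha : a ∈ R) {ω : Ω[L⁄k]}
    (hω : ω ∈ differentialSpan R) : a • ω ∈ differentialSpan R :=
  (differentialSpan R).smul_mem ⟨a, ha⟩ hω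

lemma differentialSpan_mono {R O : Subalgebra k L} (h : R ≤ O) {ω : Ω[L⁄k]}
    (hω : ω ∈ differentialSpan R) : ω ∈ differentialSpan O := by
  induction hω using Submodule.span_induction with
  | mem ω hω =>
    obtain ⟨b, rfl⟩ := hω
    exact D_mem_differentialSpan (h b.2)
  | zero => exact zero_mem _
  | add ω η _ _ h1 h2 => exact add_mem h1 h2
  | smul a ω _ h1 => exact smul_mem_differentialSpan (h a.2) h1

/-- The quotient rule `b² d(a/b) = b da - a db`: the denominators of a differential regular over `O`
can be cleared by an element of `R` invertible in `O`. -/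
lemma exists_smul_mem_differentialSpan {R O : Subalgebra k L}
    (h : ∀ z ∈ O, ∃ a ∈ R, ∃ b ∈ R, b ≠ 0 ∧ b⁻¹ ∈ O ∧ z = a / b) {ω : Ω[L⁄k]}
    (hω : ω ∈ differentialSpan O) :
    ∃ s ∈ R, s ≠ 0 ∧ s⁻¹ ∈ O ∧ s • ω ∈ differentialSpan R := by
  induction hω using Submodule.span_induction with
  | mem ω hω =>
    obtain ⟨⟨z, hz⟩, rfl⟩ := hω
    obtain ⟨a, ha, b, hb, hb0, hbO, rfl⟩ := h z hz
    refine ⟨b * b, mul_mem hb hb, mul_ne_zero hb0 hb0, ?_, ?_⟩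
    · rw [mul_inv]; exact mul_mem hbO hbO
    · have h1 : KaehlerDifferential.D k L a =
        (a / b) • KaehlerDifferential.D k L b + b • KaehlerDifferential.D k L (a / b) := by
        conv_lhs => rw [← div_mul_cancel₀ a hb0, Derivation.leibniz]
      have h2 : (b * b) • KaehlerDifferential.D k L (a / b) =
          b • KaehlerDifferential.D k L a - a • KaehlerDifferential.D k L b := by
        rw [h1, smul_add, smul_smul, smul_smul, mul_div_cancel₀ _ hb0]
        abel
      change (b * b) • KaehlerDifferential.D k L (a / b) ∈ _
      rw [h2]
      exact sub_mem (smul_mem_differentialSpan hb (D_mem_differentialSpan ha))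
        (smul_mem_differentialSpan ha (D_mem_differentialSpan hb))
  | zero => exact ⟨1, one_mem _, one_ne_zero, by simp, by simp⟩
  | add ω η _ _ h1 h2 =>
    obtain ⟨s, hs, hs0, hsO, h1⟩ := h1
    obtain ⟨t, ht, ht0, htO, h2⟩ := h2
    refine ⟨s * t, mul_mem hs ht, mul_ne_zero hs0 ht0, ?_, ?_⟩
    · rw [mul_inv]; exact mul_mem hsO htO
    · rw [smul_add]
      refine add_mem ?_ ?_
      · rw [mul_comm, mul_smul]; exact smul_mem_differentialSpan ht h1
      · rw [mul_smul]; exact smul_mem_differentialSpan hs h2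
  | smul z ω _ h1 =>
    obtain ⟨s, hs, hs0, hsO, h1⟩ := h1
    obtain ⟨z, hz⟩ := z
    obtain ⟨a, ha, b, hb, hb0, hbO, rfl⟩ := h z hz
    refine ⟨b * s, mul_mem hb hs, mul_ne_zero hb0 hs0, ?_, ?_⟩
    · rw [mul_inv]; exact mul_mem hbO hsO
    · change (b * s) • (a / b) • ω ∈ _
      rw [smul_smul, show b * s * (a / b) = a * s by field_simp, mul_smul]
      exact smul_mem_differentialSpan ha h1

/-- The multipliers that bring `ω` into the span form an ideal, which lies in no maximal ideal. -/
lemma mem_differentialSpan_of_forall_maximal (R : Subalgebra k L) {ω : Ω[L⁄k]}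
    (h : ∀ m : Ideal R, m.IsMaximal → ∃ s : R, s ∉ m ∧ (s : L) • ω ∈ differentialSpan R) :
    ω ∈ differentialSpan R := by
  let I : Ideal R := (differentialSpan R).comap (LinearMap.toSpanSingleton R _ ω)
  have hI : I = ⊤ := by
    by_contra hI
    obtain ⟨m, hm, hIm⟩ := Ideal.exists_le_maximal I hI
    obtain ⟨s, hs, hs'⟩ := h m hm
    exact hs (hIm hs')
  have h1 : (1 : R) ∈ I := hI ▸ trivial
  have h2 : (1 : R) • ω ∈ differentialSpan R := h1
  rwa [one_smul] at h2

end DifferentialSpan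

/-! ### Regular differentials of a scheme, computed on affine charts. -/

section Sections

variable {k : Type u} [Field k] (X : Over (Spec (.of k))) [IsIntegral X.left]

/-- The sections over a nonempty open subset, as a subalgebra of the function field. -/
def sectionsSubalgebra (U : X.left.Opens) [Nonempty U] : Subalgebra k X.left.functionField where
  toSubsemiring := (X.left.germToFunctionField U).hom.rangeS
  algebraMap_mem' a := ⟨X.left.presheaf.map (homOfLE le_top).op
      (((Scheme.ΓSpecIso (.of k)).inv ≫ X.hom.appTop).hom a),
    X.left.presheaf.germ_res_apply (homOfLE le_top) (genericPoint X.left) _ _⟩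

lemma mem_sectionsSubalgebra {U : X.left.Opens} [Nonempty U] {z : X.left.functionField} :
    z ∈ sectionsSubalgebra X U ↔ ∃ s, X.left.germToFunctionField U s = z := Iff.rfl

lemma sectionsSubalgebra_le_localRing {U : X.left.Opens} [Nonempty U] {x : X.left} (hx : x ∈ U) :
    sectionsSubalgebra X U ≤ localRing X x := by
  rintro _ ⟨s, rfl⟩
  exact ⟨X.left.presheaf.germ U x hx s, Scheme.algebraMap_germ_eq_germToFunctionField (X := X.left) hx s⟩

/-- The isomorphism from the sections over an open subset to a subalgebra of the function field. -/
def sectionsEquiv (U : X.left.Opens) [Nonempty U] : Γ(X.left, U) ≃+* sectionsSubalgebra X U :=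
  RingEquiv.ofBijective (X.left.germToFunctionField U).hom.rangeSRestrict
    ⟨fun _ _ h => X.left.germToFunctionField_injective U congr($h.1),
      RingHom.rangeSRestrict_surjective _⟩

lemma sectionsEquiv_apply (U : X.left.Opens) [Nonempty U] (s : Γ(X.left, U)) :
    (sectionsEquiv X U s : X.left.functionField) = X.left.germToFunctionField U s := rfl

lemma exists_of_mem_localRing {U : X.left.Opens} [Nonempty U] (hU : IsAffineOpen U) {x : X.left}
    (hx : x ∈ U) {z : X.left.functionField} (hz : z ∈ localRing X x) :
    ∃ a ∈ sectionsSubalgebra X U, ∃ b ∈ sectionsSubalgebra X U, b ≠ 0 ∧ b⁻¹ ∈ localRing X x ∧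
      z = a / b := by
  obtain ⟨w, rfl⟩ := hz
  let := TopCat.Presheaf.algebra_section_stalk X.left.presheaf ⟨x, hx⟩
  have := hU.isLocalization_stalk ⟨x, hx⟩
  obtain ⟨⟨a, b⟩, hab⟩ := IsLocalization.surj (hU.primeIdealOf ⟨x, hx⟩).asIdeal.primeCompl w
  have hb : IsUnit (X.left.presheaf.germ U x hx b) :=
    IsLocalization.map_units (M := (hU.primeIdealOf ⟨x, hx⟩).asIdeal.primeCompl)
      (X.left.presheaf.stalk x) b
  have hb' := hb.map (algebraMap (X.left.presheaf.stalk x) X.left.functionField)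
  refine ⟨_, ⟨a, rfl⟩, _, ⟨b, rfl⟩, ?_, ?_, ?_⟩
  · have := hb'.ne_zero
    rwa [Scheme.algebraMap_germ_eq_germToFunctionField] at this
  · refine ⟨hb.unit⁻¹.val, ?_⟩
    have := hb'.ne_zero
    rw [← Scheme.algebraMap_germ_eq_germToFunctionField (X := X.left) hx, ← mul_eq_one_iff_eq_inv₀ this, ← map_mul]
    simp
  · have := hb'.ne_zero
    erw [← Scheme.algebraMap_germ_eq_germToFunctionField (X := X.left) hx,
      ← Scheme.algebraMap_germ_eq_germToFunctionField (X := X.left) hx]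
    rw [eq_div_iff this, ← map_mul]
    exact congr(algebraMap _ _ $hab)

/-- Every maximal ideal of the ring of sections comes from a point of `U`. Regularity there gives a
multiplier that is a unit in the local ring, hence lies outside that ideal. -/
lemma mem_differentialSpan_sectionsSubalgebra_iff {U : X.left.Opens} [Nonempty U]
    (hU : IsAffineOpen U) (ω : Ω[X.left.functionField⁄k]) :
    ω ∈ differentialSpan (sectionsSubalgebra X U) ↔ ∀ x ∈ U, ω ∈ differentialsRegularAt X x := by
  constructor
  · intro h x hx
    exact differentialSpan_mono (sectionsSubalgebra_le_localRing X hx) h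
  · intro h
    refine mem_differentialSpan_of_forall_maximal _ fun m hm => ?_
    have hm' : (m.comap (sectionsEquiv X U)).IsPrime := Ideal.comap_isPrime _ _
    let y : PrimeSpectrum Γ(X.left, U) := ⟨_, hm'⟩
    have hyU : hU.fromSpec y ∈ U := by
      have : hU.fromSpec y ∈ hU.fromSpec.opensRange := ⟨y, rfl⟩
      rwa [hU.opensRange_fromSpec] at this
    obtain ⟨s, hs, hs0, hsx, hsω⟩ := exists_smul_mem_differentialSpan
      (fun z hz => exists_of_mem_localRing X hU hyU hz) (h _ hyU)
    refine ⟨⟨s, hs⟩, fun hsm => ?_, hsω⟩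
    obtain ⟨t, rfl⟩ := hs
    have hty : t ∈ y.asIdeal := hsm
    obtain ⟨w, hw⟩ := hsx
    have hu : X.left.presheaf.germ U _ hyU t * w = 1 := by
      apply IsFractionRing.injective (X.left.presheaf.stalk (hU.fromSpec y)) X.left.functionField
      rw [map_mul, map_one, Scheme.algebraMap_germ_eq_germToFunctionField, hw]
      exact mul_inv_cancel₀ hs0
    have hty' : hU.fromSpec y ∈ X.left.basicOpen t :=
      (Scheme.mem_basicOpen _ _ _ hyU).mpr (.of_mul_eq_one _ hu)
    have hty'' : y ∈ hU.fromSpec ⁻¹ᵁ X.left.basicOpen t := hty'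
    rw [hU.fromSpec_preimage_basicOpen] at hty''
    exact hty'' hty

lemma mem_regularDifferentials_iff {J : Type*} (U : J → X.left.Opens) [∀ j, Nonempty (U j)]
    (hU : ∀ j, IsAffineOpen (U j)) (hcov : ∀ x, ∃ j, x ∈ U j) (ω : Ω[X.left.functionField⁄k]) :
    ω ∈ regularDifferentials X ↔ ∀ j, ω ∈ differentialSpan (sectionsSubalgebra X (U j)) := by
  simp only [mem_differentialSpan_sectionsSubalgebra_iff X (hU _), regularDifferentials,
    Submodule.mem_iInf]
  refine ⟨fun h j x _ => h x, fun h x => ?_⟩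
  obtain ⟨j, hj⟩ := hcov x
  exact h j x hj

end Sections

end PlaneSextic
end

noncomputable section

namespace PlaneSextic

/-! ### Algebra and differentials of the affine curve `y² = f(x)`, `z² = g(x)`. -/

section Biquadratic

open Polynomial

variable {k L : Type*} [Field k] [Field L] [Algebra k L]

/-- If `b ≠ 0`, then `b² ∣ a²` gives `b ∣ a`, so `f` is a square, which a squarefree nonunit cannot
be. -/
lemma eq_zero_of_sq_eq_mul_sq {f a b : k[X]} (hf : Squarefree f) (hfu : ¬ IsUnit f)
    (h : a ^ 2 = f * b ^ 2) : a = 0 ∧ b = 0 := by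
  by_cases hb : b = 0
  · subst hb; simpa using h
  exfalso
  obtain ⟨c, rfl⟩ : b ∣ a := (IsIntegrallyClosed.pow_dvd_pow_iff two_ne_zero).mp ⟨f, by rw [h, mul_comm]⟩
  have hc : f = c * c := by
    apply mul_right_cancel₀ (pow_ne_zero 2 hb)
    rw [← h]; ring
  exact hfu (hc ▸ (hf c (hc ▸ dvd_rfl)).mul (hf c (hc ▸ dvd_rfl)))

/-- `x, y, z` satisfy `y² = f(x)` and `z² = g(x)`, and these equations define a smooth curve. -/
structure IsBiquadratic (f g : k[X]) (x y z : L) : Prop where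
  transcendental : Transcendental k x
  sq_left : y ^ 2 = aeval x f
  sq_right : z ^ 2 = aeval x g
  separable_left : f.Separable
  separable_right : g.Separable
  coprime : IsCoprime f g
  not_isUnit_left : ¬ IsUnit f
  not_isUnit_right : ¬ IsUnit g

namespace IsBiquadratic

variable {f g : k[X]} {x y z : L} (h : IsBiquadratic f g x y z)

include h

lemma aeval_eq_zero_iff {a : k[X]} : aeval x a = 0 ↔ a = 0 :=
  map_eq_zero_iff _ (transcendental_iff_injective.mp h.transcendental)

lemma left_ne_zero : f ≠ 0 := h.separable_left.ne_zero

lemma right_ne_zero : g ≠ 0 := h.separable_right.ne_zero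

lemma y_ne_zero : y ≠ 0 := by
  rintro rfl
  have := h.sq_left
  rw [zero_pow two_ne_zero, eq_comm, h.aeval_eq_zero_iff] at this
  exact h.left_ne_zero this

lemma z_ne_zero : z ≠ 0 := by
  rintro rfl
  have := h.sq_right
  rw [zero_pow two_ne_zero, eq_comm, h.aeval_eq_zero_iff] at this
  exact h.right_ne_zero this

lemma x_ne_zero : x ≠ 0 := by
  rintro rfl
  exact h.transcendental isAlgebraic_zero

lemma coeff_eq_zero_of_add_mul_y {a b : k[X]} (hab : aeval x a + aeval x b * y = 0) :
    a = 0 ∧ b = 0 := by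
  refine eq_zero_of_sq_eq_mul_sq h.separable_left.squarefree h.not_isUnit_left ?_
  rw [← sub_eq_zero, ← h.aeval_eq_zero_iff]
  simp only [map_sub, map_mul, map_pow, ← h.sq_left]
  linear_combination (aeval x a - aeval x b * y) * hab

/-- None of `f`, `g`, `f g` is a square in `k(x)`, so `1, y, z, yz` are independent over `k(x)`. -/
lemma coeff_eq_zero (h2 : (2 : k) ≠ 0) {a b c d : k[X]}
    (habcd : aeval x a + aeval x b * y + aeval x c * z + aeval x d * (y * z) = 0) :
    a = 0 ∧ b = 0 ∧ c = 0 ∧ d = 0 := by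
  have hf := h.separable_left.squarefree
  have hg := h.separable_right.squarefree
  have hfg : Squarefree (f * g) := (squarefree_mul_iff).mpr ⟨h.coprime.isRelPrime, hf, hg⟩
  have hfgu : ¬ IsUnit (f * g) := fun hu => h.not_isUnit_left (isUnit_of_mul_isUnit_left hu)
  have h2' : (C (2 : k)) ≠ 0 := by simpa using h2
  -- The relation times its conjugate under `z ↦ -z`, which no longer involves `z`.
  have key : aeval x (a ^ 2 + b ^ 2 * f - c ^ 2 * g - d ^ 2 * (f * g)) +
      aeval x (C 2 * (a * b - c * d * g)) * y = 0 := by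
    simp only [map_sub, map_add, map_mul, map_pow, ← h.sq_left, ← h.sq_right, map_ofNat]
    linear_combination (aeval x a + aeval x b * y - aeval x c * z - aeval x d * (y * z)) * habcd
  obtain ⟨e1, e2⟩ := h.coeff_eq_zero_of_add_mul_y key
  replace e2 := (mul_eq_zero.mp e2).resolve_left h2'
  -- Eliminating `b` makes `a²` equal to `g` or `f g` times a square.
  have e3 : (a ^ 2 - g * c ^ 2) * (a ^ 2 - (f * g) * d ^ 2) = 0 := by
    linear_combination a ^ 2 * e1 - f * (a * b + c * d * g) * e2
  rcases mul_eq_zero.mp e3 with e | e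
  · obtain ⟨rfl, rfl⟩ := eq_zero_of_sq_eq_mul_sq hg h.not_isUnit_right (sub_eq_zero.mp e)
    have : b ^ 2 = g * d ^ 2 := by
      apply mul_right_cancel₀ h.left_ne_zero
      linear_combination e1
    obtain ⟨rfl, rfl⟩ := eq_zero_of_sq_eq_mul_sq hg h.not_isUnit_right this
    simp
  · obtain ⟨rfl, rfl⟩ := eq_zero_of_sq_eq_mul_sq hfg hfgu (sub_eq_zero.mp e)
    have : (b * f) ^ 2 = (f * g) * c ^ 2 := by linear_combination f * e1
    obtain ⟨h1, rfl⟩ := eq_zero_of_sq_eq_mul_sq hfg hfgu this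
    simpa [h.left_ne_zero] using h1

lemma mem_adjoin_iff {b : L} : b ∈ Algebra.adjoin k {x, y, z} ↔ ∃ p q r s : k[X],
    b = aeval x p + aeval x q * y + aeval x r * z + aeval x s * (y * z) := by
  constructor
  · intro hb
    induction hb using Algebra.adjoin_induction with
    | mem b hb =>
      rcases hb with rfl | rfl | rfl
      · exact ⟨X, 0, 0, 0, by simp⟩
      · exact ⟨0, 1, 0, 0, by simp⟩
      · exact ⟨0, 0, 1, 0, by simp⟩
    | algebraMap a => exact ⟨C a, 0, 0, 0, by simp⟩
    | add b c _ _ hb hc =>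
      obtain ⟨p, q, r, s, rfl⟩ := hb
      obtain ⟨p', q', r', s', rfl⟩ := hc
      exact ⟨p + p', q + q', r + r', s + s', by simp only [map_add]; ring⟩
    | mul b c _ _ hb hc =>
      obtain ⟨p, q, r, s, rfl⟩ := hb
      obtain ⟨p', q', r', s', rfl⟩ := hc
      refine ⟨p * p' + q * q' * f + r * r' * g + s * s' * (f * g),
        p * q' + q * p' + (r * s' + s * r') * g, p * r' + r * p' + (q * s' + s * q') * f,
        p * s' + s * p' + q * r' + r * q', ?_⟩
      simp only [map_add, map_mul, ← h.sq_left, ← h.sq_right]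
      ring
  · rintro ⟨p, q, r, s, rfl⟩
    have hx : ∀ p : k[X], aeval x p ∈ Algebra.adjoin k {x, y, z} := fun p =>
      Algebra.adjoin_mono (by simp) (aeval_mem_adjoin_singleton k x (p := p))
    have hy : y ∈ Algebra.adjoin k {x, y, z} := Algebra.subset_adjoin (by simp)
    have hz : z ∈ Algebra.adjoin k {x, y, z} := Algebra.subset_adjoin (by simp)
    exact add_mem (add_mem (add_mem (hx p) (mul_mem (hx q) hy)) (mul_mem (hx r) hz))
      (mul_mem (hx s) (mul_mem hy hz))

end IsBiquadratic

section Differentials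

open KaehlerDifferential

/-- By the Leibniz rule it is enough to check the generators of the ring. -/
lemma exists_eq_of_mem_differentialSpan_adjoin {S : Set L} {c : L} {η : Ω[L⁄k]}
    (hS : ∀ b ∈ S, ∃ a ∈ Algebra.adjoin k S, D k L b = (a / c) • η) {ω : Ω[L⁄k]}
    (hω : ω ∈ differentialSpan (Algebra.adjoin k S)) :
    ∃ a ∈ Algebra.adjoin k S, ω = (a / c) • η := by
  induction hω using Submodule.span_induction with
  | mem ω hω =>
    obtain ⟨⟨b, hb⟩, rfl⟩ := hω
    change ∃ a ∈ Algebra.adjoin k S, D k L b = _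
    induction hb using Algebra.adjoin_induction with
    | mem b hb => exact hS b hb
    | algebraMap a => exact ⟨0, zero_mem _, by simp⟩
    | add a b _ _ ha hb =>
      obtain ⟨a', ha', ha⟩ := ha
      obtain ⟨b', hb', hb⟩ := hb
      exact ⟨a' + b', add_mem ha' hb', by rw [map_add, ha, hb, add_div, add_smul]⟩
    | mul a b haR hbR ha hb =>
      obtain ⟨a', ha', ha⟩ := ha
      obtain ⟨b', hb', hb⟩ := hb
      refine ⟨a * b' + b * a', add_mem (mul_mem haR hb') (mul_mem hbR ha'), ?_⟩
      rw [Derivation.leibniz, ha, hb, smul_smul, smul_smul, ← add_smul]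
      congr 1
      ring
  | zero => exact ⟨0, zero_mem _, by simp⟩
  | add ω η _ _ h1 h2 =>
    obtain ⟨a, ha, rfl⟩ := h1
    obtain ⟨b, hb, rfl⟩ := h2
    exact ⟨a + b, add_mem ha hb, by rw [add_div, add_smul]⟩
  | smul b ω _ h1 =>
    obtain ⟨a, ha, rfl⟩ := h1
    refine ⟨b * a, mul_mem b.2 ha, ?_⟩
    rw [mul_div_assoc, mul_smul]
    rfl

namespace IsBiquadratic

variable {f g : k[X]} {x y z : L} (h : IsBiquadratic f g x y z) (h2 : (2 : k) ≠ 0)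

include h

lemma two_mul_smul_D_y : (2 * y) • D k L y = aeval x (derivative f) • D k L x := by
  rw [← Derivation.map_aeval, ← h.sq_left, Derivation.leibniz_pow]
  simp [mul_smul, two_smul]

lemma two_mul_smul_D_z : (2 * z) • D k L z = aeval x (derivative g) • D k L x := by
  rw [← Derivation.map_aeval, ← h.sq_right, Derivation.leibniz_pow]
  simp [mul_smul, two_smul]

-- The module is free on `dx/(yz)`. One inclusion is `2y dy = f' dx` and `2z dz = g' dx`.
-- Conversely, `u f + v f' = 1` gives `dx/y = u y dx + 2v dy`, likewise for `dx/z`, and `e f + e' g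
-- = 1` gives `dx/(yz) = e y · dx/z + e' z · dx/y`.
include h2 in
lemma mem_differentialSpan_iff {ω : Ω[L⁄k]} :
    ω ∈ differentialSpan (Algebra.adjoin k {x, y, z}) ↔
      ∃ a ∈ Algebra.adjoin k {x, y, z}, ω = (a / (y * z)) • D k L x := by
  have h2L : (2 : L) ≠ 0 := by
    have := (map_ne_zero (algebraMap k L)).mpr h2
    rwa [map_ofNat] at this
  have hy0 := h.y_ne_zero
  have hz0 := h.z_ne_zero
  set R := Algebra.adjoin k {x, y, z} with hR
  have hx : x ∈ R := Algebra.subset_adjoin (by simp)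
  have hy : y ∈ R := Algebra.subset_adjoin (by simp)
  have hz : z ∈ R := Algebra.subset_adjoin (by simp)
  have hp (p : k[X]) : aeval x p ∈ R :=
    Algebra.adjoin_mono (by simp) (aeval_mem_adjoin_singleton k x (p := p))
  have h2R : (2 : L)⁻¹ ∈ R := by
    have := R.algebraMap_mem (2⁻¹ : k)
    rwa [map_inv₀, map_ofNat] at this
  have hDy : D k L y = (2⁻¹ * aeval x (derivative f) * z / (y * z)) • D k L x := by
    rw [show (2⁻¹ * aeval x (derivative f) * z / (y * z)) = (2 * y)⁻¹ * aeval x (derivative f) by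
      field_simp, mul_smul, ← h.two_mul_smul_D_y, smul_smul, inv_mul_cancel₀ (by simp [*]),
      one_smul]
  have hDz : D k L z = (2⁻¹ * aeval x (derivative g) * y / (y * z)) • D k L x := by
    rw [show (2⁻¹ * aeval x (derivative g) * y / (y * z)) = (2 * z)⁻¹ * aeval x (derivative g) by
      field_simp, mul_smul, ← h.two_mul_smul_D_z, smul_smul, inv_mul_cancel₀ (by simp [*]),
      one_smul]
  have hDx : D k L x = (y * z / (y * z)) • D k L x := by
    rw [div_self (mul_ne_zero hy0 hz0), one_smul]
  constructor
  · refine exists_eq_of_mem_differentialSpan_adjoin ?_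
    rintro b (rfl | rfl | rfl)
    · exact ⟨_, mul_mem hy hz, hDx⟩
    · exact ⟨_, mul_mem (mul_mem h2R (hp _)) hz, hDy⟩
    · exact ⟨_, mul_mem (mul_mem h2R (hp _)) hy, hDz⟩
  · rintro ⟨a, ha, rfl⟩
    obtain ⟨u, v, huv⟩ := h.separable_left
    obtain ⟨u', v', huv'⟩ := h.separable_right
    obtain ⟨e, e', hee⟩ := h.coprime
    replace huv := congr(aeval x $huv)
    replace huv' := congr(aeval x $huv')
    replace hee := congr(aeval x $hee)
    simp only [map_add, map_mul, map_one, ← h.sq_left, ← h.sq_right] at huv huv' hee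
    have mDx := D_mem_differentialSpan hx
    have mDy := D_mem_differentialSpan hy
    have mDz := D_mem_differentialSpan hz
    have two : (2 : L) ∈ R := ofNat_mem R 2
    have mz : (z / (y * z)) • D k L x ∈ differentialSpan R := by
      have : (z / (y * z)) • D k L x =
          (aeval x u * y) • D k L x + (2 * aeval x v) • D k L y := by
        rw [hDy, smul_smul, ← add_smul]
        congr 1
        field_simp
        linear_combination -huv
      rw [this]
      exact add_mem (smul_mem_differentialSpan (mul_mem (hp _) hy) mDx)
        (smul_mem_differentialSpan (mul_mem two (hp _)) mDy)
    have my : (y / (y * z)) • D k L x ∈ differentialSpan R := by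
      have : (y / (y * z)) • D k L x =
          (aeval x u' * z) • D k L x + (2 * aeval x v') • D k L z := by
        rw [hDz, smul_smul, ← add_smul]
        congr 1
        field_simp
        linear_combination -huv'
      rw [this]
      exact add_mem (smul_mem_differentialSpan (mul_mem (hp _) hz) mDx)
        (smul_mem_differentialSpan (mul_mem two (hp _)) mDz)
    have : (a / (y * z)) • D k L x = (a * aeval x e * y) • (y / (y * z)) • D k L x +
        (a * aeval x e' * z) • (z / (y * z)) • D k L x := by
      rw [smul_smul, smul_smul, ← add_smul]
      congr 1
      field_simp
      linear_combination -a * hee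
    rw [this]
    exact add_mem (smul_mem_differentialSpan (mul_mem (mul_mem ha (hp _)) hy) my)
      (smul_mem_differentialSpan (mul_mem (mul_mem ha (hp _)) hz) mz)

end IsBiquadratic

/-- The elements of a field extension whose differentials lie in a subspace. -/
lemma D_mem_of_mem_adjoin (M : Submodule L (Ω[L⁄k])) {S : Set L} (hS : ∀ s ∈ S, D k L s ∈ M)
    {b : L} (hb : b ∈ IntermediateField.adjoin k S) : D k L b ∈ M := by
  induction hb using IntermediateField.adjoin_induction with
  | mem b hb => exact hS b hb
  | algebraMap a => simp
  | add a b _ _ ha hb => rw [map_add]; exact add_mem ha hb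
  | mul a b _ _ ha hb =>
    rw [Derivation.leibniz]; exact add_mem (M.smul_mem _ hb) (M.smul_mem _ ha)
  | inv a _ ha => rw [Derivation.leibniz_inv]; exact M.smul_mem _ ha

lemma eq_top_of_D_mem (M : Submodule L (Ω[L⁄k])) {S : Set L} (hS : ∀ s ∈ S, D k L s ∈ M)
    (hT : IntermediateField.adjoin k S = ⊤) : M = ⊤ := by
  rw [eq_top_iff, ← span_range_derivation, Submodule.span_le]
  rintro _ ⟨b, rfl⟩
  exact D_mem_of_mem_adjoin M hS (hT ▸ trivial)

/-- A finitely generated extension without differentials is unramified, hence separable algebraic.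
-/
lemma nontrivial_kaehlerDifferential (hfg : (⊤ : IntermediateField k L).FG)
    {x : L} (hx : Transcendental k x) : Nontrivial (Ω[L⁄k]) := by
  by_contra hn
  rw [not_nontrivial_iff_subsingleton] at hn
  have : Algebra.FormallyUnramified k L := ⟨hn⟩
  have : Algebra.EssFiniteType k L := IntermediateField.fg_top_iff.mp hfg
  have := Algebra.FormallyUnramified.isSeparable k L
  exact hx (Algebra.IsAlgebraic.isAlgebraic x)

end Differentials

end Biquadratic

end PlaneSextic
end

noncomputable section

namespace PlaneSextic

/-! ### Depressed quartics and their reversals, which describe the curve near `x = ∞`. -/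

section Quartic

open Polynomial

/-- The depressed monic quartic polynomial with the given lower coefficients. -/
def quartic {k : Type*} [Field k] (a b c : k) : k[X] := X ^ 4 + C a * X ^ 2 + C b * X + C c

/-- The reverse of a depressed monic quartic polynomial. -/
def reverseQuartic {k : Type*} [Field k] (a b c : k) : k[X] :=
  C c * X ^ 4 + C b * X ^ 3 + C a * X ^ 2 + 1

variable {k L : Type*} [Field k] [Field L] [Algebra k L] (a b c a' b' c' : k)

lemma natDegree_quartic : (quartic a b c).natDegree = 4 := by
  unfold quartic; compute_degree!

lemma natDegree_reverseQuartic (hc : c ≠ 0) : (reverseQuartic a b c).natDegree = 4 := by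
  unfold reverseQuartic; compute_degree!

lemma not_isUnit_of_natDegree {f : k[X]} (hf : f.natDegree = 4) : ¬ IsUnit f := fun h => by
  have := natDegree_eq_zero_of_isUnit h
  omega

lemma eval_quartic (t : k) : (quartic a b c).eval t = t ^ 4 + a * t ^ 2 + b * t + c := by
  simp [quartic]

lemma eval_reverseQuartic (t : k) :
    (reverseQuartic a b c).eval t = c * t ^ 4 + b * t ^ 3 + a * t ^ 2 + 1 := by
  simp [reverseQuartic]

lemma eval_derivative_quartic (t : k) :
    (derivative (quartic a b c)).eval t = 4 * t ^ 3 + 2 * a * t + b := by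
  simp [quartic]; ring

lemma eval_derivative_reverseQuartic (t : k) :
    (derivative (reverseQuartic a b c)).eval t = 4 * c * t ^ 3 + 3 * b * t ^ 2 + 2 * a * t := by
  simp [reverseQuartic]; ring

lemma aeval_quartic (t : L) : aeval t (quartic a b c) =
    t ^ 4 + algebraMap k L a * t ^ 2 + algebraMap k L b * t + algebraMap k L c := by
  simp [quartic]

lemma aeval_reverseQuartic (t : L) : aeval t (reverseQuartic a b c) =
    algebraMap k L c * t ^ 4 + algebraMap k L b * t ^ 3 + algebraMap k L a * t ^ 2 + 1 := by
  simp [reverseQuartic]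

lemma isCoprime_of_forall_eval [IsAlgClosed k] {p q : k[X]}
    (h : ∀ t, p.eval t = 0 → q.eval t = 0 → False) : IsCoprime p q := by
  rw [isCoprime_iff_aeval_ne_zero_of_isAlgClosed k k]
  intro t
  by_contra! ht
  simp only [coe_aeval_eq_eval] at ht
  exact h t ht.1 ht.2

variable {a b c a' b' c'}

lemma separable_quartic [IsAlgClosed k]
    (h : ∀ t : k, t ^ 4 + a * t ^ 2 + b * t + c = 0 → 4 * t ^ 3 + 2 * a * t + b = 0 → False) :
    (quartic a b c).Separable :=
  isCoprime_of_forall_eval fun t h1 h2 => h t (by rwa [eval_quartic] at h1)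
    (by rwa [eval_derivative_quartic] at h2)

/-- The roots of the reversed quartic are nonzero, its constant term being 1, and they are inverse
to roots of the quartic; a common root with the derivative is carried to a common root. -/
lemma separable_reverseQuartic [IsAlgClosed k]
    (h : ∀ t : k, t ^ 4 + a * t ^ 2 + b * t + c = 0 → 4 * t ^ 3 + 2 * a * t + b = 0 → False) :
    (reverseQuartic a b c).Separable := by
  refine isCoprime_of_forall_eval fun t h1 h2 => ?_
  rw [eval_reverseQuartic] at h1
  rw [eval_derivative_reverseQuartic] at h2
  have ht : t ≠ 0 := by rintro rfl; simp at h1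
  refine h t⁻¹ ?_ ?_
  · field_simp
    linear_combination h1
  · field_simp
    linear_combination 4 * h1 - t * h2

lemma isCoprime_quartic [IsAlgClosed k]
    (h : ∀ t : k, t ^ 4 + a * t ^ 2 + b * t + c = 0 → t ^ 4 + a' * t ^ 2 + b' * t + c' = 0 → False) :
    IsCoprime (quartic a b c) (quartic a' b' c') :=
  isCoprime_of_forall_eval fun t h1 h2 => h t (by rwa [eval_quartic] at h1)
    (by rwa [eval_quartic] at h2)

lemma isCoprime_reverseQuartic [IsAlgClosed k]
    (h : ∀ t : k, t ^ 4 + a * t ^ 2 + b * t + c = 0 → t ^ 4 + a' * t ^ 2 + b' * t + c' = 0 → False) :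
    IsCoprime (reverseQuartic a b c) (reverseQuartic a' b' c') := by
  refine isCoprime_of_forall_eval fun t h1 h2 => ?_
  rw [eval_reverseQuartic] at h1 h2
  have ht : t ≠ 0 := by rintro rfl; simp at h1
  refine h t⁻¹ ?_ ?_
  · field_simp
    linear_combination h1
  · field_simp
    linear_combination h2

end Quartic

/-! ### The five-dimensional space of regular differentials. -/

section Canonical

open Polynomial KaehlerDifferential

variable {k L : Type*} [Field k] [Field L] [Algebra k L]

/-- Data defining a smooth biquadratic cover of the projective line of genus five. -/
structure IsBiquadraticPair (a b c a' b' c' : k) : Prop where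
  two_ne_zero : (2 : k) ≠ 0
  left_ne_zero : c ≠ 0
  right_ne_zero : c' ≠ 0
  separable_left : ∀ t : k, t ^ 4 + a * t ^ 2 + b * t + c = 0 → 4 * t ^ 3 + 2 * a * t + b = 0 → False
  separable_right : ∀ t : k,
    t ^ 4 + a' * t ^ 2 + b' * t + c' = 0 → 4 * t ^ 3 + 2 * a' * t + b' = 0 → False
  coprime : ∀ t : k, t ^ 4 + a * t ^ 2 + b * t + c = 0 → t ^ 4 + a' * t ^ 2 + b' * t + c' = 0 → False

/-- The coefficients of a basis of the regular differentials with respect to `dx / (yz)`. -/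
def canonicalFunctions (x y z : L) : Fin 5 → L := ![1, x, x ^ 2, y, z]

/-- Generators of the function field of the curve `y² = f(x), z² = g(x)`. -/
structure IsCurveGenerators (a b c a' b' c' : k) (x y z : L) : Prop where
  pair : IsBiquadraticPair a b c a' b' c'
  transcendental : Transcendental k x
  sq_left : y ^ 2 = aeval x (quartic a b c)
  sq_right : z ^ 2 = aeval x (quartic a' b' c')
  adjoin_eq_top : IntermediateField.adjoin k {x, y, z} = ⊤

namespace IsCurveGenerators

variable {a b c a' b' c' : k} {x y z : L}
  (h : IsCurveGenerators a b c a' b' c' x y z)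

include h

lemma fg_top : (⊤ : IntermediateField k L).FG := by
  classical
  exact ⟨{x, y, z}, by simpa using h.adjoin_eq_top⟩

variable [IsAlgClosed k]

lemma isBiquadratic : IsBiquadratic (quartic a b c) (quartic a' b' c') x y z where
  transcendental := h.transcendental
  sq_left := h.sq_left
  sq_right := h.sq_right
  separable_left := separable_quartic h.pair.separable_left
  separable_right := separable_quartic h.pair.separable_right
  coprime := isCoprime_quartic h.pair.coprime
  not_isUnit_left := not_isUnit_of_natDegree (natDegree_quartic _ _ _)
  not_isUnit_right := not_isUnit_of_natDegree (natDegree_quartic _ _ _)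

lemma x_ne_zero : x ≠ 0 := h.isBiquadratic.x_ne_zero

/-- Divide `y² = f(x)` and `z² = g(x)` by `x⁴`. Thus the chart at infinity is again biquadratic and
inherits all the affine results. -/
lemma isBiquadratic_infinity : IsBiquadratic (reverseQuartic a b c) (reverseQuartic a' b' c')
    x⁻¹ (y / x ^ 2) (z / x ^ 2) where
  transcendental := fun hx => h.transcendental (by simpa using hx.inv)
  sq_left := by
    have hx := h.x_ne_zero
    rw [div_pow, h.sq_left, aeval_quartic, aeval_reverseQuartic]
    field_simp
    ring
  sq_right := by
    have hx := h.x_ne_zero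
    rw [div_pow, h.sq_right, aeval_quartic, aeval_reverseQuartic]
    field_simp
    ring
  separable_left := separable_reverseQuartic h.pair.separable_left
  separable_right := separable_reverseQuartic h.pair.separable_right
  coprime := isCoprime_reverseQuartic h.pair.coprime
  not_isUnit_left := not_isUnit_of_natDegree (natDegree_reverseQuartic _ _ _ h.pair.left_ne_zero)
  not_isUnit_right := not_isUnit_of_natDegree (natDegree_reverseQuartic _ _ _ h.pair.right_ne_zero)

lemma span_D_x : Submodule.span L {D k L x} = ⊤ := by
  have h2 : (2 : L) ≠ 0 := by
    have := (map_ne_zero (algebraMap k L)).mpr h.pair.two_ne_zero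
    rwa [map_ofNat] at this
  refine eq_top_of_D_mem _ ?_ h.adjoin_eq_top
  have hx : D k L x ∈ Submodule.span L {D k L x} := Submodule.mem_span_singleton_self _
  have hy := h.isBiquadratic.two_mul_smul_D_y
  have hz := h.isBiquadratic.two_mul_smul_D_z
  rintro s (rfl | rfl | rfl)
  · exact hx
  · rw [← Submodule.smul_mem_iff _ (mul_ne_zero h2 h.isBiquadratic.y_ne_zero), hy]
    exact Submodule.smul_mem _ _ hx
  · rw [← Submodule.smul_mem_iff _ (mul_ne_zero h2 h.isBiquadratic.z_ne_zero), hz]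
    exact Submodule.smul_mem _ _ hx

lemma D_x_ne_zero : D k L x ≠ 0 := by
  intro h0
  have := nontrivial_kaehlerDifferential h.fg_top h.transcendental
  have h1 := h.span_D_x
  rw [h0, Submodule.span_singleton_eq_bot.mpr rfl] at h1
  exact bot_ne_top h1

end IsCurveGenerators

/-- The differentials `∑ aᵢ dbᵢ` with `aᵢ, bᵢ` in a subring `R`, as a `k`-subspace. -/
def differentialSubspace (R : Subalgebra k L) : Submodule k (Ω[L⁄k]) :=
  (differentialSpan R).restrictScalars k

lemma mem_differentialSubspace {R : Subalgebra k L} {ω : Ω[L⁄k]} :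
    ω ∈ differentialSubspace R ↔ ω ∈ differentialSpan R := Iff.rfl

lemma exists_aeval_eq_pow_mul {x : L} (hx : x ≠ 0) (q : k[X]) {N : ℕ} (hN : q.natDegree ≤ N) :
    ∃ p : k[X], p.natDegree ≤ N ∧ aeval x p = x ^ N * aeval x⁻¹ q := by
  refine ⟨q.reflect N, ?_, ?_⟩
  · rw [natDegree_le_iff_coeff_eq_zero]
    intro M hM
    rw [coeff_reflect, revAt_eq_self_of_lt hM, coeff_eq_zero_of_natDegree_lt (by omega)]
  · let : Invertible x⁻¹ := invertibleOfNonzero (inv_ne_zero hx)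
    have := eval₂_reflect_mul_pow (algebraMap k L) x⁻¹ N q hN
    rw [invOf_eq_inv, inv_inv] at this
    rw [aeval_def, aeval_def, ← this, mul_comm, mul_assoc, ← mul_pow, inv_mul_cancel₀ hx, one_pow,
      mul_one]

/-- The pole bound at infinity: the two products have equal degree. It is used with `m = 4`, `2` and
`0`, where it gives degree at most 2, degree 0, and a contradiction. -/
lemma natDegree_le_of_X_pow_mul_eq {p q : k[X]} {N m : ℕ} (hq : q.natDegree ≤ N)
    (hpq : X ^ (N + 2) * p + X ^ m * q = 0) (hp : p ≠ 0) : p.natDegree + 2 ≤ m := by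
  have h1 : (X ^ (N + 2) * p).natDegree = N + 2 + p.natDegree := by
    rw [natDegree_mul (pow_ne_zero _ X_ne_zero) hp, natDegree_X_pow]
  have h2 : (X ^ m * q).natDegree ≤ m + q.natDegree := by
    refine natDegree_mul_le.trans ?_
    rw [natDegree_X_pow]
  rw [eq_neg_of_add_eq_zero_left hpq, natDegree_neg] at h1
  omega

namespace IsCurveGenerators

variable [IsAlgClosed k] {a b c a' b' c' : k} {x y z : L}
  (h : IsCurveGenerators a b c a' b' c' x y z)

include h

/-- With `u = 1/x`, the generator `du / ((y/x²)(z/x²))` of the second chart is `-x² dx/(yz)`. So `e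
dx/(yz)` with `e = p + q y + r z + s yz` is regular on both charts exactly when `e/x²` lies in
`k[1/x, y/x², z/x²]`, that is, `deg p ≤ 2`, `q` and `r` are constant and `s = 0`. -/
lemma mem_differentialSpan_and_iff {ω : Ω[L⁄k]} :
    (ω ∈ differentialSpan (Algebra.adjoin k {x, y, z}) ∧
      ω ∈ differentialSpan (Algebra.adjoin k {x⁻¹, y / x ^ 2, z / x ^ 2})) ↔
    ω ∈ Submodule.span k (Set.range fun i => (canonicalFunctions x y z i / (y * z)) • D k L x) := by
  have hx0 := h.x_ne_zero
  have hy0 := h.isBiquadratic.y_ne_zero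
  have hz0 := h.isBiquadratic.z_ne_zero
  have hinf (e : L) : (e / (y / x ^ 2 * (z / x ^ 2))) • D k L x⁻¹ =
      (- e * x ^ 2 / (y * z)) • D k L x := by
    rw [Derivation.leibniz_inv, smul_smul]
    congr 1
    field_simp
  constructor
  · rw [h.isBiquadratic.mem_differentialSpan_iff h.pair.two_ne_zero,
      h.isBiquadratic_infinity.mem_differentialSpan_iff h.pair.two_ne_zero]
    simp only [hinf]
    rintro ⟨⟨e, he, rfl⟩, ⟨e', he', hee⟩⟩
    replace hee := smul_left_injective L h.D_x_ne_zero hee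
    rw [div_left_inj' (mul_ne_zero hy0 hz0)] at hee
    obtain ⟨p, q, r, s, rfl⟩ := h.isBiquadratic.mem_adjoin_iff.mp he
    obtain ⟨p', q', r', s', rfl⟩ := h.isBiquadratic_infinity.mem_adjoin_iff.mp he'
    let N := p'.natDegree + q'.natDegree + r'.natDegree + s'.natDegree
    obtain ⟨p'', hp, hp'⟩ := exists_aeval_eq_pow_mul hx0 p' (N := N) (by omega)
    obtain ⟨q'', hq, hq'⟩ := exists_aeval_eq_pow_mul hx0 q' (N := N) (by omega)
    obtain ⟨r'', hr, hr'⟩ := exists_aeval_eq_pow_mul hx0 r' (N := N) (by omega)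
    obtain ⟨s'', hs, hs'⟩ := exists_aeval_eq_pow_mul hx0 s' (N := N) (by omega)
    -- The equality of the two expressions times `x ^ (N + 2)`. The powers 4, 2, 2, 0 are what
    -- remains after the denominators 1, `x²`, `x²`, `x⁴` of the basis at infinity.
    have key : aeval x (X ^ (N + 2) * p + X ^ 4 * p'') + aeval x (X ^ (N + 2) * q + X ^ 2 * q'') * y +
        aeval x (X ^ (N + 2) * r + X ^ 2 * r'') * z +
        aeval x (X ^ (N + 2) * s + X ^ 0 * s'') * (y * z) = 0 := by
      simp only [map_add, map_mul, map_pow, aeval_X, hp', hq', hr', hs']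
      field_simp at hee
      simp only [one_div] at hee
      linear_combination x ^ N * hee
    obtain ⟨kp, kq, kr, ks⟩ := h.isBiquadratic.coeff_eq_zero h.pair.two_ne_zero key
    have hs0 : s = 0 := by
      by_contra hs0
      have := natDegree_le_of_X_pow_mul_eq hs ks hs0
      omega
    have hq0 : q.natDegree = 0 := by
      by_contra hq0
      have := natDegree_le_of_X_pow_mul_eq hq kq (by rintro rfl; simp at hq0)
      omega
    have hr0 : r.natDegree = 0 := by
      by_contra hr0
      have := natDegree_le_of_X_pow_mul_eq hr kr (by rintro rfl; simp at hr0)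
      omega
    have hp0 : p.natDegree ≤ 2 := by
      by_contra hp0
      have := natDegree_le_of_X_pow_mul_eq hp kp (by rintro rfl; simp at hp0)
      omega
    rw [eq_C_of_natDegree_eq_zero hq0, eq_C_of_natDegree_eq_zero hr0, hs0,
      p.as_sum_range' 3 (by omega)]
    simp only [Finset.sum_range_succ, Finset.sum_range_zero, zero_add, map_add, aeval_monomial,
      aeval_C, map_zero, zero_mul, add_zero, pow_zero, mul_one, pow_one]
    rw [Submodule.mem_span_range_iff_exists_fun]
    refine ⟨![p.coeff 0, p.coeff 1, p.coeff 2, q.coeff 0, r.coeff 0], ?_⟩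
    simp only [Fin.sum_univ_five, canonicalFunctions, Matrix.cons_val, ← smul_assoc, ← add_smul]
    congr 1
    simp only [Algebra.smul_def]
    field_simp
  · intro hω
    have hle : Submodule.span k
        (Set.range fun i => (canonicalFunctions x y z i / (y * z)) • D k L x) ≤
        differentialSubspace (Algebra.adjoin k {x, y, z}) ⊓
        differentialSubspace (Algebra.adjoin k {x⁻¹, y / x ^ 2, z / x ^ 2}) := by
      rw [Submodule.span_le]
      rintro _ ⟨i, rfl⟩
      constructor
      · rw [SetLike.mem_coe, mem_differentialSubspace, h.isBiquadratic.mem_differentialSpan_iff h.pair.two_ne_zero]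
        refine ⟨_, ?_, rfl⟩
        have hx : x ∈ Algebra.adjoin k {x, y, z} := Algebra.subset_adjoin (by simp)
        have hy : y ∈ Algebra.adjoin k {x, y, z} := Algebra.subset_adjoin (by simp)
        have hz : z ∈ Algebra.adjoin k {x, y, z} := Algebra.subset_adjoin (by simp)
        fin_cases i
        exacts [one_mem _, hx, pow_mem hx 2, hy, hz]
      · rw [SetLike.mem_coe, mem_differentialSubspace, h.isBiquadratic_infinity.mem_differentialSpan_iff h.pair.two_ne_zero]
        simp only [hinf]
        refine ⟨- (canonicalFunctions x y z i / x ^ 2), ?_, by field_simp⟩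
        have hx : x⁻¹ ∈ Algebra.adjoin k {x⁻¹, y / x ^ 2, z / x ^ 2} :=
          Algebra.subset_adjoin (by simp)
        have hy : y / x ^ 2 ∈ Algebra.adjoin k {x⁻¹, y / x ^ 2, z / x ^ 2} :=
          Algebra.subset_adjoin (by simp)
        have hz : z / x ^ 2 ∈ Algebra.adjoin k {x⁻¹, y / x ^ 2, z / x ^ 2} :=
          Algebra.subset_adjoin (by simp)
        refine neg_mem ?_
        fin_cases i
        · convert! pow_mem hx 2 using 1
          simp [canonicalFunctions]
        · convert! hx using 1
          simp [canonicalFunctions]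
          field_simp
        · convert! pow_mem hx 0 using 1
          simp [canonicalFunctions, hx0]
        · exact hy
        · exact hz
    exact hle hω

lemma linearIndependent_canonical : LinearIndependent k
    fun i => (canonicalFunctions x y z i / (y * z)) • D k L x := by
  have hy0 := h.isBiquadratic.y_ne_zero
  have hz0 := h.isBiquadratic.z_ne_zero
  rw [Fintype.linearIndependent_iff]
  intro v hv
  simp only [← smul_assoc, ← Finset.sum_smul, smul_eq_zero, h.D_x_ne_zero, or_false] at hv
  simp only [Fin.sum_univ_five, canonicalFunctions, Matrix.cons_val, Algebra.smul_def] at hv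
  have key : aeval x (C (v 0) + C (v 1) * X + C (v 2) * X ^ 2) + aeval x (C (v 3)) * y +
      aeval x (C (v 4)) * z + aeval x (0 : k[X]) * (y * z) = 0 := by
    simp only [map_add, map_mul, aeval_C, aeval_X, map_pow, map_zero]
    field_simp at hv
    linear_combination hv
  obtain ⟨h1, h3, h4, -⟩ := h.isBiquadratic.coeff_eq_zero h.pair.two_ne_zero key
  have h10 := congr(coeff $h1 0)
  have h11 := congr(coeff $h1 1)
  have h12 := congr(coeff $h1 2)
  simp [coeff_X, coeff_C] at h10 h11 h12
  intro i
  fin_cases i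
  exacts [h10, h11, h12, C_eq_zero.mp h3, C_eq_zero.mp h4]

end IsCurveGenerators

end Canonical

end PlaneSextic
end

noncomputable section

namespace PlaneSextic

/-! ### Quadratic extensions of `k(t)` and the exclusion of hyperelliptic curves. -/

section Quadratic

open Polynomial KaehlerDifferential IntermediateField

lemma dvd_of_sq_dvd_sq_mul {k : Type*} [Field k] {g c d : k[X]} (hd : Squarefree d)
    (h : g ^ 2 ∣ c ^ 2 * d) : g ∣ c := by
  by_cases hg : g = 0
  · subst hg
    rw [zero_pow two_ne_zero, zero_dvd_iff, mul_eq_zero] at h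
    rcases h with h | h
    · rw [pow_eq_zero_iff two_ne_zero] at h
      simp [h]
    · exact absurd h hd.ne_zero
  obtain ⟨e, he⟩ := (IsPrincipalIdealRing.principal (Ideal.span {g, c})).principal
  have he' : Ideal.span {e} = Ideal.span {g, c} := he.symm
  obtain ⟨g', hg'⟩ : e ∣ g := by
    rw [← Ideal.mem_span_singleton, he']; exact Ideal.subset_span (by simp)
  obtain ⟨c', hc'⟩ : e ∣ c := by
    rw [← Ideal.mem_span_singleton, he']; exact Ideal.subset_span (by simp)
  have h0 : e ≠ 0 := by
    rintro rfl
    rw [zero_mul] at hg'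
    exact hg hg'
  have hco : IsCoprime g' c' := by
    obtain ⟨u, v, huv⟩ := Ideal.mem_span_pair.mp (he' ▸ Ideal.mem_span_singleton_self e)
    refine ⟨u, v, mul_left_cancel₀ h0 ?_⟩
    linear_combination huv - u * hg' - v * hc'
  have h1 : g' ^ 2 ∣ c' ^ 2 * d := by
    rw [← mul_dvd_mul_iff_left (pow_ne_zero 2 h0), ← mul_assoc, ← mul_pow, ← mul_pow, ← hg', ← hc']
    exact h
  have h2 : g' * g' ∣ d := by
    rw [← pow_two]
    exact (hco.pow (m := 2) (n := 2)).dvd_of_dvd_mul_left h1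
  rw [hg', hc']
  exact mul_dvd_mul_left _ (hd g' h2).dvd

/-- The fractions with denominator outside a prime ideal, as a subring of the ambient field. -/
def localizationAt {k L : Type*} [Field k] [Field L] [Algebra k L] (R : Subalgebra k L)
    (m : Ideal R) [hm : m.IsPrime] : Subalgebra k L where
  carrier := {x | ∃ a b : R, a ∉ m ∧ a * x = b}
  mul_mem' := by
    rintro x y ⟨a, b, ha, hx⟩ ⟨a', b', ha', hy⟩
    refine ⟨a * a', b * b', hm.mul_notMem ha ha', ?_⟩
    push_cast
    rw [← hx, ← hy]
    ring
  add_mem' := by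
    rintro x y ⟨a, b, ha, hx⟩ ⟨a', b', ha', hy⟩
    refine ⟨a * a', a' * b + a * b', hm.mul_notMem ha ha', ?_⟩
    push_cast
    rw [← hx, ← hy]
    ring
  algebraMap_mem' r := ⟨1, algebraMap k R r, fun h => hm.ne_top ((Ideal.eq_top_iff_one m).mpr h), by
    simp⟩

variable {k L : Type*} [Field k] [Field L] [Algebra k L]

/-- `L` is generated over `k(t)` by a square root `s` of a squarefree polynomial in `t`. -/
structure IsQuadraticGenerators (t s : L) (d : k[X]) : Prop where
  two_ne_zero : (2 : k) ≠ 0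
  transcendental : Transcendental k t
  sq : s ^ 2 = aeval t d
  squarefree : Squarefree d
  not_mem : s ∉ k⟮t⟯
  exists_eq : ∀ x : L, ∃ p q r : k[X], r ≠ 0 ∧ aeval t r * x = aeval t p + aeval t q * s

namespace IsQuadraticGenerators

variable {t s : L} {d : k[X]} (h : IsQuadraticGenerators t s d)

include h

lemma aeval_eq_zero_iff {a : k[X]} : aeval t a = 0 ↔ a = 0 :=
  map_eq_zero_iff _ (transcendental_iff_injective.mp h.transcendental)

lemma two_ne_zero' : (2 : L) ≠ 0 := by
  have := (map_ne_zero (algebraMap k L)).mpr h.two_ne_zero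
  rwa [map_ofNat] at this

lemma s_ne_zero : s ≠ 0 := by
  rintro rfl
  exact h.not_mem (zero_mem _)

lemma mem_adjoin_iff {b : L} : b ∈ Algebra.adjoin k {t, s} ↔ ∃ p q : k[X],
    b = aeval t p + aeval t q * s := by
  constructor
  · intro hb
    induction hb using Algebra.adjoin_induction with
    | mem b hb =>
      rcases hb with rfl | rfl
      · exact ⟨X, 0, by simp⟩
      · exact ⟨0, 1, by simp⟩
    | algebraMap a => exact ⟨C a, 0, by simp⟩
    | add b c _ _ hb hc =>
      obtain ⟨p, q, rfl⟩ := hb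
      obtain ⟨p', q', rfl⟩ := hc
      exact ⟨p + p', q + q', by simp only [map_add]; ring⟩
    | mul b c _ _ hb hc =>
      obtain ⟨p, q, rfl⟩ := hb
      obtain ⟨p', q', rfl⟩ := hc
      refine ⟨p * p' + q * q' * d, p * q' + q * p', ?_⟩
      simp only [map_add, map_mul, ← h.sq]
      ring
  · rintro ⟨p, q, rfl⟩
    have ht : ∀ p : k[X], aeval t p ∈ Algebra.adjoin k {t, s} := fun p =>
      Algebra.adjoin_mono (by simp) (aeval_mem_adjoin_singleton k t (p := p))
    exact add_mem (ht p) (mul_mem (ht q) (Algebra.subset_adjoin (by simp)))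

/-- Since `d` is squarefree, `k[t, s]` is normal of dimension one, so its local rings are valuation
rings. Explicitly, `x = (p + q s)/r` is a root of `r² X² - 2pr X + (p² - q² d)`. Dividing by the gcd
`g` of `r²`, `p r` and `p² - q² d` leaves coefficients `α, -2β, γ` with `α, β, γ` generating the
unit ideal, and two ways to write `x` as a fraction. -/
lemma mem_localizationAt_or (m : Ideal (Algebra.adjoin k {t, s})) [hm : m.IsPrime] (x : L) :
    x ∈ localizationAt _ m ∨ x⁻¹ ∈ localizationAt _ m := by
  by_cases hx0 : x = 0
  · subst hx0
    exact .inl (zero_mem _)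
  obtain ⟨p, q, r, hr, hx⟩ := h.exists_eq x
  have hr' : aeval t r ≠ 0 := h.aeval_eq_zero_iff.not.mpr hr
  obtain ⟨g, hg⟩ := (IsPrincipalIdealRing.principal
    (Ideal.span {r ^ 2, p * r, p ^ 2 - q ^ 2 * d})).principal
  have hg' : Ideal.span {g} = Ideal.span {r ^ 2, p * r, p ^ 2 - q ^ 2 * d} := hg.symm
  obtain ⟨α, hα⟩ : g ∣ r ^ 2 := by
    rw [← Ideal.mem_span_singleton, hg']; exact Ideal.subset_span (by simp)
  obtain ⟨β, hβ⟩ : g ∣ p * r := by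
    rw [← Ideal.mem_span_singleton, hg']; exact Ideal.subset_span (by simp)
  obtain ⟨γ, hγ⟩ : g ∣ p ^ 2 - q ^ 2 * d := by
    rw [← Ideal.mem_span_singleton, hg']; exact Ideal.subset_span (by simp)
  have hg0 : g ≠ 0 := by
    rintro rfl
    rw [zero_mul] at hα
    exact hr (pow_eq_zero_iff (by norm_num) |>.mp hα)
  have hg0' : aeval t g ≠ 0 := h.aeval_eq_zero_iff.not.mpr hg0
  have hmem : g ∈ Ideal.span {r ^ 2, p * r, p ^ 2 - q ^ 2 * d} := by
    rw [← hg']; exact Ideal.mem_span_singleton_self g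
  obtain ⟨u, v, w, huvw⟩ := Submodule.mem_span_triple.mp hmem
  simp only [smul_eq_mul] at huvw
  have hone : u * α + v * β + w * γ = 1 := by
    apply mul_left_cancel₀ hg0
    linear_combination huvw - u * hα - v * hβ - w * hγ
  -- `(r q)² d = (p r)² - r² (p² - q² d)` is divisible by `g²`, and `d` is squarefree.
  obtain ⟨δ, hδ⟩ : g ∣ r * q := by
    refine dvd_of_sq_dvd_sq_mul h.squarefree ⟨β ^ 2 - α * γ, ?_⟩
    linear_combination -r ^ 2 * hγ + (p * r + g * β) * hβ - g * γ * hα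
  have eα := congr(aeval t $hα)
  have eβ := congr(aeval t $hβ)
  have eγ := congr(aeval t $hγ)
  have eδ := congr(aeval t $hδ)
  simp only [map_mul, map_pow, map_sub, ← h.sq] at eα eβ eγ eδ
  have hA (p q : k[X]) : aeval t p + aeval t q * s ∈ Algebra.adjoin k {t, s} :=
    h.mem_adjoin_iff.mpr ⟨p, q, rfl⟩
  have hA0 (p : k[X]) : aeval t p ∈ Algebra.adjoin k {t, s} :=
    h.mem_adjoin_iff.mpr ⟨p, 0, by simp⟩
  let a : Algebra.adjoin k {t, s} := ⟨aeval t α, hA0 α⟩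
  let b : Algebra.adjoin k {t, s} := ⟨aeval t β + aeval t δ * s, hA β δ⟩
  let e : Algebra.adjoin k {t, s} := ⟨aeval t (-β) + aeval t δ * s, hA (-β) δ⟩
  let c : Algebra.adjoin k {t, s} := ⟨aeval t (-γ), hA0 (-γ)⟩
  have r1 : (a : L) * x = b := by
    apply mul_left_cancel₀ (mul_ne_zero hg0' hr')
    simp only [a, b]
    linear_combination aeval t g * aeval t α * hx + aeval t r * eβ + s * aeval t r * eδ -
      (aeval t p + aeval t q * s) * eα
  have r2 : (e : L) * x = c := by
    have hx' : (aeval t r * x - aeval t p) ^ 2 = (aeval t q * s) ^ 2 := by rw [hx]; ring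
    apply mul_left_cancel₀ (mul_ne_zero hg0' (pow_ne_zero 2 hr'))
    simp only [b, a] at r1
    simp only [e, c, map_neg]
    have r1' : -aeval t β + aeval t δ * s = aeval t α * x - 2 * aeval t β := by
      linear_combination -r1
    rw [r1']
    linear_combination aeval t r ^ 2 * hx' - aeval t r ^ 2 * x ^ 2 * eα +
      2 * aeval t r ^ 2 * x * eβ - aeval t r ^ 2 * eγ
  have hbe : b - e = algebraMap k _ 2 * ⟨aeval t β, hA0 β⟩ := by
    ext
    change _ = algebraMap k L 2 * aeval t β
    rw [map_ofNat]
    simp [b, e]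
    ring
  -- Here `x = b/a = c/e`. If `a, b, c, e` all lay in `m`, so would `2β = b - e`, and then `1 = u α
  -- + v β + w γ`.
  by_cases ha : a ∈ m
  · by_cases hb : b ∈ m
    · by_cases hc : c ∈ m
      · by_cases he : e ∈ m
        · exfalso
          apply hm.ne_top
          rw [Ideal.eq_top_iff_one]
          have hβm : (⟨aeval t β, hA0 β⟩ : Algebra.adjoin k {t, s}) ∈ m := by
            have := m.mul_mem_left (algebraMap k _ 2⁻¹) (sub_mem hb he)
            rwa [hbe, ← mul_assoc, ← map_mul, inv_mul_cancel₀ h.two_ne_zero, map_one,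
              one_mul] at this
          have : (1 : Algebra.adjoin k {t, s}) = ⟨aeval t u, hA0 u⟩ * a +
              ⟨aeval t v, hA0 v⟩ * ⟨aeval t β, hA0 β⟩ - ⟨aeval t w, hA0 w⟩ * c := by
            ext
            have := congr(aeval t $hone)
            simp only [map_add, map_mul, map_one] at this
            simp [a, c, ← this]
          rw [this]
          exact sub_mem (add_mem (m.mul_mem_left _ ha) (m.mul_mem_left _ hβm)) (m.mul_mem_left _ hc)
        · exact .inl ⟨e, c, he, r2⟩
      · exact .inr ⟨c, e, hc, by rw [← r2, mul_inv_cancel_right₀ hx0]⟩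
    · exact .inr ⟨b, a, hb, by rw [← r1, mul_inv_cancel_right₀ hx0]⟩
  · exact .inl ⟨a, b, ha, r1⟩

lemma D_s : D k L s = (aeval t (C 2⁻¹ * derivative d) / s) • D k L t := by
  have h1 := congr((2 * s)⁻¹ • D k L $h.sq)
  have hs := h.s_ne_zero
  have h2 := h.two_ne_zero'
  rw [Derivation.map_aeval, Derivation.leibniz_pow, smul_smul] at h1
  simp only [← Nat.cast_smul_eq_nsmul L, smul_smul] at h1
  convert! h1 using 1
  · rw [show (2 * s)⁻¹ * (((2 : ℕ) : L) * s ^ (2 - 1)) = 1 by push_cast; field_simp, one_smul]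
  · congr 1
    rw [map_mul, aeval_C, map_inv₀, map_ofNat]
    field_simp

lemma exists_eq_of_mem_differentialSpan {ω : Ω[L⁄k]}
    (hω : ω ∈ differentialSpan (Algebra.adjoin k {t, s})) :
    ∃ p q : k[X], ω = (aeval t p + aeval t q / s) • D k L t := by
  have hs0 := h.s_ne_zero
  obtain ⟨a, ha, rfl⟩ := exists_eq_of_mem_differentialSpan_adjoin (c := s) (η := D k L t) (by
    rintro b (rfl | rfl)
    · exact ⟨s, Algebra.subset_adjoin (by simp), by rw [div_self hs0, one_smul]⟩
    · exact ⟨_, h.mem_adjoin_iff.mpr ⟨C 2⁻¹ * derivative d, 0, by simp⟩, h.D_s⟩) hω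
  obtain ⟨p, q, rfl⟩ := h.mem_adjoin_iff.mp ha
  exact ⟨q, p, by rw [add_div, mul_div_cancel_right₀ _ hs0, add_comm]⟩

omit h in
lemma mem_differentialSpan_of_localizationAt {ω : Ω[L⁄k]}
    (hω : ∀ m : Ideal (Algebra.adjoin k {t, s}), ∀ _ : m.IsPrime,
      ω ∈ differentialSpan (localizationAt _ m)) :
    ω ∈ differentialSpan (Algebra.adjoin k {t, s}) := by
  refine mem_differentialSpan_of_forall_maximal _ fun m hm => ?_
  have hp := hm.isPrime
  obtain ⟨s, hs, hs0, hsO, h1⟩ := exists_smul_mem_differentialSpan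
    (R := Algebra.adjoin k {t, s}) (O := localizationAt _ m) (fun z hz => by
      obtain ⟨a, b, ha, hab⟩ := hz
      have ha0 : (a : L) ≠ 0 := fun h0 => ha (by
        rw [show a = 0 from Subtype.ext h0]; exact zero_mem _)
      exact ⟨b, b.2, a, a.2, ha0, ⟨a, 1, ha, by simp [ha0]⟩, by rw [← hab]; field_simp⟩) (hω m hp)
  refine ⟨⟨s, hs⟩, fun hsm => ?_, h1⟩
  obtain ⟨a, b, ha, hab⟩ := hsO
  have : a = b * ⟨s, hs⟩ := by
    ext
    push_cast
    rw [← hab, inv_mul_cancel_right₀ hs0]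
  exact ha (this ▸ m.mul_mem_left _ hsm)

/-- Differentials that are regular at all valuations are regular on the affine quadratic curve. -/
lemma mem_differentialSpan_of_chart {a b c a' b' c' : k} {x y z : L} [IsAlgClosed k]
    (hc : IsCurveGenerators a b c a' b' c' x y z) {ω : Ω[L⁄k]}
    (h0 : ω ∈ differentialSpan (Algebra.adjoin k {x, y, z}))
    (h1 : ω ∈ differentialSpan (Algebra.adjoin k {x⁻¹, y / x ^ 2, z / x ^ 2})) :
    ω ∈ differentialSpan (Algebra.adjoin k {t, s}) := by
  refine mem_differentialSpan_of_localizationAt fun m hm => ?_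
  -- Valuation rings are integrally closed: if `u⁻¹` is in the ring, then so is `u = p(v) u⁻¹`.
  have hsq : ∀ u v : L, ∀ p : k[X], v ∈ localizationAt _ m → u ^ 2 = aeval v p →
      u ∈ localizationAt _ m := by
    intro u v p hv hu
    rcases h.mem_localizationAt_or m u with h' | h'
    · exact h'
    · by_cases hu0 : u = 0
      · rw [hu0]; exact zero_mem _
      · rw [show u = aeval v p * u⁻¹ by rw [← hu]; field_simp]
        refine mul_mem ?_ h'
        exact (Algebra.adjoin_le (by simpa using hv) : Algebra.adjoin k {v} ≤ localizationAt _ m)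
          (aeval_mem_adjoin_singleton k v)
  -- The valuation ring contains `x` or `x⁻¹`, hence the coordinate ring of one of the two charts.
  rcases h.mem_localizationAt_or m x with hx | hx
  · refine differentialSpan_mono (Algebra.adjoin_le ?_) h0
    rintro u (rfl | rfl | rfl)
    exacts [hx, hsq _ _ _ hx hc.sq_left, hsq _ _ _ hx hc.sq_right]
  · refine differentialSpan_mono (Algebra.adjoin_le ?_) h1
    rintro u (rfl | rfl | rfl)
    exacts [hx, hsq _ _ _ hx hc.isBiquadratic_infinity.sq_left,
      hsq _ _ _ hx hc.isBiquadratic_infinity.sq_right]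

lemma coeff_eq_zero {u v : L} (hu : u ∈ k⟮t⟯) (hv : v ∈ k⟮t⟯) (huv : u + v * s = 0) :
    u = 0 ∧ v = 0 := by
  have hv0 : v = 0 := by
    by_contra hv0
    apply h.not_mem
    rw [show s = -u / v by field_simp; linear_combination huv]
    exact div_mem (neg_mem hu) hv
  subst hv0
  simpa using huv

omit h in
lemma aeval_mem (p : k[X]) : aeval t p ∈ k⟮t⟯ :=
  algebra_adjoin_le_adjoin k _ (aeval_mem_adjoin_singleton k t)

lemma exists_eq_add_mul (x : L) : ∃ u ∈ k⟮t⟯, ∃ v ∈ k⟮t⟯, x = u + v * s := by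
  obtain ⟨p, q, r, hr, hx⟩ := h.exists_eq x
  have hr' : aeval t r ≠ 0 := h.aeval_eq_zero_iff.not.mpr hr
  refine ⟨_, div_mem (IsQuadraticGenerators.aeval_mem p) (IsQuadraticGenerators.aeval_mem r), _, div_mem (IsQuadraticGenerators.aeval_mem q) (IsQuadraticGenerators.aeval_mem r), ?_⟩
  field_simp
  linear_combination hx

lemma exists_eq_mul_of_sq_mem {w : L} (hw : w ∉ k⟮t⟯) (hw2 : w ^ 2 ∈ k⟮t⟯) :
    ∃ v ∈ k⟮t⟯, w = v * s := by
  obtain ⟨u, hu, v, hv, rfl⟩ := h.exists_eq_add_mul w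
  have hs2 : s ^ 2 ∈ k⟮t⟯ := h.sq ▸ IsQuadraticGenerators.aeval_mem d
  have key := (h.coeff_eq_zero (u := u ^ 2 + v ^ 2 * s ^ 2 - (u + v * s) ^ 2) (v := 2 * u * v)
    (sub_mem (add_mem (pow_mem hu 2) (mul_mem (pow_mem hv 2) hs2)) hw2)
    (mul_mem (mul_mem (ofNat_mem _ 2) hu) hv) (by ring)).2
  have h2 := h.two_ne_zero'
  rcases mul_eq_zero.mp key with h0 | rfl
  · have : u = 0 := by simpa [h2] using h0
    subst this
    exact ⟨v, hv, by simp⟩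
  · exact absurd (by simpa using hu) hw

end IsQuadraticGenerators

/-- Completing the square and clearing denominators gives elements outside `k(t)` whose squares are
polynomials in `t`. One for which this polynomial has least degree works, since a square factor
could be divided out. -/
lemma exists_isQuadraticGenerators (h2 : (2 : k) ≠ 0) {t : L} (ht : Transcendental k t)
    (hL : Module.finrank k⟮t⟯ L = 2) : ∃ (s : L) (d : k[X]), IsQuadraticGenerators t s d := by
  have hp (p : k[X]) : aeval t p ∈ k⟮t⟯ :=
    algebra_adjoin_le_adjoin k _ (aeval_mem_adjoin_singleton k t)
  have h2' : (2 : L) ≠ 0 := by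
    have := (map_ne_zero (algebraMap k L)).mpr h2
    rwa [map_ofNat] at this
  have hzero {a : k[X]} : aeval t a = 0 ↔ a = 0 :=
    map_eq_zero_iff _ (transcendental_iff_injective.mp ht)
  have hfrac {u : L} (hu : u ∈ k⟮t⟯) : ∃ p q : k[X], q ≠ 0 ∧ aeval t q * u = aeval t p := by
    obtain ⟨p, q, rfl⟩ := (mem_adjoin_simple_iff k u).mp hu
    by_cases hq : q = 0
    · exact ⟨0, 1, one_ne_zero, by simp [hq]⟩
    · exact ⟨p, q, hq, mul_div_cancel₀ _ (hzero.not.mpr hq)⟩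
  have hspan {a : L} (ha : a ∉ k⟮t⟯) (x : L) : ∃ u ∈ k⟮t⟯, ∃ v ∈ k⟮t⟯, x = u + v * a := by
    have hli : LinearIndependent k⟮t⟯ ![1, a] := by
      rw [LinearIndependent.pair_iff]
      intro u v huv
      simp only [Algebra.smul_def, mul_one, IntermediateField.algebraMap_apply] at huv
      have hv0 : v = 0 := by
        by_contra hv0
        apply ha
        have hv0' : (v : L) ≠ 0 := fun h0 => hv0 (Subtype.ext h0)
        rw [show a = -u / v by field_simp; linear_combination huv]
        exact div_mem (neg_mem u.2) v.2
      subst hv0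
      simpa using huv
    have := hli.span_eq_top_of_card_eq_finrank (by simp [hL])
    have hx : x ∈ Submodule.span k⟮t⟯ (Set.range ![1, a]) := this ▸ trivial
    rw [Submodule.mem_span_range_iff_exists_fun] at hx
    obtain ⟨w, rfl⟩ := hx
    exact ⟨w 0, (w 0).2, w 1, (w 1).2, by simp [Algebra.smul_def]⟩
  obtain ⟨a, ha⟩ : ∃ a, a ∉ k⟮t⟯ := by
    by_contra! hall
    have : k⟮t⟯ = ⊤ := eq_top_iff.mpr fun a _ => hall a
    have := IntermediateField.finrank_eq_one_iff_eq_top.mpr this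
    omega
  let S : Set k[X] := {d | ∃ s ∉ k⟮t⟯, s ^ 2 = aeval t d}
  have hS : S.Nonempty := by
    obtain ⟨u, hu, v, hv, huv⟩ := hspan ha (a ^ 2)
    obtain ⟨p, q, hq, hpq⟩ := hfrac (u := u + v ^ 2 / 4)
      (add_mem hu (div_mem (pow_mem hv 2) (ofNat_mem _ 4)))
    have hq' := hzero.not.mpr hq
    refine ⟨p * q, aeval t q * (a - v / 2), fun hmem => ha ?_, ?_⟩
    · rw [show a = aeval t q * (a - v / 2) / aeval t q + v / 2 by field_simp; ring]
      exact add_mem (div_mem hmem (hp q)) (div_mem hv (ofNat_mem _ 2))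
    · have h4 : (4 : L) ≠ 0 := by
        rw [show (4 : L) = 2 * 2 by norm_num]; exact mul_ne_zero h2' h2'
      rw [map_mul, ← hpq, show u = a ^ 2 - v * a by linear_combination -huv]
      field_simp
      ring
  obtain ⟨d, ⟨s, hs, hsd⟩, hmin⟩ := (measure (natDegree (R := k))).wf.has_min S hS
  have hd0 : d ≠ 0 := by
    rintro rfl
    rw [map_zero, pow_eq_zero_iff two_ne_zero] at hsd
    exact hs (hsd ▸ zero_mem _)
  refine ⟨s, d, h2, ht, hsd, ?_, hs, ?_⟩
  · rintro c ⟨e, rfl⟩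
    by_contra hc
    have hc0 : c ≠ 0 := by rintro rfl; simp at hd0
    have he0 : e ≠ 0 := by rintro rfl; simp at hd0
    have hc0' := hzero.not.mpr hc0
    refine hmin e ⟨s / aeval t c, fun hmem => hs ?_, ?_⟩ ?_
    · rw [show s = s / aeval t c * aeval t c by field_simp]
      exact mul_mem hmem (hp c)
    · rw [div_pow, hsd, map_mul, map_mul]
      field_simp
    · change e.natDegree < (c * c * e).natDegree
      have : c.natDegree ≠ 0 := fun h0 => hc (by
        rw [eq_C_of_natDegree_eq_zero h0] at hc0 ⊢
        exact isUnit_C.mpr (isUnit_iff_ne_zero.mpr (by simpa using hc0)))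
      rw [natDegree_mul (mul_ne_zero hc0 hc0) he0, natDegree_mul hc0 hc0]
      omega
  · intro x
    obtain ⟨u, hu, v, hv, rfl⟩ := hspan hs x
    obtain ⟨p, q, hq, hpq⟩ := hfrac hu
    obtain ⟨p', q', hq', hpq'⟩ := hfrac hv
    refine ⟨p * q', p' * q, q * q', mul_ne_zero hq hq', ?_⟩
    simp only [map_mul, ← hpq, ← hpq']
    ring

lemma adjoin_inv_eq (t : L) : k⟮t⁻¹⟯ = k⟮t⟯ := by
  apply le_antisymm
  · rw [adjoin_simple_le_iff]
    exact inv_mem (mem_adjoin_simple_self k t)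
  · rw [adjoin_simple_le_iff]
    simpa using inv_mem (mem_adjoin_simple_self k t⁻¹)

/-- The part of `ω` invariant under `s ↦ -s` is `p(t) dt`, regular also at `t = ∞`; a projective
line has no nonzero regular differentials, so only the anti-invariant part survives. -/
lemma exists_mem_of_mem_differentialSpan {t s s' : L} {d d' : k[X]}
    (h : IsQuadraticGenerators t s d) (h' : IsQuadraticGenerators t⁻¹ s' d') {ω : Ω[L⁄k]}
    (h0 : ω ∈ differentialSpan (Algebra.adjoin k {t, s}))
    (h1 : ω ∈ differentialSpan (Algebra.adjoin k {t⁻¹, s'})) (hDt : D k L t ≠ 0) :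
    ∃ v ∈ k⟮t⟯, ω = (v * s) • D k L t := by
  have ht0 : t ≠ 0 := by
    rintro rfl
    exact h.transcendental isAlgebraic_zero
  have hs0 := h.s_ne_zero
  have hs0' := h'.s_ne_zero
  have hs2 : s ^ 2 ∈ k⟮t⟯ := h.sq ▸ IsQuadraticGenerators.aeval_mem d
  have hp' (p : k[X]) : aeval t⁻¹ p ∈ k⟮t⟯ := adjoin_inv_eq (k := k) t ▸ IsQuadraticGenerators.aeval_mem p
  -- Both `s` and `s'` are square roots of elements of the same field `k(t)`, so they differ by a
  -- factor in `k(t)` and change sign together.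
  obtain ⟨e, he, rfl⟩ := h.exists_eq_mul_of_sq_mem (w := s') (adjoin_inv_eq (k := k) t ▸ h'.not_mem)
    (h'.sq ▸ hp' d')
  have he0 : e ≠ 0 := left_ne_zero_of_mul hs0'
  obtain ⟨p, q, rfl⟩ := h.exists_eq_of_mem_differentialSpan h0
  obtain ⟨p', q', hω⟩ := h'.exists_eq_of_mem_differentialSpan h1
  rw [Derivation.leibniz_inv, smul_smul] at hω
  replace hω := smul_left_injective L hDt hω
  have key := (h.coeff_eq_zero (u := aeval t p + aeval t⁻¹ p' / t ^ 2)
    (v := aeval t q / s ^ 2 + aeval t⁻¹ q' / (e * s ^ 2 * t ^ 2))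
    (add_mem (IsQuadraticGenerators.aeval_mem p) (div_mem (hp' p') (pow_mem (mem_adjoin_simple_self k t) 2)))
    (add_mem (div_mem (IsQuadraticGenerators.aeval_mem q) hs2) (div_mem (hp' q')
      (mul_mem (mul_mem he hs2) (pow_mem (mem_adjoin_simple_self k t) 2)))) (by
      field_simp at hω ⊢
      linear_combination hω)).1
  obtain ⟨p'', hp1, hp2⟩ := exists_aeval_eq_pow_mul ht0 p' le_rfl
  have hp0 : p = 0 := by
    by_contra hp0
    have := natDegree_le_of_X_pow_mul_eq (m := 0) hp1 (p := p) (by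
      rw [← h.aeval_eq_zero_iff]
      simp only [map_add, map_mul, map_pow, aeval_X, hp2]
      field_simp at key
      simp only [one_div] at key
      linear_combination t ^ p'.natDegree * key) hp0
    omega
  refine ⟨aeval t q / s ^ 2, div_mem (IsQuadraticGenerators.aeval_mem q) hs2, ?_⟩
  rw [hp0, map_zero, zero_add]
  congr 1
  field_simp

/-- Otherwise all five regular differentials have the form `v s dt` with `v ∈ k(t)`, so their ratios
`x, y, z` lie in `k(t)`. As these generate `L`, the degree would be 1. -/
lemma finrank_adjoin_ne_two [IsAlgClosed k] {a b c a' b' c' : k} {x y z : L}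
    (hc : IsCurveGenerators a b c a' b' c' x y z) (t : L) : Module.finrank k⟮t⟯ L ≠ 2 := by
  intro hL
  have : FiniteDimensional k⟮t⟯ L := .of_finrank_pos (by omega)
  have ht : Transcendental k t := by
    intro ht
    have : Algebra.IsAlgebraic k k⟮t⟯ :=
      isAlgebraic_adjoin_simple ht.isIntegral
    have : Algebra.IsAlgebraic k L := Algebra.IsAlgebraic.trans k k⟮t⟯ L
    exact hc.transcendental (Algebra.IsAlgebraic.isAlgebraic x)
  obtain ⟨s, d, h⟩ := exists_isQuadraticGenerators hc.pair.two_ne_zero ht hL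
  obtain ⟨s', d', h'⟩ := exists_isQuadraticGenerators hc.pair.two_ne_zero (t := t⁻¹)
    (fun hx => ht (by simpa using hx.inv)) (by rwa [adjoin_inv_eq])
  have hy0 := hc.isBiquadratic.y_ne_zero
  have hz0 := hc.isBiquadratic.z_ne_zero
  have hspan : Submodule.span L {D k L t} = ⊤ := by
    refine eq_top_of_D_mem (S := {t, s}) _ ?_ ?_
    · rintro _ (rfl | rfl)
      · exact Submodule.mem_span_singleton_self _
      · rw [h.D_s]
        exact Submodule.smul_mem _ _ (Submodule.mem_span_singleton_self _)
    · rw [eq_top_iff]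
      intro w _
      have hle : k⟮t⟯ ≤ IntermediateField.adjoin k {t, s} := adjoin.mono _ _ _ (by simp)
      obtain ⟨u, hu, v, hv, rfl⟩ := h.exists_eq_add_mul w
      exact add_mem (hle hu) (mul_mem (hle hv) (subset_adjoin _ _ (by simp)))
  obtain ⟨θ, hθ⟩ := Submodule.mem_span_singleton.mp (hspan ▸ trivial :
    D k L x ∈ Submodule.span L {D k L t})
  have hθ0 : θ ≠ 0 := by
    rintro rfl
    exact hc.D_x_ne_zero (by rw [← hθ, zero_smul])
  have hDt : D k L t ≠ 0 := by
    intro h0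
    exact hc.D_x_ne_zero (by rw [← hθ, h0, smul_zero])
  have key (i : Fin 5) : ∃ v ∈ k⟮t⟯, canonicalFunctions x y z i * (θ / (y * z)) = v * s := by
    obtain ⟨h0, h1⟩ := hc.mem_differentialSpan_and_iff.mpr (Submodule.subset_span ⟨i, rfl⟩)
    obtain ⟨v, hv, hv'⟩ := exists_mem_of_mem_differentialSpan h h'
      (h.mem_differentialSpan_of_chart hc h0 h1) (h'.mem_differentialSpan_of_chart hc h0 h1) hDt
    refine ⟨v, hv, ?_⟩
    simp only [← hθ, smul_smul] at hv'
    rw [← smul_left_injective L hDt hv']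
    ring
  obtain ⟨v0, hv0, h0⟩ := key 0
  have hmem (i : Fin 5) : canonicalFunctions x y z i ∈ k⟮t⟯ := by
    obtain ⟨v, hv, hi⟩ := key i
    have h0' : θ / (y * z) = v0 * s := by simpa [canonicalFunctions] using h0
    have hv00 : v0 ≠ 0 := by
      rintro rfl
      simp [hθ0, hy0, hz0] at h0'
    rw [h0', ← mul_assoc] at hi
    rw [show canonicalFunctions x y z i = v / v0 by
      rw [eq_div_iff hv00]; exact mul_right_cancel₀ h.s_ne_zero hi]
    exact div_mem hv hv0
  have htop : k⟮t⟯ = ⊤ := by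
    rw [← top_le_iff, ← hc.adjoin_eq_top, adjoin_le_iff]
    rintro _ (rfl | rfl | rfl)
    exacts [hmem 1, hmem 3, hmem 4]
  have := IntermediateField.finrank_eq_one_iff_eq_top.mpr htop
  omega

end Quadratic

end PlaneSextic
end

noncomputable section

namespace PlaneSextic

attribute [local instance] MvPolynomial.gradedAlgebra

/-! ### Morphisms to the projective line and their degrees. -/

section ResidueDegree

open HomogeneousLocalization IntermediateField

variable {k K : Type u} [Field k] [Field K] [Algebra k K] {n : ℕ}

lemma mk_X_mem (l : Fin (n + 1)) : (MvPolynomial.X l : MvPolynomial (Fin (n + 1)) k) ∈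
    MvPolynomial.homogeneousSubmodule (Fin (n + 1)) k (1 • 1) := by
  simpa using X_mem l

lemma eval₂Hom_eq_mk (j : Fin (n + 1)) {m : ℕ} (G : MvPolynomial (Fin (n + 1)) k)
    (hG : G ∈ MvPolynomial.homogeneousSubmodule (Fin (n + 1)) k (m • 1)) :
    MvPolynomial.eval₂Hom ((fromZeroRingHom (MvPolynomial.homogeneousSubmodule (Fin (n + 1)) k)
      (.powers (MvPolynomial.X j))).comp (algebraMap k _))
      (fun l => Away.mk _ (X_mem j) 1 (MvPolynomial.X l) (mk_X_mem l)) G =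
      Away.mk _ (X_mem j) m G hG := by
  apply val_injective
  rw [Away.val_mk, ← HomogeneousLocalization.algebraMap_apply]
  rw [smul_eq_mul, mul_one] at hG
  let M := Localization.Away (MvPolynomial.X j : MvPolynomial (Fin (n + 1)) k)
  have hmk (m : ℕ) (G : MvPolynomial (Fin (n + 1)) k) : (Localization.mk G
      (⟨MvPolynomial.X j ^ m, m, rfl⟩ :
        Submonoid.powers (MvPolynomial.X j : MvPolynomial (Fin (n + 1)) k)) : M) =
      IsLocalization.Away.invSelf (MvPolynomial.X j : MvPolynomial (Fin (n + 1)) k) ^ m *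
        algebraMap _ M G := by
    rw [Localization.mk_eq_mk', IsLocalization.mk'_eq_iff_eq_mul]
    have := IsLocalization.Away.mul_invSelf (S := M) (MvPolynomial.X j :
      MvPolynomial (Fin (n + 1)) k)
    rw [map_pow, mul_right_comm, ← mul_pow, mul_comm (IsLocalization.Away.invSelf _), this,
      one_pow, one_mul]
  have hcomp : (algebraMap (Away (MvPolynomial.homogeneousSubmodule (Fin (n + 1)) k)
      (MvPolynomial.X j)) M).comp (MvPolynomial.eval₂Hom
      ((fromZeroRingHom (MvPolynomial.homogeneousSubmodule (Fin (n + 1)) k)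
      (.powers (MvPolynomial.X j))).comp (algebraMap k _))
      (fun l => Away.mk _ (X_mem j) 1 (MvPolynomial.X l) (mk_X_mem l))) =
      (MvPolynomial.aeval (R := k) (S₁ := M) (fun l => IsLocalization.Away.invSelf (S := M) (MvPolynomial.X j : MvPolynomial (Fin (n + 1)) k) *
        algebraMap (MvPolynomial (Fin (n + 1)) k) M (MvPolynomial.X l))).toRingHom := by
    apply MvPolynomial.ringHom_ext
    · intro r
      simp
      exact Localization.mk_one_eq_algebraMap _
    · intro l
      rw [RingHom.comp_apply, MvPolynomial.coe_eval₂Hom, MvPolynomial.eval₂_X,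
        HomogeneousLocalization.algebraMap_apply, Away.val_mk]
      refine (hmk 1 _).trans ?_
      simp
  refine congr($hcomp G).trans ?_
  refine (aeval_mul_of_isHomogeneous _ hG _).trans ?_
  rw [hmk]
  congr 1
  have : (MvPolynomial.aeval (R := k) (fun l => algebraMap (MvPolynomial (Fin (n + 1)) k) M
      (MvPolynomial.X l))) = IsScalarTower.toAlgHom k (MvPolynomial (Fin (n + 1)) k) M := by
    ext l
    simp
  exact congr($this G)

/-- The converse of `projectivePoint`: a `K`-point over `k` in the chart of `X j` has as coordinates
the values of the fractions `X l / X j`. -/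
lemma exists_projectivePoint_eq (h : Spec (.of K) ⟶
      Proj (MvPolynomial.homogeneousSubmodule (Fin (n + 1)) k))
    (hk : h ≫ projectiveSpaceHom k n = Spec.map (CommRingCat.ofHom (algebraMap k K)))
    {j : Fin (n + 1)} (hj : h (IsLocalRing.closedPoint K) ∈ Proj.basicOpen _ (MvPolynomial.X j)) :
    ∃ (c : Fin (n + 1) → K) (hc : ∃ i, c i ≠ 0), c j = 1 ∧ h = projectivePoint c k hc := by
  have hr : Set.range h ⊆ Set.range (Proj.awayι (MvPolynomial.homogeneousSubmodule (Fin (n + 1)) k)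
      (MvPolynomial.X j) (X_mem j) one_pos) := by
    rintro _ ⟨x, rfl⟩
    rw [Subsingleton.elim x (IsLocalRing.closedPoint K)]
    rw [← Proj.opensRange_awayι _ _ (X_mem j) one_pos] at hj
    exact hj
  obtain ⟨ψ, hψ⟩ := Spec.map_surjective (IsOpenImmersion.lift _ h hr)
  have hψ' : h = Spec.map ψ ≫ Proj.awayι _ (MvPolynomial.X j) (X_mem j) one_pos := by
    rw [hψ, IsOpenImmersion.lift_fac]
  have hψk : (ψ.hom.comp (fromZeroRingHom (MvPolynomial.homogeneousSubmodule (Fin (n + 1)) k)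
      _)).comp (algebraMap k _) = algebraMap k K := by
    rw [hψ', projectiveSpaceHom, Category.assoc, Proj.awayι_toSpecZero_assoc, ← Spec.map_comp,
      ← Spec.map_comp] at hk
    exact congr($(Spec.map_injective hk).hom)
  let c : Fin (n + 1) → K := fun l => ψ.hom (Away.mk _ (X_mem j) 1 (MvPolynomial.X l) (mk_X_mem l))
  have hψG (m : ℕ) (G : MvPolynomial (Fin (n + 1)) k)
      (hG : G ∈ MvPolynomial.homogeneousSubmodule (Fin (n + 1)) k (m • 1)) :
      ψ.hom (Away.mk _ (X_mem j) m G hG) = MvPolynomial.aeval c G := by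
    rw [← eval₂Hom_eq_mk]
    have : (MvPolynomial.aeval c).toRingHom = ψ.hom.comp (MvPolynomial.eval₂Hom
        ((fromZeroRingHom (MvPolynomial.homogeneousSubmodule (Fin (n + 1)) k)
        (.powers (MvPolynomial.X j))).comp (algebraMap k _))
        (fun l => Away.mk _ (X_mem j) 1 (MvPolynomial.X l) (mk_X_mem l))) := by
      apply MvPolynomial.ringHom_ext
      · intro r
        simpa using congr($hψk r).symm
      · intro l
        simp [c]
    exact congr($this G).symm
  have hcj : c j = 1 := by
    refine Eq.trans (congrArg ψ.hom ?_) (map_one ψ.hom)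
    refine (val_injective _ ?_)
    rw [Away.val_mk, val_one]
    simp only [pow_one]
    exact Localization.mk_self (⟨MvPolynomial.X j, 1, pow_one _⟩ :
      Submonoid.powers (MvPolynomial.X j : MvPolynomial (Fin (n + 1)) k))
  have hc : ∃ i, c i ≠ 0 := ⟨j, by simp [hcj]⟩
  refine ⟨c, hc, hcj, ?_⟩
  have hF := aeval_X_ne (k := k) c (i := j) (by simp [hcj])
  rw [projectivePoint_eq c hc (X_mem j) one_pos hF, hψ']
  congr 2
  ext a
  obtain ⟨m, G, hG, rfl⟩ := Away.mk_surjective _ (X_mem j) a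
  refine (hψG m G hG).trans ?_
  refine Eq.trans ?_ (evalAway_mk c _ hF (X_mem j) m G hG).symm
  simp [hcj]


lemma exists_pointEval_projectivePoint_iff (c : Fin (n + 1) → K) (hc : ∃ i, c i ≠ 0)
    (j : Fin (n + 1)) (hj : c j ≠ 0) (hU : ⊤ ≤ projectivePoint c k hc ⁻¹ᵁ Proj.basicOpen _
      (MvPolynomial.X j)) (z : K) :
    (∃ s, pointEval (projectivePoint c k hc) _ hU s = z) ↔
      z ∈ Algebra.adjoin k (Set.range fun l => c l / c j) := by
  rw [← SetLike.mem_coe, ← range_evalAway_X c j hj]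
  have he := projectivePoint_eq c hc (X_mem j) one_pos (aeval_X_ne (k := k) c hj)
  have hO := (Proj.opensRange_awayι (MvPolynomial.homogeneousSubmodule (Fin (n + 1)) k)
    (MvPolynomial.X j) (X_mem j) one_pos)
  generalize Proj.basicOpen (MvPolynomial.homogeneousSubmodule (Fin (n + 1)) k)
    (MvPolynomial.X j) = V at hU hO
  subst hO
  exact exists_pointEval_eq_iff _ _ he hU z

lemma exists_exists_pointEval_iff (h : Spec (.of K) ⟶
      Proj (MvPolynomial.homogeneousSubmodule (Fin (n + 1)) k))
    (hk : h ≫ projectiveSpaceHom k n = Spec.map (CommRingCat.ofHom (algebraMap k K)))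
    {j : Fin (n + 1)} (hj : h (IsLocalRing.closedPoint K) ∈ Proj.basicOpen _ (MvPolynomial.X j)) :
    ∃ c : Fin (n + 1) → K, c j = 1 ∧ ∀ (hU : ⊤ ≤ h ⁻¹ᵁ Proj.basicOpen _ (MvPolynomial.X j)) (z : K),
      (∃ s, pointEval h _ hU s = z) ↔ z ∈ Algebra.adjoin k (Set.range c) := by
  obtain ⟨c, hc, hcj, rfl⟩ := exists_projectivePoint_eq h hk hj
  refine ⟨c, hcj, fun hU z => ?_⟩
  have := exists_pointEval_projectivePoint_iff c hc j (by simp [hcj]) hU z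
  simpa only [hcj, div_one] using this

lemma pointEval_fromSpecStalk {X : Scheme.{u}} {x : X} {U : X.Opens} (hx : x ∈ U)
    (hU : ⊤ ≤ X.fromSpecStalk x ⁻¹ᵁ U) :
    pointEval (X.fromSpecStalk x) U hU = X.presheaf.germ U x hx := by
  have h3 : pointEval (X.fromSpecStalk x) U hU = (X.fromSpecStalk x).app U ≫
    (Spec (X.presheaf.stalk x)).presheaf.map (homOfLE hU).op ≫ (Scheme.ΓSpecIso _).hom :=
    (Category.assoc _ _ _)
  rw [h3, Scheme.fromSpecStalk_app hx, Category.assoc, Category.assoc, ← Functor.map_comp_assoc,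
    ← op_comp, Subsingleton.elim (homOfLE hU ≫ homOfLE le_top) (𝟙 _), op_id,
    CategoryTheory.Functor.map_id,
    Category.id_comp, Iso.inv_hom_id]
  exact Category.comp_id _

variable (X : Over (Spec (.of k))) [IsIntegral X.left]

/-- The generic point as a point with values in the function field. -/
def genericPointHom : Spec (.of X.left.functionField) ⟶ X.left :=
  X.left.fromSpecStalk (genericPoint X.left)

lemma pointEval_genericPointHom (U : X.left.Opens) [h : Nonempty U]
    (hU : ⊤ ≤ genericPointHom X ⁻¹ᵁ U) (s : Γ(X.left, U)) :
    pointEval (genericPointHom X) U hU s = X.left.germToFunctionField U s := by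
  have hη : genericPoint X.left ∈ U :=
    ((genericPoint_spec X.left).mem_open_set_iff U.isOpen).mpr (by simpa using h)
  exact congr($(pointEval_fromSpecStalk hη hU).hom s)

lemma eq_SpecMap_pointEval {R S : CommRingCat.{u}} (g : Spec R ⟶ Spec S) :
    g = Spec.map ((Scheme.ΓSpecIso S).inv ≫ pointEval g ⊤ le_rfl) := by
  obtain ⟨ψ, rfl⟩ := Spec.map_surjective g
  rw [pointEval_SpecMap, Iso.inv_hom_id_assoc]

lemma genericPointHom_hom : genericPointHom X ≫ X.hom =
    Spec.map (CommRingCat.ofHom (algebraMap k X.left.functionField)) := by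
  have : Nonempty (⊤ : X.left.Opens) := ⟨⟨genericPoint X.left, trivial⟩⟩
  rw [eq_SpecMap_pointEval (genericPointHom X ≫ X.hom)]
  congr 1
  ext a
  have h1 := pointEval_comp (genericPointHom X) X.hom ⊤ le_rfl
  refine congr($(h1).hom ((Scheme.ΓSpecIso (.of k)).inv a)).trans ?_
  exact pointEval_genericPointHom X ⊤ le_rfl _

lemma genericPointHom_closedPoint :
    genericPointHom X (IsLocalRing.closedPoint X.left.functionField) = genericPoint X.left :=
  X.left.fromSpecStalk_closedPoint

/-- The residue field at the image point consists of the quotients of values of sections over an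
affine neighbourhood; `E` is its copy inside the function field. -/
lemma residueDegree_eq_finrank {X P : Scheme.{u}} [IsIntegral X] (F : X ⟶ P) {U : P.Opens}
    (hU : IsAffineOpen U) (hη : F (genericPoint X) ∈ U) [Nonempty (F ⁻¹ᵁ U)]
    (E : Subfield X.functionField)
    (hE : ∀ z, z ∈ E ↔ ∃ a b : Γ(P, U), z = X.germToFunctionField (F ⁻¹ᵁ U) (F.app U a) /
      X.germToFunctionField (F ⁻¹ᵁ U) (F.app U b)) :
    F.residueDegree (genericPoint X) = Module.finrank E X.functionField := by
  let r : X.functionField ≃+* X.residueField (genericPoint X) :=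
    RingEquiv.ofBijective (X.residue _).hom
      ⟨(X.residue _).hom.injective, X.residue_surjective _⟩
  let Ψ : P.residueField (F (genericPoint X)) →+* X.functionField :=
    r.symm.toRingHom.comp (F.residueFieldMap _).hom
  have hΨ (s : Γ(P, U)) : Ψ (P.evaluation U _ hη s) =
      X.germToFunctionField (F ⁻¹ᵁ U) (F.app U s) := by
    refine (congrArg r.symm (Scheme.evaluation_naturality_apply F _ hη s)).trans ?_
    rw [RingEquiv.symm_apply_eq]
    rfl
  have hrange (z : X.functionField) : z ∈ Set.range Ψ ↔ z ∈ E := by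
    rw [hE]
    constructor
    · rintro ⟨w, rfl⟩
      obtain ⟨v, rfl⟩ := P.residue_surjective _ w
      let := TopCat.Presheaf.algebra_section_stalk P.presheaf ⟨F (genericPoint X), hη⟩
      have := hU.isLocalization_stalk ⟨F (genericPoint X), hη⟩
      obtain ⟨⟨a, b⟩, hab⟩ :=
        IsLocalization.surj (hU.primeIdealOf ⟨F (genericPoint X), hη⟩).asIdeal.primeCompl v
      have hb : IsUnit (P.presheaf.germ U _ hη b) :=
        IsLocalization.map_units
          (M := (hU.primeIdealOf ⟨F (genericPoint X), hη⟩).asIdeal.primeCompl)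
          (P.presheaf.stalk (F (genericPoint X))) b
      have hb' : Ψ (P.evaluation U _ hη b) ≠ 0 := ((hb.map (P.residue _).hom).map Ψ).ne_zero
      have hab' : Ψ (P.residue _ v) * Ψ (P.evaluation U _ hη b) = Ψ (P.evaluation U _ hη a) := by
        rw [← map_mul]
        refine congrArg Ψ ?_
        refine Eq.trans ?_ (congrArg (P.residue (F (genericPoint X))).hom hab)
        exact (map_mul (P.residue (F (genericPoint X))).hom _ _).symm
      rw [← eq_div_iff hb', hΨ, hΨ] at hab'
      exact ⟨a, b, hab'⟩
    · rintro ⟨a, b, rfl⟩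
      exact ⟨P.evaluation U _ hη a / P.evaluation U _ hη b, by rw [map_div₀, hΨ, hΨ]⟩
  let ΨE : P.residueField (F (genericPoint X)) ≃+* E := RingEquiv.ofBijective
    (Ψ.codRestrict E fun w => (hrange _).mp ⟨w, rfl⟩)
    ⟨fun a b hab => Ψ.injective congr($(hab).1), fun z => by
      obtain ⟨w, hw⟩ := (hrange z).mpr z.2
      exact ⟨w, Subtype.ext hw⟩⟩
  let := (F.residueFieldMap (genericPoint X)).hom.toAlgebra
  refine Algebra.finrank_eq_of_equiv_equiv ΨE r.symm ?_
  ext w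
  rfl

lemma residueDegree_eq_finrank_adjoin {P : Scheme.{u}} (F : X.left ⟶ P) {U : P.Opens}
    (hU : IsAffineOpen U) (hη : F (genericPoint X.left) ∈ U) (t : X.left.functionField)
    (ht : ∀ (hU : ⊤ ≤ (genericPointHom X ≫ F) ⁻¹ᵁ U) (z : X.left.functionField),
      (∃ s, pointEval (genericPointHom X ≫ F) U hU s = z) ↔ z ∈ Algebra.adjoin k {t}) :
    F.residueDegree (genericPoint X.left) = Module.finrank k⟮t⟯ X.left.functionField := by
  have : Nonempty (F ⁻¹ᵁ U) := ⟨⟨_, hη⟩⟩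
  have hUtop' : ⊤ ≤ genericPointHom X ⁻¹ᵁ (F ⁻¹ᵁ U) := by
    intro x _
    rw [Subsingleton.elim x (IsLocalRing.closedPoint X.left.functionField)]
    change F (genericPointHom X _) ∈ U
    rw [genericPointHom_closedPoint]
    exact hη
  have hUtop : ⊤ ≤ (genericPointHom X ≫ F) ⁻¹ᵁ U := hUtop'
  have hev (z : X.left.functionField) :
      (∃ s, X.left.germToFunctionField (F ⁻¹ᵁ U) (F.app U s) = z) ↔ z ∈ Algebra.adjoin k {t} := by
    rw [← ht hUtop]
    have h1 (s : Γ(P, U)) : pointEval (genericPointHom X ≫ F) U hUtop s =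
        pointEval (genericPointHom X) (F ⁻¹ᵁ U) hUtop' (F.app U s) :=
      congr($(pointEval_comp (genericPointHom X) F U hUtop).hom s)
    have h2 (s : Γ(P, U)) : pointEval (genericPointHom X ≫ F) U hUtop s =
        X.left.germToFunctionField (F ⁻¹ᵁ U) (F.app U s) :=
      (h1 s).trans (pointEval_genericPointHom X (F ⁻¹ᵁ U) hUtop' (F.app U s))
    simp only [h2]
  refine residueDegree_eq_finrank F hU hη k⟮t⟯.toSubfield fun z => ?_
  refine (mem_adjoin_iff_div (F := k) (S := {t})).trans ?_
  constructor
  · rintro ⟨a, ha, b, hb, rfl⟩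
    obtain ⟨a', ha'⟩ := (hev a).mpr ha
    obtain ⟨b', hb'⟩ := (hev b).mpr hb
    exact ⟨a', b', by rw [ha', hb']⟩
  · rintro ⟨a, b, rfl⟩
    exact ⟨_, (hev _).mp ⟨a, rfl⟩, _, (hev _).mp ⟨b, rfl⟩, rfl⟩

lemma exists_finrank_adjoin_eq_of_comp_eq
    (F : X.left ⟶ Proj (MvPolynomial.homogeneousSubmodule (Fin (1 + 1)) k))
    (hF : F ≫ projectiveSpaceHom k 1 = X.hom) :
    ∃ t : X.left.functionField, Module.finrank k⟮t⟯ X.left.functionField =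
      F.residueDegree (genericPoint X.left) := by
  obtain ⟨j, hj⟩ := exists_mem_basicOpen_X (F (genericPoint X.left))
  obtain ⟨c, hcj, hc⟩ := exists_exists_pointEval_iff (j := j) (genericPointHom X ≫ F)
    (by rw [Category.assoc, hF, genericPointHom_hom]) (by
      change F (genericPointHom X (IsLocalRing.closedPoint X.left.functionField)) ∈ _
      rw [genericPointHom_closedPoint]
      exact hj)
  -- One of the two coordinates is 1; the other is `t`.
  obtain ⟨t, ht⟩ : ∃ t, Algebra.adjoin k (Set.range c) = Algebra.adjoin k {t} := by
    have h0 : Algebra.adjoin k {c 0, c 1} = Algebra.adjoin k (Set.range c) := by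
      congr 1
      ext z
      simp [Fin.exists_fin_two, eq_comm]
    rw [← h0]
    have h1 (z : X.left.functionField) : Algebra.adjoin k {1, z} = Algebra.adjoin k {z} := by
      refine le_antisymm (Algebra.adjoin_le ?_) (Algebra.adjoin_mono (by simp))
      rintro _ (rfl | rfl)
      exacts [one_mem _, Algebra.subset_adjoin rfl]
    obtain rfl | rfl : j = 0 ∨ j = 1 := (by decide : ∀ j : Fin (1 + 1), j = 0 ∨ j = 1) j
    · exact ⟨c 1, by rw [hcj, h1]⟩
    · exact ⟨c 0, by rw [hcj, Set.pair_comm, h1]⟩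
  refine ⟨t, ?_⟩
  have hUaff : IsAffineOpen (Proj.basicOpen (MvPolynomial.homogeneousSubmodule (Fin (1 + 1)) k)
    (MvPolynomial.X j)) := Proj.isAffineOpen_basicOpen _ _ (X_mem j) one_pos
  rw [ht] at hc
  exact (residueDegree_eq_finrank_adjoin X F hUaff hj t hc).symm

/-- The degree of a morphism from an integral scheme to the projective line is the degree of a
field extension generated by one function. -/
lemma exists_finrank_adjoin_eq (f : X ⟶ projectiveSpace k 1) :
    ∃ t : X.left.functionField, Module.finrank k⟮t⟯ X.left.functionField =
      f.left.residueDegree (genericPoint X.left) :=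
  exists_finrank_adjoin_eq_of_comp_eq X f.left (Over.w f)

end ResidueDegree

end PlaneSextic
end

noncomputable section

namespace PlaneSextic

/-! ### Smoothness of the affine biquadratic curve by infinitesimal lifting. -/

section FormallySmooth

open Polynomial

variable {k L : Type*} [Field k] [Field L] [Algebra k L]

/-- The normal form is fixed before the solution `a`. Taking `a` in `L × A` allows a relation that
holds in `L` to be transferred to `A`. -/
lemma MvPolynomial.exists_aeval_eq {A : Type*} [CommRing A] [Algebra k A] (f g : k[X])
    (P : MvPolynomial (Fin 3) k) : ∃ p q r s : k[X], ∀ a : Fin 3 → L × A,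
      a 1 ^ 2 = aeval (a 0) f → a 2 ^ 2 = aeval (a 0) g →
      MvPolynomial.aeval a P =
        aeval (a 0) p + aeval (a 0) q * a 1 + aeval (a 0) r * a 2 + aeval (a 0) s * (a 1 * a 2) := by
  induction P using MvPolynomial.induction_on with
  | C c => exact ⟨C c, 0, 0, 0, fun a _ _ => by simp⟩
  | add P Q hP hQ =>
    obtain ⟨p, q, r, s, h⟩ := hP
    obtain ⟨p', q', r', s', h'⟩ := hQ
    refine ⟨p + p', q + q', r + r', s + s', fun a hf hg => ?_⟩
    rw [map_add, h a hf hg, h' a hf hg]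
    simp only [map_add]
    ring
  | mul_X P i hP =>
    obtain ⟨p, q, r, s, h⟩ := hP
    obtain rfl | rfl | rfl : i = 0 ∨ i = 1 ∨ i = 2 := by fin_cases i <;> simp
    · refine ⟨p * X, q * X, r * X, s * X, fun a hf hg => ?_⟩
      rw [map_mul, h a hf hg]
      simp only [map_mul, aeval_X, MvPolynomial.aeval_X]
      ring
    · refine ⟨q * f, p, s * f, r, fun a hf hg => ?_⟩
      rw [map_mul, h a hf hg]
      simp only [map_mul, MvPolynomial.aeval_X, ← hf]
      ring
    · refine ⟨r * g, s * g, p, q, fun a hf hg => ?_⟩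
      rw [map_mul, h a hf hg]
      simp only [map_mul, MvPolynomial.aeval_X, ← hg]
      ring

/-- A Newton step with the Jacobian criterion made explicit. The errors `ε`, `δ` have zero squares
and product, so only the linear system `f' dx - 2y dy = ε`, `g' dx - 2z dz = δ` has to be solved. -/
lemma exists_lift_of_sq_eq {B : Type*} [CommRing B] [Algebra k B] (h2 : (2 : k) ≠ 0) {f g : k[X]}
    (hf : f.Separable) (hg : g.Separable) (hfg : IsCoprime f g) (I : Ideal B) (hI : I ^ 2 = ⊥)
    (x y z : B) (hy : y ^ 2 - aeval x f ∈ I) (hz : z ^ 2 - aeval x g ∈ I) :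
    ∃ x' y' z' : B, x' - x ∈ I ∧ y' - y ∈ I ∧ z' - z ∈ I ∧
      y' ^ 2 = aeval x' f ∧ z' ^ 2 = aeval x' g := by
  obtain ⟨a, b, hab⟩ := hf
  obtain ⟨c, d, hcd⟩ := hg
  obtain ⟨e, e', hee⟩ := hfg
  have hmul {s t : B} (hs : s ∈ I) (ht : t ∈ I) : s * t = 0 := by
    have := Ideal.mul_mem_mul hs ht
    rwa [← pow_two, hI] at this
  replace hab := congrArg (aeval x) hab
  replace hcd := congrArg (aeval x) hcd
  replace hee := congrArg (aeval x) hee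
  simp only [map_add, map_mul, map_one] at hab hcd hee
  have hh : (2 : B) * algebraMap k B 2⁻¹ = 1 := by
    rw [← map_ofNat (algebraMap k B) 2, ← map_mul, mul_inv_cancel₀ h2, map_one]
  generalize algebraMap k B 2⁻¹ = m at hh
  obtain ⟨ε, hε⟩ : ∃ ε, ε = y ^ 2 - aeval x f := ⟨_, rfl⟩
  obtain ⟨δ, hδ⟩ : ∃ δ, δ = z ^ 2 - aeval x g := ⟨_, rfl⟩
  rw [← hε] at hy
  rw [← hδ] at hz
  have hεε := hmul hy hy
  have hεδ := hmul hy hz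
  have hδδ := hmul hz hz
  let F' := aeval x (derivative f)
  let G' := aeval x (derivative g)
  let A := aeval x a
  let D := aeval x b
  let E := aeval x e
  let E' := aeval x e'
  let C' := aeval x c
  let D' := aeval x d
  -- The weights `u, v, w` combine the minors `yz`, `f' z`, `g' y` of the system, up to signs and
  -- powers of 2, to 1 modulo `I`; `dx, dy, dz` combine the corresponding Cramer solutions, with `m
  -- = 1/2`.
  let u := E * y * C' * z + E' * z * A * y
  let v := E' * z * D
  let w := E * y * D'
  let dx := v * (z * ε) + w * (y * δ)
  let dy := u * (-z * m * ε) + w * m * (F' * δ - G' * ε)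
  let dz := u * (-y * m * δ) + v * m * (G' * ε - F' * δ)
  have hdx : dx ∈ I := add_mem (I.mul_mem_left _ (I.mul_mem_left _ hy))
    (I.mul_mem_left _ (I.mul_mem_left _ hz))
  have hdy : dy ∈ I := add_mem (I.mul_mem_left _ (I.mul_mem_left _ hy))
    (I.mul_mem_left _ (sub_mem (I.mul_mem_left _ hz) (I.mul_mem_left _ hy)))
  have hdz : dz ∈ I := add_mem (I.mul_mem_left _ (I.mul_mem_left _ hz))
    (I.mul_mem_left _ (sub_mem (I.mul_mem_left _ hy) (I.mul_mem_left _ hz)))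
  have hdx2 : dx ^ 2 = 0 := by rw [pow_two, hmul hdx hdx]
  have hdy2 : dy ^ 2 = 0 := by rw [pow_two, hmul hdy hdy]
  have hdz2 : dz ^ 2 = 0 := by rw [pow_two, hmul hdz hdz]
  have hσ : 1 - (u * (y * z) + v * (F' * z) + w * (G' * y)) ∈ I := by
    have : 1 - (u * (y * z) + v * (F' * z) + w * (G' * y)) =
        -((E + E' * z ^ 2 * A) * ε + (E' + E * y ^ 2 * C') * δ) := by
      linear_combination -E * y ^ 2 * hcd - E' * z ^ 2 * hab - hee +
        (E + E' * z ^ 2 * A) * hε + (E' + E * y ^ 2 * C') * hδ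
    rw [this]
    exact neg_mem (add_mem (I.mul_mem_left _ hy) (I.mul_mem_left _ hz))
  have hσε := hmul hσ hy
  have hσδ := hmul hσ hz
  refine ⟨x + dx, y + dy, z + dz, by simpa using hdx, by simpa using hdy, by simpa using hdz, ?_, ?_⟩
  · rw [aeval_add_of_sq_eq_zero _ _ _ hdx2]
    change _ = _ + F' * dx
    linear_combination hdy2 - hε + hσε + (u * y * z * ε - w * y * (F' * δ - G' * ε)) * (-hh)
  · rw [aeval_add_of_sq_eq_zero _ _ _ hdx2]
    change _ = _ + G' * dx
    linear_combination hdz2 - hδ + hσδ + (u * y * z * δ - v * z * (G' * ε - F' * δ)) * (-hh)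

namespace IsBiquadratic

variable {f g : k[X]} {x y z : L} (h : IsBiquadratic f g x y z)

lemma _root_.Algebra.adjoin_eq_range_aeval_three {R A : Type*} [CommRing R] [CommRing A]
    [Algebra R A] (x y z : A) :
    Algebra.adjoin R {x, y, z} = (MvPolynomial.aeval (R := R) ![x, y, z]).range := by
  rw [← Algebra.adjoin_range_eq_range_aeval]
  congr 1
  ext t
  simp [eq_comm, or_left_comm, or_comm]

include h

/-- The normal form of a relation among `x, y, z` has zero coefficients by `coeff_eq_zero`, so the
relation holds for every solution of the two equations. -/
lemma aeval_eq_zero_of_sq_eq (h2 : (2 : k) ≠ 0) {B : Type*} [CommRing B] [Algebra k B]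
    (b : Fin 3 → B) (hf : b 1 ^ 2 = aeval (b 0) f) (hg : b 2 ^ 2 = aeval (b 0) g)
    (P : MvPolynomial (Fin 3) k) (hP : MvPolynomial.aeval ![x, y, z] P = 0) :
    MvPolynomial.aeval b P = 0 := by
  obtain ⟨p, q, r, s, hpqrs⟩ := MvPolynomial.exists_aeval_eq (L := L) (A := B) f g P
  let a : Fin 3 → L × B := fun i => (![x, y, z] i, b i)
  have h1 (Q : MvPolynomial (Fin 3) k) : MvPolynomial.aeval a Q =
      (MvPolynomial.aeval ![x, y, z] Q, MvPolynomial.aeval b Q) := by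
    have : MvPolynomial.aeval (R := k) a =
        (MvPolynomial.aeval ![x, y, z]).prod (MvPolynomial.aeval b) := by
      ext i <;> simp [a]
    exact congr($this Q)
  have h3 (Q : k[X]) (i : Fin 3) : aeval (a i) Q = (aeval (![x, y, z] i) Q, aeval (b i) Q) := by
    have : aeval (R := k) (a i) = (aeval (![x, y, z] i)).prod (aeval (b i)) := by
      ext <;> simp [a]
    exact congr($this Q)
  have h4 := hpqrs a (by rw [h3]; ext <;> simp [a, h.sq_left, hf])
    (by rw [h3]; ext <;> simp [a, h.sq_right, hg])
  simp only [h1, h3, hP, Prod.ext_iff, Prod.fst_add, Prod.fst_mul, Prod.snd_add, Prod.snd_mul, a] at h4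
  obtain ⟨h5, h6⟩ := h4
  obtain ⟨rfl, rfl, rfl, rfl⟩ := h.coeff_eq_zero h2 h5.symm
  simpa using h6

lemma exists_algHom (h2 : (2 : k) ≠ 0) {B : Type*} [CommRing B] [Algebra k B]
    (b : Fin 3 → B) (hf : b 1 ^ 2 = aeval (b 0) f) (hg : b 2 ^ 2 = aeval (b 0) g) :
    ∃ φ : (MvPolynomial.aeval (R := k) ![x, y, z]).range →ₐ[k] B,
      ∀ P, φ ((MvPolynomial.aeval ![x, y, z]).rangeRestrict P) = MvPolynomial.aeval b P := by
  let e := Ideal.quotientKerAlgEquivOfSurjective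
    (MvPolynomial.aeval (R := k) ![x, y, z]).rangeRestrict_surjective
  refine ⟨(Ideal.Quotient.liftₐ _ (MvPolynomial.aeval b) fun P hP => ?_).comp e.symm.toAlgHom,
    fun P => ?_⟩
  · refine h.aeval_eq_zero_of_sq_eq h2 b hf hg P ?_
    exact congr($(hP).1)
  · have : e.symm ((MvPolynomial.aeval ![x, y, z]).rangeRestrict P) = Ideal.Quotient.mk _ P := by
      rw [AlgEquiv.symm_apply_eq]
      rfl
    rw [AlgHom.comp_apply]
    refine (congrArg _ this).trans ?_
    exact Ideal.Quotient.lift_mk _ _ _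

/-- Arbitrary lifts of the images of `x, y, z` satisfy the equations modulo `I`; the Newton step
corrects them, and the universal property turns the result into a homomorphism. -/
lemma formallySmooth (h2 : (2 : k) ≠ 0) :
    Algebra.FormallySmooth k (Algebra.adjoin k {x, y, z}) := by
  rw [Algebra.adjoin_eq_range_aeval_three]
  refine Algebra.FormallySmooth.of_comp_surjective fun B _ _ I hI φ => ?_
  set π := (MvPolynomial.aeval (R := k) ![x, y, z]).rangeRestrict with hπ
  have hπX (i : Fin 3) (p : k[X]) : π (aeval (MvPolynomial.X i) p) = aeval (π (MvPolynomial.X i)) p :=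
    (aeval_algHom_apply π _ p).symm
  have hφ (i : Fin 3) : ∃ b : B, Ideal.Quotient.mkₐ k I b = φ (π (MvPolynomial.X i)) :=
    Ideal.Quotient.mk_surjective _
  choose b hb using hφ
  have hrel1 : π (MvPolynomial.X 1) ^ 2 = aeval (π (MvPolynomial.X 0)) f := by
    apply Subtype.ext
    rw [← hπX]
    refine Eq.trans ?_ (aeval_algHom_apply (MvPolynomial.aeval ![x, y, z]) (MvPolynomial.X 0) f)
    simp [hπ, h.sq_left]
  have hrel2 : π (MvPolynomial.X 2) ^ 2 = aeval (π (MvPolynomial.X 0)) g := by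
    apply Subtype.ext
    rw [← hπX]
    refine Eq.trans ?_ (aeval_algHom_apply (MvPolynomial.aeval ![x, y, z]) (MvPolynomial.X 0) g)
    simp [hπ, h.sq_right]
  have hmem {t : B} : Ideal.Quotient.mkₐ k I t = 0 ↔ t ∈ I := Ideal.Quotient.eq_zero_iff_mem
  obtain ⟨x', y', z', hx, hy, hz, hf, hg⟩ := exists_lift_of_sq_eq h2 h.separable_left
    h.separable_right h.coprime I hI (b 0) (b 1) (b 2)
    (by rw [← hmem, map_sub, map_pow, ← aeval_algHom_apply, hb, hb, aeval_algHom_apply, ← hrel1,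
          map_pow, sub_self])
    (by rw [← hmem, map_sub, map_pow, ← aeval_algHom_apply, hb, hb, aeval_algHom_apply, ← hrel2,
          map_pow, sub_self])
  obtain ⟨ψ, hψ⟩ := h.exists_algHom h2 ![x', y', z'] hf hg
  refine ⟨ψ, ?_⟩
  have hcomp : ((Ideal.Quotient.mkₐ k I).comp ψ).comp π = φ.comp π := by
    ext i
    rw [AlgHom.comp_apply, AlgHom.comp_apply, AlgHom.comp_apply, hψ, ← hb, MvPolynomial.aeval_X,
      ← sub_eq_zero, ← map_sub, hmem]
    fin_cases i <;> assumption
  ext t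
  obtain ⟨P, rfl⟩ := (MvPolynomial.aeval (R := k) ![x, y, z]).rangeRestrict_surjective t
  exact congr($hcomp P)

lemma smooth (h2 : (2 : k) ≠ 0) : Algebra.Smooth k (Algebra.adjoin k {x, y, z}) where
  formallySmooth := h.formallySmooth h2
  finitePresentation := by
    have : Algebra.FiniteType k (Algebra.adjoin k {x, y, z}) :=
      ⟨(Subalgebra.fg_top _).mpr (Subalgebra.fg_def.mpr ⟨_, Set.toFinite _, rfl⟩)⟩
    exact Algebra.FinitePresentation.of_finiteType.mp this

end IsBiquadratic

end FormallySmooth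

/-! ### The relative dimension of a smooth domain, from the differentials of its fraction field. -/

section RelativeDimension

variable {k R L : Type u} [Field k] [CommRing R] [IsDomain R] [Algebra k R] [Field L] [Algebra k L]
  [Algebra R L] [IsScalarTower k R L] [IsFractionRing R L]

lemma locally_isStandardSmoothOfRelativeDimension [Algebra.Smooth k R] (n : ℕ)
    (hL : Module.rank L Ω[L⁄k] = n) :
    RingHom.Locally (RingHom.IsStandardSmoothOfRelativeDimension n) (algebraMap k R) := by
  obtain ⟨s, hs, hsmooth⟩ := Algebra.Smooth.exists_span_eq_top_isStandardSmooth k R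
  refine ⟨s \ {0}, ?_, fun t ht => ?_⟩
  · rw [Ideal.span_sdiff_singleton_zero, hs]
  have ht0 : t ≠ 0 := fun h => ht.2 h
  have hle := powers_le_nonZeroDivisors_of_noZeroDivisors ht0
  let S := Localization.Away t
  have := hsmooth t ht.1
  rw [← IsScalarTower.algebraMap_eq]
  refine (RingHom.isStandardSmoothOfRelativeDimension_algebraMap n).mpr ?_
  have : IsDomain S := IsLocalization.isDomain_localization hle
  rw [Algebra.IsStandardSmoothOfRelativeDimension.iff_of_isStandardSmooth]
  let : Algebra S L := (IsLocalization.lift (M := Submonoid.powers t) (g := algebraMap R L)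
    fun y => by
      simpa using nonZeroDivisors.ne_zero (hle y.2)).toAlgebra
  have : IsScalarTower R S L := .of_algebraMap_eq fun r =>
    (IsLocalization.lift_eq _ r).symm
  have : IsScalarTower k S L := .of_algebraMap_eq fun r => by
    rw [IsScalarTower.algebraMap_apply k R S, ← IsScalarTower.algebraMap_apply R S L,
      ← IsScalarTower.algebraMap_apply k R L]
  have : IsFractionRing S L :=
    IsFractionRing.isFractionRing_of_isDomain_of_isLocalization (.powers t) S L
  -- Passing to the fraction field is formally étale, so the differentials of `S` have the rank of
  -- those of `L`.
  have : Algebra.FormallyEtale S L := .of_isLocalization (nonZeroDivisors S)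
  have e := KaehlerDifferential.tensorKaehlerEquivOfFormallyEtale k S L
  have := e.rank_eq
  rw [hL, Module.rank_baseChange] at this
  simpa using this

end RelativeDimension

end PlaneSextic
end

noncomputable section

namespace PlaneSextic

attribute [local instance] MvPolynomial.gradedAlgebra

/-! ### Smoothness of a scheme from the rings of sections of an affine cover. -/

section SmoothOfSections

variable {k : Type u} [Field k] (X : Over (Spec (.of k))) [IsIntegral X.left]

lemma sectionsEquiv_appLE (U : X.left.Opens) [Nonempty U] (a : Γ(Spec (.of k), ⊤)) :
    sectionsEquiv X U ((X.hom.appLE ⊤ U le_top).hom a) =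
      algebraMap k (sectionsSubalgebra X U) ((Scheme.ΓSpecIso (.of k)).hom.hom a) := by
  apply Subtype.ext
  have h1 : algebraMap k (sectionsSubalgebra X U) ((Scheme.ΓSpecIso (.of k)).hom.hom a) =
      toFunctionField X ((Scheme.ΓSpecIso (.of k)).hom.hom a) := rfl
  have h2 : (Scheme.ΓSpecIso (.of k)).inv.hom ((Scheme.ΓSpecIso (.of k)).hom.hom a) = a :=
    congr($((Scheme.ΓSpecIso (.of k)).hom_inv_id).hom a)
  have h3 : toFunctionField X ((Scheme.ΓSpecIso (.of k)).hom.hom a) =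
      X.left.presheaf.germ ⊤ (genericPoint X.left) trivial
        (X.hom.appTop.hom ((Scheme.ΓSpecIso (.of k)).inv.hom
          ((Scheme.ΓSpecIso (.of k)).hom.hom a))) := rfl
  rw [h1, h3, h2, sectionsEquiv_apply]
  exact X.left.presheaf.germ_res_apply (homOfLE le_top) (genericPoint X.left) _ _

lemma smoothOfRelativeDimension_of_sectionsSubalgebra {J : Type*} (U : J → X.left.Opens)
    [∀ j, Nonempty (U j)] (hU : ∀ j, IsAffineOpen (U j)) (hcov : ∀ x, ∃ j, x ∈ U j) (n : ℕ)
    [∀ j, Algebra.Smooth k (sectionsSubalgebra X (U j))]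
    [∀ j, IsFractionRing (sectionsSubalgebra X (U j)) X.left.functionField]
    (hn : Module.rank X.left.functionField Ω[X.left.functionField⁄k] = n) :
    SmoothOfRelativeDimension n X.hom := by
  refine HasRingHomProperty.of_iSup_eq_top (P := @SmoothOfRelativeDimension n)
    (fun j => ⟨U j, hU j⟩) ?_ fun j => ?_
  · ext x
    simpa using hcov x
  have h1 := locally_isStandardSmoothOfRelativeDimension (k := k) (R := sectionsSubalgebra X (U j))
    (L := X.left.functionField) n hn
  have hiso := RingHom.locally_respectsIso
    (RingHom.isStandardSmoothOfRelativeDimension_respectsIso (n := n))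
  have h2 := hiso.1 _ (sectionsEquiv X (U j)).symm (hiso.2 _
    (Scheme.ΓSpecIso (.of k)).commRingCatIsoToRingEquiv h1)
  refine Eq.mp (congrArg _ ?_) h2
  ext a
  refine (sectionsEquiv X (U j)).symm_apply_eq.mpr ?_
  exact (sectionsEquiv_appLE X (U j) a).symm

end SmoothOfSections

/-! ### Transport of curve generators along isomorphisms, and the two chart rings. -/

section Transport

variable {k L L' : Type*} [Field k] [Field L] [Algebra k L] [Field L'] [Algebra k L']
  {a b c a' b' c' : k} {x y z : L}

lemma IsCurveGenerators.map (h : IsCurveGenerators a b c a' b' c' x y z) (e : L ≃ₐ[k] L') :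
    IsCurveGenerators a b c a' b' c' (e x) (e y) (e z) where
  pair := h.pair
  transcendental := fun H => h.transcendental ((isAlgebraic_algHom_iff e.toAlgHom e.injective).mp H)
  sq_left := by
    rw [← map_pow, h.sq_left]
    exact (Polynomial.aeval_algHom_apply e.toAlgHom x _).symm
  sq_right := by
    rw [← map_pow, h.sq_right]
    exact (Polynomial.aeval_algHom_apply e.toAlgHom x _).symm
  adjoin_eq_top := by
    have := congrArg (IntermediateField.map e.toAlgHom) h.adjoin_eq_top
    rw [IntermediateField.adjoin_map] at this
    rw [← AlgHom.fieldRange_eq_map] at this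
    simpa [Set.image_insert_eq, (AlgHom.fieldRange_eq_top (f := e.toAlgHom)).mpr e.surjective] using this

lemma isFractionRing_adjoin {S : Set L} (h : IntermediateField.adjoin k S = ⊤) :
    IsFractionRing (Algebra.adjoin k S) L := by
  refine .of_field _ _ fun z => ?_
  have hz : z ∈ IntermediateField.adjoin k S := h ▸ trivial
  obtain ⟨a, ha, b, hb, rfl⟩ := IntermediateField.mem_adjoin_iff_div.mp hz
  exact ⟨⟨a, ha⟩, ⟨b, hb⟩, rfl⟩

lemma IsCurveGenerators.rank_kaehlerDifferential [IsAlgClosed k]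
    (h : IsCurveGenerators a b c a' b' c' x y z) : Module.rank L Ω[L⁄k] = (1 : ℕ) := by
  rw [Nat.cast_one]
  exact rank_eq_one _ h.D_x_ne_zero fun w =>
    Submodule.mem_span_singleton.mp (h.span_D_x ▸ trivial)

lemma IsCurveGenerators.adjoin_infinity_eq_top [IsAlgClosed k]
    (h : IsCurveGenerators a b c a' b' c' x y z) :
    IntermediateField.adjoin k {x⁻¹, y / x ^ 2, z / x ^ 2} = ⊤ := by
  have hx0 := h.x_ne_zero
  rw [← top_le_iff, ← h.adjoin_eq_top, IntermediateField.adjoin_le_iff]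
  have hx : x ∈ IntermediateField.adjoin k {x⁻¹, y / x ^ 2, z / x ^ 2} := by
    rw [← inv_mem_iff]
    exact IntermediateField.subset_adjoin _ _ (by simp)
  have h1 (w : L) (hw : w / x ^ 2 ∈ IntermediateField.adjoin k {x⁻¹, y / x ^ 2, z / x ^ 2}) :
      w ∈ IntermediateField.adjoin k {x⁻¹, y / x ^ 2, z / x ^ 2} := by
    have := mul_mem hw (pow_mem hx 2)
    rwa [div_mul_cancel₀ _ (pow_ne_zero 2 hx0)] at this
  rintro w (rfl | rfl | rfl)
  · exact hx
  · exact h1 _ (IntermediateField.subset_adjoin _ _ (by simp))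
  · exact h1 _ (IntermediateField.subset_adjoin _ _ (by simp))

lemma map_canonicalFunctions (e : L ≃ₐ[k] L') (i : Fin 5) :
    e (canonicalFunctions x y z i) = canonicalFunctions (e x) (e y) (e z) i := by
  fin_cases i <;> simp [canonicalFunctions]

lemma range_canonicalFunctions_div (t : L) : (Set.range fun l => canonicalFunctions x y z l / t) =
    {1 / t, x / t, x ^ 2 / t, y / t, z / t} := by
  ext w
  simp [canonicalFunctions, Fin.exists_fin_succ, eq_comm]

lemma adjoin_canonicalFunctions :
    Algebra.adjoin k (Set.range fun l => canonicalFunctions x y z l / canonicalFunctions x y z 0) =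
      Algebra.adjoin k {x, y, z} := by
  rw [range_canonicalFunctions_div]
  simp only [canonicalFunctions, Matrix.cons_val, div_one]
  have hx : x ∈ Algebra.adjoin k {x, y, z} := Algebra.subset_adjoin (by simp)
  refine le_antisymm (Algebra.adjoin_le ?_) (Algebra.adjoin_mono ?_)
  · rintro w (rfl | rfl | rfl | rfl | rfl)
    exacts [one_mem _, hx, pow_mem hx 2, Algebra.subset_adjoin (by simp),
      Algebra.subset_adjoin (by simp)]
  · rintro w (rfl | rfl | rfl) <;> simp

lemma adjoin_canonicalFunctions_infinity (hx : x ≠ 0) :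
    Algebra.adjoin k (Set.range fun l => canonicalFunctions x y z l / canonicalFunctions x y z 2) =
      Algebra.adjoin k {x⁻¹, y / x ^ 2, z / x ^ 2} := by
  rw [range_canonicalFunctions_div]
  have h2 : x / x ^ 2 = x⁻¹ := by field_simp
  simp only [canonicalFunctions, Matrix.cons_val, h2, div_self (pow_ne_zero 2 hx)]
  have hx : x⁻¹ ∈ Algebra.adjoin k {x⁻¹, y / x ^ 2, z / x ^ 2} := Algebra.subset_adjoin (by simp)
  refine le_antisymm (Algebra.adjoin_le ?_) (Algebra.adjoin_mono ?_)
  · rintro w (rfl | rfl | rfl | rfl | rfl)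
    · simpa using pow_mem hx 2
    exacts [hx, one_mem _, Algebra.subset_adjoin (by simp), Algebra.subset_adjoin (by simp)]
  · rintro w (rfl | rfl | rfl) <;> simp

end Transport

/-! ### The canonical model in `ℙ⁴`: smoothness, genus, and absence of a degree two map to the line.
-/

section CanonicalCurve

variable {k K : Type u} [Field k] [Field K] [Algebra k K]

lemma exists_canonicalFunctions_ne_zero (x y z : K) : ∃ i, canonicalFunctions x y z i ≠ 0 :=
  ⟨0, by simp [canonicalFunctions]⟩

variable (k) in
/-- The canonical model in `ℙ⁴` of the curve `y² = f(x), z² = g(x)`. -/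
abbrev canonicalCurve (x y z : K) : Over (Spec (.of k)) :=
  closureOfPoint (canonicalFunctions x y z) (exists_canonicalFunctions_ne_zero x y z) k

section

variable {n : ℕ} (c : Fin (n + 1) → K) (hc : ∃ i, c i ≠ 0)

lemma map_sectionsSubalgebra_coordinateChart (j : Fin (n + 1)) (hj : c j ≠ 0)
    [Nonempty (coordinateChart (k := k) c hc j)]
    (e : (closureOfPoint c hc k).left.functionField ≃ₐ[k] K)
    (he : ∀ w, e w = functionFieldAlgHom c hc w) :
    sectionsSubalgebra (closureOfPoint c hc k) (coordinateChart c hc j) =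
      Algebra.adjoin k (Set.range fun l => e.symm (c l) / e.symm (c j)) := by
  have h1 : (Set.range fun l => e.symm (c l) / e.symm (c j)) =
      e.symm.toAlgHom '' Set.range fun l => c l / c j := by
    rw [← Set.range_comp]
    congr 1
    ext l
    simp
  rw [h1, ← AlgHom.map_adjoin]
  ext w
  have h2 := exists_functionFieldAlgHom_eq_iff (k := k) c hc j hj (e w)
  rw [Subalgebra.mem_map, mem_sectionsSubalgebra]
  constructor
  · rintro ⟨s, rfl⟩
    exact ⟨_, h2.mp ⟨s, (he _).symm⟩, e.symm_apply_apply _⟩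
  · rintro ⟨v, hv, rfl⟩
    obtain ⟨s, hs⟩ := h2.mpr (by simpa using hv)
    refine ⟨s, e.injective ?_⟩
    rw [he, hs]

end

namespace IsCurveGenerators

variable {a b c a' b' c' : k} {x y z : K} (h : IsCurveGenerators a b c a' b' c' x y z)

include h

lemma intermediateField_adjoin_canonicalFunctions :
    IntermediateField.adjoin k (Set.range fun l =>
      canonicalFunctions x y z l / canonicalFunctions x y z 0) = ⊤ := by
  rw [← top_le_iff, ← h.adjoin_eq_top]
  have := adjoin_canonicalFunctions (k := k) (x := x) (y := y) (z := z)
  rw [IntermediateField.adjoin_le_iff]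
  intro w hw
  exact IntermediateField.algebra_adjoin_le_adjoin _ _ (this ▸ Algebra.subset_adjoin hw)

/-- The function field of the canonical model. -/
def functionFieldEquivCanonical : (canonicalCurve k x y z).left.functionField ≃ₐ[k] K :=
  functionFieldEquiv _ (exists_canonicalFunctions_ne_zero x y z) 0 (by simp [canonicalFunctions])
    h.intermediateField_adjoin_canonicalFunctions

lemma functionField : IsCurveGenerators a b c a' b' c' (h.functionFieldEquivCanonical.symm x)
    (h.functionFieldEquivCanonical.symm y) (h.functionFieldEquivCanonical.symm z) :=
  h.map h.functionFieldEquivCanonical.symm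

/-- On the curve `X₁² = X₀X₂`, while `X₃²` and `X₄²` are quadratic forms in `X₀, X₁, X₂` lying in
the ideal `(X₀, X₂)`. If `X₀` and `X₂` vanished at a point, all coordinates would. -/
lemma exists_mem_coordinateChart_canonical (p : (canonicalCurve k x y z).left) :
    ∃ j : Fin 2, p ∈ coordinateChart (k := k) (canonicalFunctions x y z)
      (exists_canonicalFunctions_ne_zero x y z) (![0, 2] j) := by
  have hc := exists_canonicalFunctions_ne_zero x y z
  by_contra! H
  have H0 := not_not.mp ((mem_coordinateChart_iff _ hc p 0).not.mp (H 0))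
  have H2 := not_not.mp ((mem_coordinateChart_iff _ hc p 2).not.mp (H 1))
  set I := (closureOfPointι (k := k) (canonicalFunctions x y z) hc p).asHomogeneousIdeal with hI
  have hprime : I.toIdeal.IsPrime := (closureOfPointι (k := k) (canonicalFunctions x y z) hc p).isPrime
  have hmem {G : MvPolynomial (Fin 5) k} (hG : G.IsHomogeneous 2)
      (h : MvPolynomial.aeval (canonicalFunctions x y z) G = 0) : G ∈ I.toIdeal :=
    mem_asHomogeneousIdeal_of_aeval_eq_zero _ hc p hG two_pos h
  have hX (i j : Fin 5) : (MvPolynomial.X i * MvPolynomial.X j : MvPolynomial (Fin 5) k).IsHomogeneous 2 :=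
    (MvPolynomial.isHomogeneous_X k i).mul (MvPolynomial.isHomogeneous_X k j)
  have hCX (r : k) (i j : Fin 5) : (MvPolynomial.C r * (MvPolynomial.X i * MvPolynomial.X j) :
      MvPolynomial (Fin 5) k).IsHomogeneous 2 := by
    simpa using (MvPolynomial.isHomogeneous_C _ r).mul (hX i j)
  have H1 : MvPolynomial.X 1 ∈ I.toIdeal := by
    refine hprime.mem_of_pow_mem 2 ?_
    have := hmem ((hX 1 1).sub (hX 0 2)) (by simp [canonicalFunctions]; ring)
    have := add_mem this (I.toIdeal.mul_mem_left (MvPolynomial.X 0) H2)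
    convert this using 1
    ring
  have hq (r s t : k) (i : Fin 5) (h : canonicalFunctions x y z i ^ 2 =
      Polynomial.aeval x (quartic r s t)) : MvPolynomial.X i ∈ I.toIdeal := by
    refine hprime.mem_of_pow_mem 2 ?_
    have := hmem ((hX i i).sub ((((hX 2 2).add (hCX r 0 2)).add (hCX s 0 1)).add (hCX t 0 0))) (by
      rw [aeval_quartic] at h
      simp only [map_sub, map_mul, map_add, MvPolynomial.aeval_X, MvPolynomial.algHom_C]
      rw [← pow_two, h]
      simp only [canonicalFunctions, Matrix.cons_val]
      ring)
    have h1 := add_mem this (I.toIdeal.mul_mem_left (MvPolynomial.X 2) H2)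
    have h2 := add_mem h1 (I.toIdeal.mul_mem_left (MvPolynomial.C r * MvPolynomial.X 2 +
      MvPolynomial.C s * MvPolynomial.X 1 + MvPolynomial.C t * MvPolynomial.X 0) H0)
    convert h2 using 1
    ring
  have H3 := hq a b c 3 h.sq_left
  have H4 := hq a' b' c' 4 h.sq_right
  obtain ⟨i, hi⟩ := exists_mem_coordinateChart (k := k) _ hc p
  refine (mem_coordinateChart_iff _ hc p i).mp hi ?_
  fin_cases i
  exacts [H0, H1, H2, H3, H4]

variable [IsAlgClosed k]

lemma canonicalChart_nonempty : ∀ j : Fin 2, Nonempty (coordinateChart (k := k)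
    (canonicalFunctions x y z) (exists_canonicalFunctions_ne_zero x y z) (![0, 2] j)) := by
  have := h.x_ne_zero
  intro j
  refine nonempty_coordinateChart _ _ _ ?_
  fin_cases j <;> simp [canonicalFunctions, this]

lemma sectionsSubalgebra_zero :
    have := h.canonicalChart_nonempty
    sectionsSubalgebra (canonicalCurve k x y z) (coordinateChart _ _ (![0, 2] 0)) =
      Algebra.adjoin k {h.functionFieldEquivCanonical.symm x,
        h.functionFieldEquivCanonical.symm y, h.functionFieldEquivCanonical.symm z} := by
  have := h.canonicalChart_nonempty
  refine (map_sectionsSubalgebra_coordinateChart _ _ (![0, 2] 0) ?_ h.functionFieldEquivCanonical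
    fun _ => rfl).trans ?_
  · simp [canonicalFunctions]
  · rw [← adjoin_canonicalFunctions]
    simp only [map_canonicalFunctions]
    rfl

lemma sectionsSubalgebra_one :
    have := h.canonicalChart_nonempty
    sectionsSubalgebra (canonicalCurve k x y z) (coordinateChart _ _ (![0, 2] 1)) =
      Algebra.adjoin k {(h.functionFieldEquivCanonical.symm x)⁻¹,
        h.functionFieldEquivCanonical.symm y / h.functionFieldEquivCanonical.symm x ^ 2,
        h.functionFieldEquivCanonical.symm z / h.functionFieldEquivCanonical.symm x ^ 2} := by
  have := h.canonicalChart_nonempty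
  refine (map_sectionsSubalgebra_coordinateChart _ _ (![0, 2] 1) ?_ h.functionFieldEquivCanonical
    fun _ => rfl).trans ?_
  · simp [canonicalFunctions, h.x_ne_zero]
  · rw [← adjoin_canonicalFunctions_infinity h.functionField.x_ne_zero]
    simp only [map_canonicalFunctions]
    rfl

lemma smoothOfRelativeDimension_one :
    SmoothOfRelativeDimension 1 (canonicalCurve k x y z).hom := by
  have := h.canonicalChart_nonempty
  have h2 := h.pair.two_ne_zero
  have : ∀ j : Fin 2, Algebra.Smooth k (sectionsSubalgebra (canonicalCurve k x y z)
      (coordinateChart _ _ (![0, 2] j))) := by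
    refine Fin.forall_fin_two.mpr ⟨?_, ?_⟩
    · rw [h.sectionsSubalgebra_zero]
      exact h.functionField.isBiquadratic.smooth h2
    · rw [h.sectionsSubalgebra_one]
      exact h.functionField.isBiquadratic_infinity.smooth h2
  have : ∀ j : Fin 2, IsFractionRing (sectionsSubalgebra (canonicalCurve k x y z)
      (coordinateChart _ _ (![0, 2] j))) (canonicalCurve k x y z).left.functionField := by
    refine Fin.forall_fin_two.mpr ⟨?_, ?_⟩
    · rw [h.sectionsSubalgebra_zero]
      exact isFractionRing_adjoin h.functionField.adjoin_eq_top
    · rw [h.sectionsSubalgebra_one]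
      exact isFractionRing_adjoin h.functionField.adjoin_infinity_eq_top
  exact smoothOfRelativeDimension_of_sectionsSubalgebra _
    (fun j : Fin 2 => coordinateChart _ _ (![0, 2] j))
    (fun j => isAffineOpen_coordinateChart _ _ _) h.exists_mem_coordinateChart_canonical 1
    h.functionField.rank_kaehlerDifferential

lemma isNonsingularCurve : IsNonsingularCurve (canonicalCurve k x y z) where
  isIntegral := inferInstance
  smooth := h.smoothOfRelativeDimension_one
  projective := ⟨4, Over.homMk (closureOfPointι _ _) rfl,
    inferInstanceAs (IsClosedImmersion (closureOfPointι _ _))⟩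

lemma genus_eq_five : genus (canonicalCurve k x y z) = 5 := by
  have := h.canonicalChart_nonempty
  have h1 : regularDifferentials (canonicalCurve k x y z) = Submodule.span k (Set.range fun i =>
      (canonicalFunctions (h.functionFieldEquivCanonical.symm x)
        (h.functionFieldEquivCanonical.symm y) (h.functionFieldEquivCanonical.symm z) i /
        (h.functionFieldEquivCanonical.symm y * h.functionFieldEquivCanonical.symm z)) •
        KaehlerDifferential.D k _ (h.functionFieldEquivCanonical.symm x)) := by
    ext ω
    rw [← h.functionField.mem_differentialSpan_and_iff, mem_regularDifferentials_iff _
      (fun j : Fin 2 => coordinateChart _ _ (![0, 2] j))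
      (fun j => isAffineOpen_coordinateChart _ _ _) h.exists_mem_coordinateChart_canonical,
      Fin.forall_fin_two, h.sectionsSubalgebra_zero, h.sectionsSubalgebra_one]
  rw [genus, h1, finrank_span_eq_card h.functionField.linearIndependent_canonical]
  rfl

lemma not_isHyperelliptic : ¬ IsHyperelliptic (canonicalCurve k x y z) := by
  rintro ⟨f, -, hf⟩
  obtain ⟨t, ht⟩ := exists_finrank_adjoin_eq _ f
  exact finrank_adjoin_ne_two h.functionField t (ht.trans hf)

end IsCurveGenerators

end CanonicalCurve

end PlaneSextic
end

noncomputable section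

namespace PlaneSextic

/-! ### Existence of the function field, inside an algebraic closure of `k(x)`. -/

section Existence

variable {k : Type u} [Field k]

lemma IsBiquadraticPair.exists_isCurveGenerators {a b c a' b' c' : k}
    (h : IsBiquadraticPair a b c a' b' c') :
    ∃ (K : Type u) (_ : Field K) (_ : Algebra k K) (x y z : K),
      IsCurveGenerators a b c a' b' c' x y z := by
  let Ω := AlgebraicClosure (RatFunc k)
  let x : Ω := algebraMap (RatFunc k) Ω RatFunc.X
  have hx : Transcendental k x := fun H => RatFunc.transcendental_X
    ((isAlgebraic_algHom_iff (IsScalarTower.toAlgHom k (RatFunc k) Ω)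
      (algebraMap (RatFunc k) Ω).injective).mp H)
  obtain ⟨y, hy⟩ := IsAlgClosed.exists_pow_nat_eq (Polynomial.aeval x (quartic a b c)) two_pos
  obtain ⟨z, hz⟩ := IsAlgClosed.exists_pow_nat_eq (Polynomial.aeval x (quartic a' b' c')) two_pos
  let K := IntermediateField.adjoin k {x, y, z}
  have hxK : x ∈ K := IntermediateField.subset_adjoin _ _ (by simp)
  have hyK : y ∈ K := IntermediateField.subset_adjoin _ _ (by simp)
  have hzK : z ∈ K := IntermediateField.subset_adjoin _ _ (by simp)
  refine ⟨K, inferInstance, inferInstance, ⟨x, hxK⟩, ⟨y, hyK⟩, ⟨z, hzK⟩, h, fun H => hx ?_, ?_, ?_, ?_⟩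
  · exact (isAlgebraic_algHom_iff K.val K.val.injective).mpr H
  · apply Subtype.ext
    refine Eq.trans hy ?_
    exact Polynomial.aeval_algHom_apply K.val ⟨x, hxK⟩ _
  · apply Subtype.ext
    refine Eq.trans hz ?_
    exact Polynomial.aeval_algHom_apply K.val ⟨x, hxK⟩ _
  · apply IntermediateField.lift_injective K
    rw [IntermediateField.lift_top, IntermediateField.lift_adjoin]
    simp [Set.image_insert_eq, K]

end Existence

/-! ### The sign changes of `y` and `z` on the function field. -/

section SignChange

open Polynomial

variable {k K : Type u} [Field k] [Field K] [Algebra k K] {a b c a' b' c' : k} {x y z : K}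

namespace IsCurveGenerators

variable [IsAlgClosed k]

/-- The triple `(x, εy, δz)` solves the same equations, so it defines an endomorphism of `k[x, y,
z]`; this is its own inverse and extends to the fraction field. -/
lemma exists_algEquiv (h : IsCurveGenerators a b c a' b' c' x y z) {ε δ : k} (hε : ε ^ 2 = 1)
    (hδ : δ ^ 2 = 1) : ∃ τ : K ≃ₐ[k] K, τ x = x ∧ τ y = ε • y ∧ τ z = δ • z := by
  let R := Algebra.adjoin k {x, y, z}
  have : IsFractionRing R K := isFractionRing_adjoin h.adjoin_eq_top
  have hRx : x ∈ R := Algebra.subset_adjoin (by simp)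
  have hRy : y ∈ R := Algebra.subset_adjoin (by simp)
  have hRz : z ∈ R := Algebra.subset_adjoin (by simp)
  have hR : R = (MvPolynomial.aeval (R := k) ![x, y, z]).range :=
    Algebra.adjoin_eq_range_aeval_three x y z
  have hval (p : k[X]) : ((aeval (⟨x, hRx⟩ : R) p : R) : K) = aeval x p :=
    (aeval_algHom_apply R.val (⟨x, hRx⟩ : R) p).symm
  obtain ⟨φ, hφ⟩ := h.isBiquadratic.exists_algHom h.pair.two_ne_zero (B := R)
    ![⟨x, hRx⟩, ε • ⟨y, hRy⟩, δ • ⟨z, hRz⟩]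
    (by
      apply Subtype.ext
      simp only [Matrix.cons_val, _root_.smul_pow, hε, one_smul]
      exact h.sq_left.trans (hval _).symm)
    (by
      apply Subtype.ext
      simp only [Matrix.cons_val, _root_.smul_pow, hδ, one_smul]
      exact h.sq_right.trans (hval _).symm)
  let ψ : R →ₐ[k] R := φ.comp (Subalgebra.equivOfEq _ _ hR).toAlgHom
  have hψ (i : Fin 3) (hi : (![x, y, z] : Fin 3 → K) i ∈ R) : ψ ⟨_, hi⟩ =
      (![⟨x, hRx⟩, ε • ⟨y, hRy⟩, δ • ⟨z, hRz⟩] : Fin 3 → R) i := by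
    have := hφ (MvPolynomial.X i)
    rw [MvPolynomial.aeval_X] at this
    rw [← this]
    refine congrArg φ (Subtype.ext ?_)
    simp
  have hψx : ψ ⟨x, hRx⟩ = ⟨x, hRx⟩ := hψ 0 hRx
  have hψy : ψ ⟨y, hRy⟩ = ε • ⟨y, hRy⟩ := hψ 1 hRy
  have hψz : ψ ⟨z, hRz⟩ = δ • ⟨z, hRz⟩ := hψ 2 hRz
  have hgen : Algebra.adjoin k {(⟨x, hRx⟩ : R), ⟨y, hRy⟩, ⟨z, hRz⟩} = ⊤ := by
    apply Subalgebra.map_injective (f := R.val) Subtype.val_injective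
    rw [AlgHom.map_adjoin, Algebra.map_top, Subalgebra.range_val]
    simp [Set.image_insert_eq, R]
  have hψψ : ψ.comp ψ = AlgHom.id k R := by
    refine AlgHom.ext_of_adjoin_eq_top hgen ?_
    rintro _ (rfl | rfl | rfl)
    · simp [hψx]
    · rw [AlgHom.comp_apply, hψy, map_smul, hψy, smul_smul, ← pow_two, hε, one_smul]; rfl
    · rw [AlgHom.comp_apply, hψz, map_smul, hψz, smul_smul, ← pow_two, hδ, one_smul]; rfl
  let ψe : R ≃ₐ[k] R := AlgEquiv.ofAlgHom ψ ψ hψψ hψψ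
  let τ : K ≃ₐ[k] K := IsFractionRing.fieldEquivOfAlgEquiv k K K ψe
  have hτ (w : R) : τ w = ψ w := IsFractionRing.fieldEquivOfAlgEquiv_algebraMap k K K ψe w
  refine ⟨τ, ?_, ?_, ?_⟩
  · simpa [hψx] using hτ ⟨x, hRx⟩
  · simpa [hψy] using hτ ⟨y, hRy⟩
  · simpa [hψz] using hτ ⟨z, hRz⟩

end IsCurveGenerators

end SignChange

end PlaneSextic
end

noncomputable section

namespace PlaneSextic

attribute [local instance] MvPolynomial.gradedAlgebra

/-! ### Klein four-subgroups from two commuting involutions. -/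

section KleinFour

variable {G : Type*} [Group G]

lemma exists_isKleinFour_subgroup {a b : G} (ha : a * a = 1) (hb : b * b = 1)
    (hab : a * b = b * a) (ha1 : a ≠ 1) (hb1 : b ≠ 1) (hne : a ≠ b) :
    ∃ V : Subgroup G, IsKleinFour V := by
  have ha' : a⁻¹ = a := inv_eq_of_mul_eq_one_left ha
  have hb' : b⁻¹ = b := inv_eq_of_mul_eq_one_left hb
  have hab1 : a * b ≠ 1 := fun h => hne (by rw [eq_inv_of_mul_eq_one_left h, hb'])
  let V : Subgroup G :=
    { carrier := {1, a, b, a * b}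
      one_mem' := by simp
      mul_mem' := by
        have h1 (c : G) : a * (a * c) = c := by rw [← mul_assoc, ha, one_mul]
        have h2 (c : G) : b * (b * c) = c := by rw [← mul_assoc, hb, one_mul]
        rintro _ _ (rfl | rfl | rfl | rfl) (rfl | rfl | rfl | rfl) <;>
          simp [ha, hb, h2, mul_assoc, hab]
        all_goals simp [← hab, h1, hb]
      inv_mem' := by
        rintro _ (rfl | rfl | rfl | rfl)
        · simp
        · simp [ha']
        · simp [hb']
        · simp [ha', hb', hab] }
  have hV : ∀ v : V, v * v = 1 := by
    rintro ⟨v, (rfl | rfl | rfl | rfl)⟩ <;> apply Subtype.ext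
    · exact one_mul 1
    · exact ha
    · exact hb
    · change a * b * (a * b) = 1
      nth_rw 2 [hab]
      rw [mul_assoc, ← mul_assoc b, hb, one_mul, ha]
  have hcard : Nat.card V = 4 := by
    have : ((({1, a, b, a * b} : Set G)).ncard) = 4 := by
      rw [Set.ncard_insert_of_notMem, Set.ncard_insert_of_notMem, Set.ncard_pair]
      · simpa using ha1
      · simp [hne, hb1]
      · simp [ha1.symm, hb1.symm, hab1.symm]
    exact this
  refine ⟨V, hcard, ?_⟩
  have : Nontrivial V := ⟨⟨⟨a, by simp [V]⟩, 1, fun h => ha1 congr($(h).1)⟩⟩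
  rw [Monoid.exponent_eq_prime_iff Nat.prime_two]
  intro v hv
  exact orderOf_eq_prime (by rw [pow_two, hV]) hv

end KleinFour

/-! ### Diagonal automorphisms of projective space. -/

section Scale

open HomogeneousLocalization

variable {k K : Type u} [Field k] [Field K] [Algebra k K] {n : ℕ}

/-- The graded endomorphism of the polynomial ring that multiplies the `i`-th variable by `ε i`. -/
def scale (ε : Fin (n + 1) → k) : MvPolynomial.homogeneousSubmodule (Fin (n + 1)) k →+*ᵍ
    MvPolynomial.homogeneousSubmodule (Fin (n + 1)) k where
  __ := (MvPolynomial.aeval (R := k) fun i =>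
    (MvPolynomial.C (ε i) * MvPolynomial.X i : MvPolynomial (Fin (n + 1)) k)).toRingHom
  map_mem := by
    intro d G hG
    have := MvPolynomial.IsHomogeneous.aeval (n := 1) hG
      (fun i => (MvPolynomial.C (ε i) * MvPolynomial.X i : MvPolynomial (Fin (n + 1)) k)) fun i => by
        simpa using (MvPolynomial.isHomogeneous_C _ (ε i)).mul (MvPolynomial.isHomogeneous_X k i)
    simpa using this

lemma aeval_scale (ε : Fin (n + 1) → k) (c : Fin (n + 1) → K) (G : MvPolynomial (Fin (n + 1)) k) :
    MvPolynomial.aeval c (scale ε G) = MvPolynomial.aeval (fun i => ε i • c i) G := by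
  have : (MvPolynomial.aeval c).comp (MvPolynomial.aeval (R := k) (fun i =>
      (MvPolynomial.C (ε i) * MvPolynomial.X i : MvPolynomial (Fin (n + 1)) k))) =
      MvPolynomial.aeval (fun i => ε i • c i) := by
    ext i
    simp [Algebra.smul_def]
  exact congr($this G)

lemma scale_scale (ε δ : Fin (n + 1) → k) (h : ∀ i, ε i * δ i = 1)
    (G : MvPolynomial (Fin (n + 1)) k) : scale ε (scale δ G) = G := by
  have : (MvPolynomial.aeval (R := k) (fun i =>
      (MvPolynomial.C (ε i) * MvPolynomial.X i : MvPolynomial (Fin (n + 1)) k))).comp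
      (MvPolynomial.aeval (R := k) (fun i =>
      (MvPolynomial.C (δ i) * MvPolynomial.X i : MvPolynomial (Fin (n + 1)) k))) =
      AlgHom.id k _ := by
    ext1 i
    simp only [AlgHom.comp_apply, MvPolynomial.aeval_X, map_mul, MvPolynomial.algHom_C,
      AlgHom.id_apply, MvPolynomial.algebraMap_eq]
    rw [← mul_assoc, ← map_mul, mul_comm (δ i), h, map_one, one_mul]
  exact congr($this G)

variable (ε : Fin (n + 1) → k) (hε : ∀ i, ε i ≠ 0)

open HomogeneousIdeal in
include hε in
lemma irrelevant_le_map_scale :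
    irrelevant (MvPolynomial.homogeneousSubmodule (Fin (n + 1)) k) ≤
      (irrelevant (MvPolynomial.homogeneousSubmodule (Fin (n + 1)) k)).map (scale ε) := by
  rw [← toIdeal_le_toIdeal_iff]
  refine (toIdeal_irrelevant_le _).mpr fun i hi G hG => ?_
  have hδ := scale_scale ε (fun i => (ε i)⁻¹) (fun i => mul_inv_cancel₀ (hε i)) G
  rw [← hδ]
  refine Ideal.mem_map_of_mem (scale ε) ?_
  exact mem_irrelevant_of_mem _ hi (GradedFunLike.map_mem (scale _) hG)

/-- The automorphism of projective space that multiplies the `i`-th coordinate by `ε i`. -/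
def projScale : Proj (MvPolynomial.homogeneousSubmodule (Fin (n + 1)) k) ⟶
    Proj (MvPolynomial.homogeneousSubmodule (Fin (n + 1)) k) :=
  Proj.map (scale ε) (irrelevant_le_map_scale ε hε)

variable (c : Fin (n + 1) → K) (hc : ∃ i, c i ≠ 0)

include hε hc in
lemma exists_smul_ne_zero : ∃ i, ε i • c i ≠ 0 := by
  obtain ⟨i, hi⟩ := hc
  exact ⟨i, smul_ne_zero (hε i) hi⟩

lemma projectivePoint_projScale :
    projectivePoint c k hc ≫ projScale ε hε =
      projectivePoint (fun i => ε i • c i) k (exists_smul_ne_zero ε hε c hc) := by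
  obtain ⟨i, hi⟩ := hc
  have hX : MvPolynomial.aeval c (scale ε (MvPolynomial.X i)) ≠ 0 := by
    rw [aeval_scale, MvPolynomial.aeval_X]
    exact smul_ne_zero (hε i) hi
  have hX' : MvPolynomial.aeval (fun i => ε i • c i) (MvPolynomial.X i : MvPolynomial _ k) ≠ 0 := by
    rwa [← aeval_scale]
  rw [projectivePoint_eq c _ (GradedFunLike.map_mem (scale ε) (X_mem i)) one_pos hX,
    projectivePoint_eq (fun i => ε i • c i) _ (X_mem i) one_pos hX', projScale, Category.assoc,
    Proj.awayι_comp_map _ _ one_pos _ (X_mem i), ← Category.assoc, ← Spec.map_comp,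
    ← CommRingCat.ofHom_comp]
  congr 3
  ext a
  obtain ⟨m, G, hG, rfl⟩ := Away.mk_surjective _ (X_mem i) a
  rw [RingHom.comp_apply, Away.map_mk, evalAway_mk, evalAway_mk, aeval_scale, aeval_scale]

lemma projectivePoint_map (τ : K →ₐ[k] K) :
    Spec.map (CommRingCat.ofHom τ.toRingHom) ≫ projectivePoint c k hc =
      projectivePoint (fun i => τ (c i)) k (hc.imp fun _ hi => (map_ne_zero τ).mpr hi) := by
  obtain ⟨i, hi⟩ := hc
  rw [projectivePoint_eq c _ (X_mem i) one_pos (aeval_X_ne c hi),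
    projectivePoint_eq (fun i => τ (c i)) _ (X_mem i) one_pos
      (aeval_X_ne _ ((map_ne_zero τ).mpr hi)), ← Category.assoc, ← Spec.map_comp,
    ← CommRingCat.ofHom_comp]
  congr 3
  ext a
  obtain ⟨m, G, hG, rfl⟩ := Away.mk_surjective _ (X_mem i) a
  rw [RingHom.comp_apply, evalAway_mk, evalAway_mk]
  have h (G : MvPolynomial (Fin (n + 1)) k) : τ (MvPolynomial.aeval c G) =
    MvPolynomial.aeval (fun i => τ (c i)) G := MvPolynomial.comp_aeval_apply c τ G
  refine (map_div₀ τ _ _).trans ?_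
  rw [map_pow, h, h]

lemma div_eq_div_of_projectivePoint_eq {c' : Fin (n + 1) → K} (hc' : ∃ i, c' i ≠ 0)
    (h : projectivePoint c k hc = projectivePoint c' k hc') {j : Fin (n + 1)} (hj : c j ≠ 0)
    (hj' : c' j ≠ 0) (l : Fin (n + 1)) : c l / c j = c' l / c' j := by
  rw [projectivePoint_eq c _ (X_mem j) one_pos (aeval_X_ne c hj),
    projectivePoint_eq c' _ (X_mem j) one_pos (aeval_X_ne c' hj'), cancel_mono] at h
  have h1 := congr($(Spec.map_injective h).hom
    (Away.mk _ (X_mem j) 1 (MvPolynomial.X l) (mk_X_mem l)))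
  have h2 := (evalAway_mk c _ (aeval_X_ne c hj) (X_mem j) 1 _ (mk_X_mem l)).symm.trans
    (h1.trans (evalAway_mk c' _ (aeval_X_ne c' hj') (X_mem j) 1 _ (mk_X_mem l)))
  simpa using h2

end Scale

/-! ### Automorphisms of the canonical model induced from its function field. -/

section Automorphism

variable {k K : Type u} [Field k] [Field K] [Algebra k K] {n : ℕ} (c : Fin (n + 1) → K)
  (hc : ∃ i, c i ≠ 0)

lemma ker_toImage {X Y : Scheme.{u}} (f : X ⟶ Y) [QuasiCompact f] : f.toImage.ker = ⊥ := by
  rw [eq_bot_iff]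
  intro U
  refine (Scheme.Hom.ideal_ker_le f.toImage U).trans ?_
  rw [(RingHom.injective_iff_ker_eq_bot _).mp (toImage_app_injective f U)]
  exact bot_le

lemma ker_toClosureOfPoint : (toClosureOfPoint (k := k) c hc).ker = ⊥ :=
  ker_toImage (projectivePoint c k hc)

/-- An endomorphism `φ` of the closure of a point induces `τ` on the function field. -/
def Induces (φ : closureOfPoint c hc k ⟶ closureOfPoint c hc k) (τ : K →ₐ[k] K) : Prop :=
  toClosureOfPoint c hc ≫ φ.left =
    Spec.map (CommRingCat.ofHom τ.toRingHom) ≫ toClosureOfPoint c hc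

/-- The map `g` sends the defining point to the same point twisted by `τ`. The ideal of the closure
is the kernel of the point, so `g` restricted to the closure factors through it. -/
lemma exists_induces_of_comp_eq (τ : K →ₐ[k] K)
    (g : Proj (MvPolynomial.homogeneousSubmodule (Fin (n + 1)) k) ⟶
      Proj (MvPolynomial.homogeneousSubmodule (Fin (n + 1)) k))
    (hg : projectivePoint c k hc ≫ g =
      Spec.map (CommRingCat.ofHom τ.toRingHom) ≫ projectivePoint c k hc) :
    ∃ φ : closureOfPoint c hc k ⟶ closureOfPoint c hc k, Induces c hc φ τ := by
  have hle : (closureOfPointι (k := k) c hc).ker ≤ (closureOfPointι (k := k) c hc ≫ g).ker := by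
    rw [← Scheme.IdealSheafData.map_bot (closureOfPointι c hc ≫ g), ← ker_toClosureOfPoint c hc,
      Scheme.IdealSheafData.map_ker, ← Category.assoc, toClosureOfPoint_ι, hg,
      ← toClosureOfPoint_ι, ← Category.assoc]
    exact Scheme.Hom.le_ker_comp _ _
  have hφ := IsClosedImmersion.lift_fac _ _ hle
  have h1 : toClosureOfPoint c hc ≫ IsClosedImmersion.lift _ _ hle =
      Spec.map (CommRingCat.ofHom τ.toRingHom) ≫ toClosureOfPoint c hc := by
    rw [← cancel_mono (closureOfPointι (k := k) c hc), Category.assoc, hφ, ← Category.assoc,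
      toClosureOfPoint_ι, hg, ← toClosureOfPoint_ι, Category.assoc]
  have h2 : toClosureOfPoint c hc ≫ (closureOfPoint c hc k).hom =
      Spec.map (CommRingCat.ofHom (algebraMap k K)) := by
    rw [← closureOfPointι_hom, ← Category.assoc, toClosureOfPoint_ι, projectivePoint_hom]
  refine ⟨Over.homMk (IsClosedImmersion.lift _ _ hle) ?_, h1⟩
  -- Compatibility with the structure maps may be tested on the dense point, where it says that `τ`
  -- fixes `k`.
  refine ext_of_isDominant (toClosureOfPoint (k := k) c hc) ?_
  rw [← Category.assoc, h1, Category.assoc, h2, ← Spec.map_comp, ← CommRingCat.ofHom_comp]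
  congr 2
  exact τ.comp_algebraMap

lemma exists_induces (τ : K →ₐ[k] K) (ε : Fin (n + 1) → k) (hε : ∀ i, ε i ≠ 0)
    (hτ : ∀ i, τ (c i) = ε i • c i) :
    ∃ φ : closureOfPoint c hc k ⟶ closureOfPoint c hc k, Induces c hc φ τ := by
  refine exists_induces_of_comp_eq c hc τ (projScale ε hε) ?_
  rw [projectivePoint_projScale, projectivePoint_map]
  simp only [hτ]

variable {c hc} in
lemma Induces.comp {φ ψ : closureOfPoint c hc k ⟶ closureOfPoint c hc k} {τ σ : K →ₐ[k] K}
    (hφ : Induces c hc φ τ) (hψ : Induces c hc ψ σ) : Induces c hc (φ ≫ ψ) (τ.comp σ) := by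
  rw [Induces, Over.comp_left, ← Category.assoc, hφ, Category.assoc, hψ, ← Category.assoc,
    ← Spec.map_comp, ← CommRingCat.ofHom_comp]
  rfl

lemma induces_id : Induces c hc (𝟙 (closureOfPoint c hc k)) (AlgHom.id k K) := by
  rw [Induces, Over.id_left, Category.comp_id]
  refine (Category.id_comp _).symm.trans ?_
  congr 1
  exact (Spec.map_id _).symm

variable {c hc} in
lemma Induces.eq {φ ψ : closureOfPoint c hc k ⟶ closureOfPoint c hc k} {τ : K →ₐ[k] K}
    (hφ : Induces c hc φ τ) (hψ : Induces c hc ψ τ) : φ = ψ := by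
  apply Over.OverMorphism.ext
  rw [← cancel_mono (closureOfPointι (k := k) c hc)]
  refine ext_of_isDominant (toClosureOfPoint (k := k) c hc) ?_
  rw [← Category.assoc, ← Category.assoc, hφ, hψ]

variable {c hc} in
lemma Induces.apply_div_eq {φ : closureOfPoint c hc k ⟶ closureOfPoint c hc k} {τ σ : K →ₐ[k] K}
    (hτ : Induces c hc φ τ) (hσ : Induces c hc φ σ) {j : Fin (n + 1)} (hj : c j ≠ 0)
    (l : Fin (n + 1)) : τ (c l) / τ (c j) = σ (c l) / σ (c j) := by
  have h := congr($(hτ.symm.trans hσ) ≫ closureOfPointι c hc)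
  rw [Category.assoc, Category.assoc, toClosureOfPoint_ι, projectivePoint_map,
    projectivePoint_map] at h
  exact div_eq_div_of_projectivePoint_eq _ _ _ h ((map_ne_zero τ).mpr hj)
    ((map_ne_zero σ).mpr hj) l

variable [IsAlgClosed k] {a b s a' b' s' : k} {x y z : K}

lemma IsCurveGenerators.exists_isKleinFour (h : IsCurveGenerators a b s a' b' s' x y z) :
    ∃ V : Subgroup (Aut (canonicalCurve k x y z)), IsKleinFour V := by
  have h2 : (2 : K) ≠ 0 := by
    have := (map_ne_zero (algebraMap k K)).mpr h.pair.two_ne_zero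
    rwa [map_ofNat] at this
  have hy0 := h.isBiquadratic.y_ne_zero
  have hz0 := h.isBiquadratic.z_ne_zero
  have hc0 : canonicalFunctions x y z 0 ≠ 0 := by simp [canonicalFunctions]
  have key (ε δ : k) (hε : ε ^ 2 = 1) (hδ : δ ^ 2 = 1) :
      ∃ (τ : K →ₐ[k] K) (φ : canonicalCurve k x y z ⟶ canonicalCurve k x y z),
        τ x = x ∧ τ y = ε • y ∧ τ z = δ • z ∧ Induces _ _ φ τ := by
    obtain ⟨τ, hx, hy, hz⟩ := h.exists_algEquiv hε hδ
    have hε0 : ε ≠ 0 := by rintro rfl; simp at hε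
    have hδ0 : δ ≠ 0 := by rintro rfl; simp at hδ
    obtain ⟨φ, hφ⟩ := exists_induces (canonicalFunctions x y z)
      (exists_canonicalFunctions_ne_zero x y z) τ.toAlgHom ![1, 1, 1, ε, δ]
      (by intro i; fin_cases i <;> simp [hε0, hδ0])
      (by intro i; fin_cases i <;> simp [canonicalFunctions, hx, hy, hz])
    exact ⟨τ.toAlgHom, φ, hx, hy, hz, hφ⟩
  have hext {τ σ : K →ₐ[k] K} (hx : τ x = σ x) (hy : τ y = σ y) (hz : τ z = σ z) : τ = σ := by
    ext w
    have hw : w ∈ IntermediateField.adjoin k {x, y, z} := h.adjoin_eq_top ▸ trivial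
    induction hw using IntermediateField.adjoin_induction with
    | mem v hv => rcases hv with rfl | rfl | rfl <;> assumption
    | algebraMap r => rw [AlgHom.commutes, AlgHom.commutes]
    | add u v _ _ hu hv => rw [map_add, map_add, hu, hv]
    | inv u _ hu => rw [map_inv₀, map_inv₀, hu]
    | mul u v _ _ hu hv => rw [map_mul, map_mul, hu, hv]
  obtain ⟨τ, φ, hτx, hτy, hτz, hφ⟩ := key (-1) 1 (by simp) (by simp)
  obtain ⟨σ, ψ, hσx, hσy, hσz, hψ⟩ := key 1 (-1) (by simp) (by simp)
  have hττ : τ.comp τ = AlgHom.id k K := hext (by simp [hτx]) (by simp [hτy]) (by simp [hτz])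
  have hσσ : σ.comp σ = AlgHom.id k K := hext (by simp [hσx]) (by simp [hσy]) (by simp [hσz])
  have hτσ : τ.comp σ = σ.comp τ :=
    hext (by simp [hτx, hσx]) (by simp [hτy, hσy]) (by simp [hτz, hσz])
  have hφφ : φ ≫ φ = 𝟙 _ := (hφ.comp hφ).eq (hττ ▸ induces_id _ _)
  have hψψ : ψ ≫ ψ = 𝟙 _ := (hψ.comp hψ).eq (hσσ ▸ induces_id _ _)
  have hφψ : φ ≫ ψ = ψ ≫ φ := (hφ.comp hψ).eq (hτσ ▸ hψ.comp hφ)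
  have hne {w : K} (hw : w ≠ 0) : -w ≠ w := by
    intro H
    have : 2 * w = 0 := by linear_combination -H
    exact mul_ne_zero h2 hw this
  refine exists_isKleinFour_subgroup (a := (⟨φ, φ, hφφ, hφφ⟩ : Aut (canonicalCurve k x y z)))
    (b := ⟨ψ, ψ, hψψ, hψψ⟩) (Iso.ext hφφ) (Iso.ext hψψ) (Iso.ext hφψ.symm) ?_ ?_ ?_
  · intro H
    have H' : φ = 𝟙 _ := congr($(H).hom)
    -- Coordinate 3 is `y`: a trivial automorphism would give `-y = y`.
    have := hφ.apply_div_eq (H' ▸ induces_id _ _) hc0 3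
    refine hne hy0 ?_
    simpa [canonicalFunctions, hτy] using this
  · intro H
    have H' : ψ = 𝟙 _ := congr($(H).hom)
    have := hψ.apply_div_eq (H' ▸ induces_id _ _) hc0 4
    refine hne hz0 ?_
    simpa [canonicalFunctions, hσz] using this
  · intro H
    have H' : φ = ψ := congr($(H).hom)
    have := hφ.apply_div_eq (H' ▸ hψ) hc0 3
    refine hne hy0 ?_
    simpa [canonicalFunctions, hτy, hσy] using this

end Automorphism

end PlaneSextic
end

noncomputable section

namespace PlaneSextic

attribute [local instance] MvPolynomial.gradedAlgebra

/-! ### Birational equivalence of models with the same function field. -/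

section Birational

lemma isDominant_of_isOpenImmersion {X Y : Scheme.{u}} (f : X ⟶ Y) [IsOpenImmersion f]
    [IrreducibleSpace Y] [Nonempty X] : IsDominant f :=
  ⟨f.isOpenEmbedding.isOpen_range.dense (Set.range_nonempty f)⟩

variable {k : Type u} [Field k]

variable (k) in
/-- The structure morphism of the spectrum of a `k`-algebra. -/
abbrev specHom (A : Type u) [CommRing A] [Algebra k A] : Spec (.of A) ⟶ Spec (.of k) :=
  Spec.map (CommRingCat.ofHom (algebraMap k A))

lemma birationalOver_specHom_of_algEquiv {A B : Type u} [CommRing A] [CommRing B] [IsDomain A]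
    [Algebra k A] [Algebra k B] (e : A ≃ₐ[k] B) :
    Scheme.BirationalOver (specHom k B) (specHom k A) := by
  have : IsIso (Spec.map e.toRingEquiv.toCommRingCatIso.hom) := inferInstance
  refine (Spec.map e.toRingEquiv.toCommRingCatIso.hom).birationalOver (specHom k A) _ ?_
  rw [specHom, ← Spec.map_comp]
  congr 1
  ext a
  exact e.commutes a

lemma birationalOver_specHom_of_isLocalization {A B : Type u} [CommRing A] [CommRing B] [IsDomain A]
    [Nontrivial B] [Algebra k A] [Algebra k B] [Algebra A B] [IsScalarTower k A B] (a : A)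
    [IsLocalization.Away a B] : Scheme.BirationalOver (specHom k B) (specHom k A) := by
  have := IsOpenImmersion.of_isLocalization (S := B) a
  have : Nonempty (Spec (.of B)) := inferInstanceAs (Nonempty (PrimeSpectrum B))
  have : IsDominant (Spec.map (CommRingCat.ofHom (algebraMap A B))) :=
    isDominant_of_isOpenImmersion _
  refine (Spec.map (CommRingCat.ofHom (algebraMap A B))).birationalOver (specHom k A) _ ?_
  rw [specHom, ← Spec.map_comp, ← CommRingCat.ofHom_comp, ← IsScalarTower.algebraMap_eq]

lemma birationalOver_sectionsSubalgebra (X : Over (Spec (.of k))) [IsIntegral X.left]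
    {U : X.left.Opens} [Nonempty U] (hU : IsAffineOpen U) :
    Scheme.BirationalOver (specHom k (sectionsSubalgebra X U)) X.hom := by
  let f : Spec (.of (sectionsSubalgebra X U)) ⟶ X.left :=
    Spec.map (sectionsEquiv X U).toCommRingCatIso.hom ≫ hU.fromSpec
  have : Nonempty (Spec (.of (sectionsSubalgebra X U))) :=
    inferInstanceAs (Nonempty (PrimeSpectrum _))
  have : IsDominant f := isDominant_of_isOpenImmersion f
  refine f.birationalOver X.hom _ ?_
  have h1 := IsAffineOpen.SpecMap_appLE_fromSpec X.hom (isAffineOpen_top (Spec (.of k))) hU le_top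
  rw [Category.assoc, ← h1, IsAffineOpen.fromSpec_top, Scheme.isoSpec_Spec_inv, ← Spec.map_comp,
    ← Spec.map_comp]
  congr 1
  ext a
  refine congrArg Subtype.val ((sectionsEquiv_appLE X U _).trans ?_)
  refine congrArg (algebraMap k (sectionsSubalgebra X U)) ?_
  exact congr($((Scheme.ΓSpecIso (.of k)).inv_hom_id).hom a)

variable {K : Type u} [Field K] [Algebra k K]

/-- The subalgebra obtained by adjoining the inverse of an element. -/
def adjoinInv (A : Subalgebra k K) (a : K) : Subalgebra k K := Algebra.adjoin k (A ∪ {a⁻¹})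

lemma le_adjoinInv (A : Subalgebra k K) (a : K) : A ≤ adjoinInv A a :=
  fun _ hz => Algebra.subset_adjoin (.inl hz)

lemma inv_mem_adjoinInv (A : Subalgebra k K) (a : K) : a⁻¹ ∈ adjoinInv A a :=
  Algebra.subset_adjoin (.inr rfl)

lemma adjoinInv_le {A B : Subalgebra k K} {a : K} (h : A ≤ B) (ha : a⁻¹ ∈ B) : adjoinInv A a ≤ B :=
  Algebra.adjoin_le (Set.union_subset h (by simpa))

lemma exists_pow_mul_mem {A : Subalgebra k K} {a : K} (ha : a ∈ A) (ha0 : a ≠ 0) {z : K}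
    (hz : z ∈ adjoinInv A a) : ∃ m : ℕ, a ^ m * z ∈ A := by
  induction hz using Algebra.adjoin_induction with
  | mem z hz =>
    rcases hz with hz | rfl
    · exact ⟨0, by simpa using hz⟩
    · exact ⟨1, by simp [ha0, one_mem]⟩
  | algebraMap r => exact ⟨0, by simp [A.algebraMap_mem]⟩
  | add u v _ _ hu hv =>
    obtain ⟨m, hm⟩ := hu
    obtain ⟨l, hl⟩ := hv
    refine ⟨m + l, ?_⟩
    have : a ^ (m + l) * (u + v) = a ^ l * (a ^ m * u) + a ^ m * (a ^ l * v) := by ring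
    rw [this]
    exact add_mem (mul_mem (pow_mem ha _) hm) (mul_mem (pow_mem ha _) hl)
  | mul u v _ _ hu hv =>
    obtain ⟨m, hm⟩ := hu
    obtain ⟨l, hl⟩ := hv
    refine ⟨m + l, ?_⟩
    have : a ^ (m + l) * (u * v) = (a ^ m * u) * (a ^ l * v) := by ring
    rw [this]
    exact mul_mem hm hl

lemma birationalOver_adjoinInv {A : Subalgebra k K} {a : K} (ha : a ∈ A) (ha0 : a ≠ 0) :
    Scheme.BirationalOver (specHom k (adjoinInv A a)) (specHom k A) := by
  have hle := le_adjoinInv A a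
  let : Algebra A (adjoinInv A a) := (Subalgebra.inclusion hle).toRingHom.toAlgebra
  have : IsScalarTower k A (adjoinInv A a) := .of_algebraMap_eq fun _ => rfl
  have hval (w : A) : ((algebraMap A (adjoinInv A a) w : adjoinInv A a) : K) = w := rfl
  have : IsLocalization.Away (⟨a, ha⟩ : A) (adjoinInv A a) := by
    refine ⟨?_, ?_, ?_⟩
    · rintro ⟨_, m, rfl⟩
      rw [map_pow]
      refine IsUnit.pow _ (IsUnit.of_mul_eq_one ⟨a⁻¹, inv_mem_adjoinInv A a⟩ (Subtype.ext ?_))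
      exact mul_inv_cancel₀ ha0
    · rintro ⟨z, hz⟩
      obtain ⟨m, hm⟩ := exists_pow_mul_mem ha ha0 hz
      refine ⟨⟨⟨_, hm⟩, ⟨_, m, rfl⟩⟩, Subtype.ext ?_⟩
      change z * a ^ m = a ^ m * z
      ring
    · intro u v huv
      have : u = v := Subtype.ext congr(($huv : K))
      exact ⟨1, by rw [this]⟩
  exact birationalOver_specHom_of_isLocalization (⟨a, ha⟩ : A)

lemma exists_le_adjoinInv {A B : Subalgebra k K} (hA : A.FG) [IsFractionRing B K] :
    ∃ b ∈ B, b ≠ 0 ∧ A ≤ adjoinInv B b := by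
  obtain ⟨S, rfl⟩ := hA
  obtain ⟨⟨⟨b, hb⟩, hb0⟩, h⟩ :=
    IsLocalization.exist_integer_multiples_of_finset (nonZeroDivisors B) S
  have hb0' : b ≠ 0 := fun h => nonZeroDivisors.ne_zero hb0 (Subtype.ext h)
  refine ⟨b, hb, hb0', Algebra.adjoin_le fun s hs => ?_⟩
  obtain ⟨w, hw⟩ := h s hs
  have hw' : (w : K) = b * s := hw
  have : s = w * b⁻¹ := by rw [hw']; field_simp
  rw [this]
  exact mul_mem (le_adjoinInv B b w.2) (inv_mem_adjoinInv B b)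

/-- By finite generation, `A ⊆ B[1/b]` and `B ⊆ A[1/a]` for some `a ∈ A` and `b ∈ B`. After both `a`
and `b` are inverted the two rings coincide. -/
lemma birationalOver_of_isFractionRing {A B : Subalgebra k K} (hA : A.FG) (hB : B.FG)
    [IsFractionRing A K] [IsFractionRing B K] :
    Scheme.BirationalOver (specHom k A) (specHom k B) := by
  obtain ⟨b, hb, hb0, hAB⟩ := exists_le_adjoinInv (B := B) hA
  obtain ⟨a, ha, ha0, hBA⟩ := exists_le_adjoinInv (B := A) hB
  have heq : adjoinInv (adjoinInv A a) b = adjoinInv (adjoinInv B b) a :=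
    le_antisymm
      (adjoinInv_le (adjoinInv_le (hAB.trans (le_adjoinInv _ _)) (inv_mem_adjoinInv _ _))
        (le_adjoinInv _ _ (inv_mem_adjoinInv _ _)))
      (adjoinInv_le (adjoinInv_le (hBA.trans (le_adjoinInv _ _)) (inv_mem_adjoinInv _ _))
        (le_adjoinInv _ _ (inv_mem_adjoinInv _ _)))
  have h1 := (birationalOver_adjoinInv (hBA hb) hb0).trans (birationalOver_adjoinInv ha ha0)
  have h2 := (birationalOver_adjoinInv (hAB ha) ha0).trans (birationalOver_adjoinInv hb hb0)
  rw [heq] at h1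
  exact h1.symm.trans h2

variable {n m : ℕ} (c : Fin (n + 1) → K) (hc : ∃ i, c i ≠ 0)

lemma birationalOver_closureOfPoint {j : Fin (n + 1)} (hj : c j ≠ 0)
    (hgen : IntermediateField.adjoin k (Set.range fun l => c l / c j) = ⊤) :
    Scheme.BirationalOver (specHom k (Algebra.adjoin k (Set.range fun l => c l / c j)))
      (closureOfPoint c hc k).hom := by
  have := nonempty_coordinateChart (k := k) c hc j hj
  let e := functionFieldEquiv c hc j hj hgen
  have h1 := birationalOver_sectionsSubalgebra (closureOfPoint c hc k)
    (isAffineOpen_coordinateChart c hc j)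
  refine Scheme.BirationalOver.trans ?_ h1
  have h2 := map_sectionsSubalgebra_coordinateChart c hc j hj e fun _ => rfl
  have h3 : (sectionsSubalgebra (closureOfPoint c hc k) (coordinateChart c hc j)).map e.toAlgHom =
      Algebra.adjoin k (Set.range fun l => c l / c j) := by
    rw [h2, AlgHom.map_adjoin, ← Set.range_comp]
    congr 2
    ext l
    simp
  rw [← h3]
  exact birationalOver_specHom_of_algEquiv
    (Subalgebra.equivMapOfInjective _ e.toAlgHom e.injective)

lemma birationalOver_closureOfPoint_closureOfPoint (d : Fin (m + 1) → K) (hd : ∃ i, d i ≠ 0)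
    {j : Fin (n + 1)} (hj : c j ≠ 0) {l : Fin (m + 1)} (hl : d l ≠ 0)
    (hcgen : IntermediateField.adjoin k (Set.range fun i => c i / c j) = ⊤)
    (hdgen : IntermediateField.adjoin k (Set.range fun i => d i / d l) = ⊤) :
    Scheme.BirationalOver (closureOfPoint c hc k).hom (closureOfPoint d hd k).hom := by
  have := isFractionRing_adjoin hcgen
  have := isFractionRing_adjoin hdgen
  refine (birationalOver_closureOfPoint c hc hj hcgen).symm.trans
    (Scheme.BirationalOver.trans ?_ (birationalOver_closureOfPoint d hd hl hdgen))
  exact birationalOver_of_isFractionRing (Subalgebra.fg_def.mpr ⟨_, Set.finite_range _, rfl⟩)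
    (Subalgebra.fg_def.mpr ⟨_, Set.finite_range _, rfl⟩)

end Birational

end PlaneSextic
end

noncomputable section

namespace PlaneSextic

attribute [local instance] MvPolynomial.gradedAlgebra

/-! ### The plane curve `F = 0` as the closure of a generic point. -/

section PlaneCurve

variable {k K : Type u} [Field k] [Field K] [Algebra k K]

lemma ker_eq_vanishingIdeal {X Y : Scheme.{u}} [IsReduced X] (f : X ⟶ Y) :
    f.ker = Scheme.IdealSheafData.vanishingIdeal (.closure (Set.range f)) := by
  rw [← Scheme.IdealSheafData.map_bot, ← Scheme.nilradical_eq_bot,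
    ← Scheme.IdealSheafData.vanishingIdeal_top, Scheme.IdealSheafData.map_vanishingIdeal]
  congr 2
  exact Set.image_univ

lemma aeval_eq_zero_of_mem {n : ℕ} (c : Fin (n + 1) → K) (hc : ∃ i, c i ≠ 0) (p : Spec (.of K))
    {G : MvPolynomial (Fin (n + 1)) k} {m : ℕ} (hG : G.IsHomogeneous m)
    (h : G ∈ (projectivePoint c k hc p).asHomogeneousIdeal) : MvPolynomial.aeval c G = 0 := by
  obtain ⟨i, hi⟩ := hc
  by_contra h0
  have h1 : MvPolynomial.aeval c (G * MvPolynomial.X i) ≠ 0 := by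
    rw [map_mul]
    exact mul_ne_zero h0 (aeval_X_ne c hi)
  have h2 := (projectivePoint_mem_basicOpen c ⟨i, hi⟩ p (hG.mul (MvPolynomial.isHomogeneous_X k i))
    (Nat.succ_pos m)).mpr h1
  exact h2 (Ideal.mul_mem_right _ _ h)

lemma mem_of_aeval_eq_zero {n : ℕ} (c : Fin (n + 1) → K) (hc : ∃ i, c i ≠ 0) (p : Spec (.of K))
    {G : MvPolynomial (Fin (n + 1)) k} {m : ℕ} (hG : G.IsHomogeneous m) (hm : 0 < m)
    (h : MvPolynomial.aeval c G = 0) : G ∈ (projectivePoint c k hc p).asHomogeneousIdeal := by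
  by_contra h0
  exact (projectivePoint_mem_basicOpen c hc p hG hm).mp h0 h

/-- By `hdvd` the forms vanishing at `c` are the multiples of `F`, so the homogeneous ideal of the
point `c` is generated by `F`. -/
lemma planeZeroLocus_eq_closure (c : Fin 3 → K) (hc : ∃ i, c i ≠ 0) {F : MvPolynomial (Fin 3) k}
    {d : ℕ} (hF : F.IsHomogeneous d) (hd : 0 < d) (hFc : MvPolynomial.aeval c F = 0)
    (hdvd : ∀ (m : ℕ) (G : MvPolynomial (Fin 3) k), G.IsHomogeneous m →
      MvPolynomial.aeval c G = 0 → F ∣ G) :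
    planeZeroLocus F = .closure (Set.range (projectivePoint c k hc)) := by
  classical
  let p : Spec (.of K) := IsLocalRing.closedPoint K
  have hrange : Set.range (projectivePoint c k hc) = {projectivePoint c k hc p} := by
    have : Subsingleton (Spec (.of K)) := inferInstanceAs (Subsingleton (PrimeSpectrum K))
    ext q
    constructor
    · rintro ⟨p', rfl⟩
      rw [Subsingleton.elim p' p]
      rfl
    · rintro rfl
      exact ⟨p, rfl⟩
  rw [hrange]
  apply le_antisymm
  · intro q hq
    have hFq : F ∈ q.asHomogeneousIdeal := hq rfl
    refine (ProjectiveSpectrum.le_iff_mem_closure _ _ _).mp ?_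
    intro G hG
    have hG' := (projectivePoint c k hc p).asHomogeneousIdeal.2
    have hG : G ∈ (projectivePoint c k hc p).asHomogeneousIdeal.toIdeal := hG
    change G ∈ q.asHomogeneousIdeal.toIdeal
    rw [← DirectSum.sum_support_decompose (MvPolynomial.homogeneousSubmodule (Fin 3) k) G]
    refine sum_mem fun i _ => ?_
    have h1 := aeval_eq_zero_of_mem c hc p
      (DirectSum.decompose (MvPolynomial.homogeneousSubmodule (Fin 3) k) G i).2 (hG' i hG)
    exact Ideal.mem_of_dvd _ (hdvd i _
      (DirectSum.decompose (MvPolynomial.homogeneousSubmodule (Fin 3) k) G i).2 h1) hFq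
  · refine TopologicalSpace.Closeds.closure_le.mpr ?_
    rintro _ rfl
    rintro _ rfl
    exact mem_of_aeval_eq_zero c hc p hF hd hFc

lemma planeCurve_eq_closureOfPoint (c : Fin 3 → K) (hc : ∃ i, c i ≠ 0)
    {F : MvPolynomial (Fin 3) k} {d : ℕ} (hF : F.IsHomogeneous d) (hd : 0 < d)
    (hFc : MvPolynomial.aeval c F = 0)
    (hdvd : ∀ (m : ℕ) (G : MvPolynomial (Fin 3) k), G.IsHomogeneous m →
      MvPolynomial.aeval c G = 0 → F ∣ G) :
    planeCurve F = closureOfPoint c hc k := by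
  rw [planeCurve, planeZeroLocus_eq_closure c hc hF hd hFc hdvd, ← ker_eq_vanishingIdeal]
  rfl

lemma IsCurveGenerators.birationalOver_planeCurve [IsAlgClosed k] {a b s a' b' s' : k} {x y z : K}
    (h : IsCurveGenerators a b s a' b' s' x y z) (c : Fin 3 → K) {j : Fin 3} (hj : c j ≠ 0)
    (hgen : {x, y, z} ⊆ (IntermediateField.adjoin k (Set.range fun i => c i / c j) : Set K))
    {F : MvPolynomial (Fin 3) k} {d : ℕ} (hF : F.IsHomogeneous d) (hd : 0 < d)
    (hFc : MvPolynomial.aeval c F = 0)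
    (hdvd : ∀ (m : ℕ) (G : MvPolynomial (Fin 3) k), G.IsHomogeneous m →
      MvPolynomial.aeval c G = 0 → F ∣ G) :
    Scheme.BirationalOver (canonicalCurve k x y z).hom (planeCurve F).hom := by
  rw [planeCurve_eq_closureOfPoint c ⟨j, hj⟩ hF hd hFc hdvd]
  refine birationalOver_closureOfPoint_closureOfPoint _ _ c _ (j := 0)
    (by simp [canonicalFunctions]) hj h.intermediateField_adjoin_canonicalFunctions ?_
  rw [← top_le_iff, ← h.adjoin_eq_top, IntermediateField.adjoin_le_iff]
  exact hgen

end PlaneCurve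

end PlaneSextic
end

noncomputable section
namespace PlaneSextic

/-! ### Taylor expansions and partial derivatives. -/

section Multiplicity

open _root_.MvPolynomial

variable {k σ : Type*} [Field k]

/-- The Taylor expansion of a polynomial at a point. -/
def taylorAt (v : σ → k) : MvPolynomial σ k →ₐ[k] MvPolynomial σ k :=
  aeval fun i => C (v i) + X i

lemma constantCoeff_taylorAt (v : σ → k) (F : MvPolynomial σ k) :
    constantCoeff (taylorAt v F) = eval v F := by
  induction F using MvPolynomial.induction_on with
  | C a => simp [taylorAt, algebraMap_eq]
  | add p q hp hq => simp [hp, hq]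
  | mul_X p i hp => rw [map_mul, map_mul, hp]; simp [taylorAt]

lemma pderiv_taylorAt (v : σ → k) (i : σ) (F : MvPolynomial σ k) :
    pderiv i (taylorAt v F) = taylorAt v (pderiv i F) := by
  classical
  induction F using MvPolynomial.induction_on with
  | C a => simp [taylorAt, algebraMap_eq]
  | add p q hp hq => simp [hp, hq]
  | mul_X p j hp =>
    rw [map_mul, pderiv_mul, hp, pderiv_mul, map_add, map_mul, map_mul]
    congr 2
    by_cases hij : j = i
    · subst hij; simp [taylorAt]
    · simp [taylorAt, pderiv_X_of_ne hij]

lemma coeff_single_one_taylorAt (v : σ → k) (i : σ) (F : MvPolynomial σ k) :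
    coeff (Finsupp.single i 1) (taylorAt v F) = eval v (pderiv i F) := by
  rw [← constantCoeff_taylorAt, ← pderiv_taylorAt, constantCoeff_eq, coeff_pderiv]
  simp

lemma two_mul_coeff_single_two_taylorAt (v : σ → k) (i : σ) (F : MvPolynomial σ k) :
    2 * coeff (Finsupp.single i 2) (taylorAt v F) = eval v (pderiv i (pderiv i F)) := by
  rw [← constantCoeff_taylorAt, ← pderiv_taylorAt, ← pderiv_taylorAt, constantCoeff_eq,
    coeff_pderiv, coeff_pderiv, zero_add, ← Finsupp.single_add]
  simp [mul_comm, one_add_one_eq_two]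

end Multiplicity

/-! ### Singular points and double points by partial derivatives. -/

section SingularPoints

open _root_.MvPolynomial

variable {k : Type u} [Field k] {F : MvPolynomial (Fin 3) k}

lemma multiplicityAt_eq (F : MvPolynomial (Fin 3) k) (P : Projectivization k (Fin 3 → k)) :
    multiplicityAt F P = (taylorAt P.rep F).toMvPowerSeries.order := rfl

lemma two_le_multiplicityAt_iff {P : Projectivization k (Fin 3 → k)} :
    2 ≤ multiplicityAt F P ↔ eval P.rep F = 0 ∧ ∀ i, eval P.rep (pderiv i F) = 0 := by
  rw [multiplicityAt_eq]
  constructor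
  · intro h
    constructor
    · rw [← constantCoeff_taylorAt, constantCoeff_eq, ← coeff_coe]
      exact MvPowerSeries.coeff_of_lt_order (lt_of_lt_of_le (by simp) h)
    · intro i
      rw [← coeff_single_one_taylorAt, ← coeff_coe]
      refine MvPowerSeries.coeff_of_lt_order (lt_of_lt_of_le ?_ h)
      rw [Finsupp.degree_single]
      norm_num
  · rintro ⟨h0, h1⟩
    refine MvPowerSeries.nat_le_order fun d hd => ?_
    rw [coeff_coe]
    obtain hd | hd : d.degree = 0 ∨ d.degree = 1 := by lia
    · rw [(Finsupp.degree_eq_zero_iff d).mp hd, ← constantCoeff_eq, constantCoeff_taylorAt, h0]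
    · obtain ⟨i, hi⟩ : ∃ i, d i ≠ 0 := by
        by_contra! hd0
        rw [show d = 0 from Finsupp.ext hd0] at hd
        simp at hd
      have hle : Finsupp.single i 1 ≤ d := by simpa [Nat.one_le_iff_ne_zero] using hi
      obtain ⟨e, rfl⟩ := exists_add_of_le hle
      rw [map_add, Finsupp.degree_single, Nat.add_eq_left, Finsupp.degree_eq_zero_iff] at hd
      subst hd
      rw [add_zero, coeff_single_one_taylorAt, h1]

/-- This second partial derivative is twice the coefficient of `Xᵢ²` in the Taylor expansion, so
that coefficient is nonzero. -/
lemma multiplicityAt_le_two {P : Projectivization k (Fin 3 → k)} {i : Fin 3}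
    (h : eval P.rep (pderiv i (pderiv i F)) ≠ 0) : multiplicityAt F P ≤ 2 := by
  rw [← two_mul_coeff_single_two_taylorAt, ← coeff_coe] at h
  refine (MvPowerSeries.order_le (right_ne_zero_of_mul h)).trans ?_
  rw [Finsupp.degree_single]
  norm_num

lemma multiplicityAt_eq_two
    (h : ∀ w : Fin 3 → k, w ≠ 0 → eval w F = 0 → (∀ i, eval w (pderiv i F) = 0) →
      ∃ i, eval w (pderiv i (pderiv i F)) ≠ 0)
    {P : Projectivization k (Fin 3 → k)} (hP : P ∈ singularPoints F) :
    multiplicityAt F P = 2 := by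
  obtain ⟨h0, h1⟩ := two_le_multiplicityAt_iff.mp hP
  obtain ⟨i, hi⟩ := h _ P.rep_nonzero h0 h1
  exact le_antisymm (multiplicityAt_le_two hi) hP

lemma encard_singularPoints {s : ℕ} (v : Fin s → Fin 3 → k) (hv : ∀ i, v i ≠ 0)
    (hinj : ∀ i j (a : k), a • v j = v i → i = j)
    (h : ∀ w : Fin 3 → k, w ≠ 0 → ((eval w F = 0 ∧ ∀ i, eval w (pderiv i F) = 0) ↔
      ∃ i, ∃ a : k, a • v i = w)) :
    (singularPoints F).encard = s := by
  have hrange : singularPoints F = Set.range fun i => Projectivization.mk k (v i) (hv i) := by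
    ext P
    rw [singularPoints, Set.mem_ofPred_eq, two_le_multiplicityAt_iff, h _ P.rep_nonzero,
      Set.mem_range]
    refine exists_congr fun i => ?_
    conv_rhs => rw [eq_comm, ← P.mk_rep, Projectivization.mk_eq_mk_iff']
  have hinj' : Function.Injective fun i => Projectivization.mk k (v i) (hv i) := by
    intro i j hij
    obtain ⟨a, ha⟩ := (Projectivization.mk_eq_mk_iff' ..).mp hij
    exact hinj i j a ha
  rw [hrange, ← Set.image_univ, hinj'.encard_image, Set.encard_univ, ENat.card_eq_coe_natCard,
    Nat.card_fin]

end SingularPoints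

end PlaneSextic
end

noncomputable section
namespace PlaneSextic

/-! ### Irreducibility of `α X⁴ + β X² + γ` over a field, and divisibility by Gauss's lemma. -/

section BiquadraticPolynomial

open Polynomial

variable {E : Type*} [Field E]

/-- After normalisation to a monic polynomial, a root `r` makes the discriminant the square of `2αr²
+ β`. In a product of monic quadratics the linear coefficients are opposite, and either both vanish,
which again makes the discriminant a square, or the constant terms agree; the latter is the case
excluded by `h2`. -/
lemma irreducible_biquadratic {α β γ : E} (hα : α ≠ 0) (h1 : ¬ IsSquare (β ^ 2 - 4 * α * γ))
    (h2 : ∀ δ, δ ^ 2 = α * γ → ¬ IsSquare (α * (2 * δ - β))) :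
    Irreducible (C α * X ^ 4 + C β * X ^ 2 + C γ) := by
  obtain ⟨B, rfl⟩ : ∃ B, β = α * B := ⟨α⁻¹ * β, by field_simp⟩
  obtain ⟨D, rfl⟩ : ∃ D, γ = α * D := ⟨α⁻¹ * γ, by field_simp⟩
  have hmonic : (X ^ 4 + C B * X ^ 2 + C D).Monic := by monicity!
  have hdeg : (X ^ 4 + C B * X ^ 2 + C D).natDegree = 4 := by compute_degree!
  have hf : C α * X ^ 4 + C (α * B) * X ^ 2 + C (α * D) = C α * (X ^ 4 + C B * X ^ 2 + C D) := by
    simp only [C_mul]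
    ring
  rw [hf, irreducible_isUnit_mul (isUnit_C.mpr hα.isUnit),
    hmonic.irreducible_iff_natDegree']
  refine ⟨fun h => by simp [h] at hdeg, ?_⟩
  intro g h hg hh hgh
  rw [hdeg]
  intro hmem
  have hsum : g.natDegree + h.natDegree = 4 := by rw [← hg.natDegree_mul hh, hgh, hdeg]
  obtain hh1 | hh2 : h.natDegree = 1 ∨ h.natDegree = 2 := by
    have := Finset.mem_Ioc.mp hmem
    lia
  · obtain ⟨r, hr⟩ := exists_root_of_degree_eq_one (by
      rw [degree_eq_natDegree hh.ne_zero, hh1]; rfl)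
    have hr' : (X ^ 4 + C B * X ^ 2 + C D).eval r = 0 := by
      rw [← hgh, eval_mul, hr.eq_zero, mul_zero]
    simp only [eval_add, eval_mul, eval_pow, eval_X, eval_C] at hr'
    exact h1 ⟨α * (2 * r ^ 2 + B), by linear_combination (-4 * α ^ 2) * hr'⟩
  · have hg2 : g.natDegree = 2 := by lia
    have c (n : ℕ) := congr(($hgh).coeff n)
    have e3 := c 3
    have e2 := c 2
    have e1 := c 1
    have e0 := c 0
    have g2 : g.coeff 2 = 1 := by rw [← hg2]; exact hg
    have h2' : h.coeff 2 = 1 := by rw [← hh2]; exact hh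
    have g3 : g.coeff 3 = 0 := coeff_eq_zero_of_natDegree_lt (by lia)
    have h3 : h.coeff 3 = 0 := coeff_eq_zero_of_natDegree_lt (by lia)
    simp [coeff_mul, Finset.Nat.antidiagonal_succ, g2, h2', g3, h3, coeff_X_pow, coeff_C]
      at e3 e2 e1 e0
    generalize g.coeff 0 = a0 at *
    generalize g.coeff 1 = a1 at *
    generalize h.coeff 0 = b0 at *
    generalize h.coeff 1 = b1 at *
    obtain rfl : a1 = -b1 := by linear_combination e3
    obtain hb1 | hab : b1 = 0 ∨ a0 - b0 = 0 := by
      rw [← mul_eq_zero]; linear_combination e1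
    · exact h1 ⟨α * (a0 - b0), by
        rw [hb1] at e2
        rw [← e2, ← e0]
        ring⟩
    · obtain rfl : a0 = b0 := by linear_combination hab
      exact h2 (α * a0) (by rw [← e0]; ring) ⟨α * b1, by rw [← e2]; ring⟩

/-- A common root rules out coprimality over the fraction field, so `P` divides `s Q` for some
nonzero constant `s`; the prime `P` has positive degree and cannot divide `s`. -/
lemma dvd_of_eval₂_eq_zero {A : Type*} [CommRing A] [IsDomain A] [UniqueFactorizationMonoid A]
    {L : Type*} [Field L] {P Q : A[X]} (hP : Irreducible P)
    (hP' : Irreducible (P.map (algebraMap A (FractionRing A)))) (hdeg : 0 < P.natDegree)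
    {ι : A →+* L} (hι : Function.Injective ι) {ω : L}
    (h0 : P.eval₂ ι ω = 0) (h0' : Q.eval₂ ι ω = 0) : P ∣ Q := by
  have hlift : (IsFractionRing.lift hι : FractionRing A →+* L).comp (algebraMap A _) = ι :=
    RingHom.ext fun a => IsFractionRing.lift_algebraMap hι a
  obtain ⟨q, hq⟩ | hcop := EuclideanDomain.dvd_or_coprime
    (P.map (algebraMap A (FractionRing A))) (Q.map (algebraMap A (FractionRing A))) hP'
  · obtain ⟨s, hs0, hs⟩ := IsLocalization.integerNormalization_spec (nonZeroDivisors A) q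
    have hdvd : P ∣ C s * Q := by
      refine ⟨IsLocalization.integerNormalization (nonZeroDivisors A) q,
        map_injective _ (IsFractionRing.injective A (FractionRing A)) ?_⟩
      rw [Polynomial.map_mul, Polynomial.map_mul, hs, hq, map_C, mul_smul_comm,
        ← smul_eq_C_mul, algebraMap_smul]
    obtain h' | h' := hP.prime.dvd_or_dvd hdvd
    · have := natDegree_le_of_dvd h' (C_ne_zero.mpr (nonZeroDivisors.ne_zero hs0))
      rw [natDegree_C] at this
      lia
    · exact h'
  · obtain ⟨r, s, hrs⟩ := hcop
    have := congr(($hrs).eval₂ (IsFractionRing.lift hι) ω)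
    rw [eval₂_add, eval₂_mul, eval₂_mul, eval₂_map, eval₂_map, hlift, h0, h0',
      mul_zero, mul_zero, zero_add, eval₂_one] at this
    exact absurd this zero_ne_one

end BiquadraticPolynomial

/-! ### Plane forms `α V⁴ + β V² + γ`: irreducibility and the ideal of a generic point. -/

section BiquadraticForm

open _root_.MvPolynomial

variable {k : Type*} [Field k]

/-- The form `α V⁴ + β V² + γ` in the variables `V = x₀`, `t = x₁`, `b = x₂`, with coefficients
`α, β, γ` in `k[t, b]`. -/
def biquadraticForm (α β γ : MvPolynomial (Fin 2) k) : MvPolynomial (Fin 3) k :=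
  rename Fin.succ α * X 0 ^ 4 + rename Fin.succ β * X 0 ^ 2 + rename Fin.succ γ

lemma finSuccEquiv_rename_succ {n : ℕ} (α : MvPolynomial (Fin n) k) :
    finSuccEquiv k n (rename Fin.succ α) = Polynomial.C α := by
  induction α using MvPolynomial.induction_on with
  | C a => simp [finSuccEquiv_apply]
  | add p q hp hq => simp [hp, hq]
  | mul_X p i hp => rw [map_mul, map_mul, hp, rename_X, finSuccEquiv_X_succ, map_mul]

lemma finSuccEquiv_biquadraticForm (α β γ : MvPolynomial (Fin 2) k) :
    finSuccEquiv k 2 (biquadraticForm α β γ) =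
      .C α * .X ^ 4 + .C β * .X ^ 2 + .C γ := by
  simp only [biquadraticForm, map_add, map_mul, map_pow, finSuccEquiv_rename_succ,
    finSuccEquiv_X_zero]

/-- The dehomogenization `t = 1` of polynomials in `t = x₀` and `b = x₁`. -/
def dehomogenize : MvPolynomial (Fin 2) k →ₐ[k] Polynomial k := aeval ![1, .X]

/-- Conditions on the coefficients `α, β, γ` that make `α V⁴ + β V² + γ` irreducible. -/
structure IsIrreducibleBiquadratic (α β γ : MvPolynomial (Fin 2) k) : Prop where
  ne_zero : α ≠ 0
  not_isSquare_discr :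
    ¬ IsSquare (dehomogenize β ^ 2 - 4 * dehomogenize α * dehomogenize γ)
  not_isSquare : ∀ δ, δ ^ 2 = dehomogenize α * dehomogenize γ →
    ¬ IsSquare (dehomogenize α * (2 * δ - dehomogenize β))
  primitive : ∀ π, Prime π → π ∣ α → π ∣ β → ¬ π ∣ γ

lemma exists_algebraMap_eq_of_sq_eq {A : Type*} [CommRing A] [IsDomain A] [IsIntegrallyClosed A]
    {D : A} {δ : FractionRing A} (h : δ ^ 2 = algebraMap A _ D) :
    ∃ d, d ^ 2 = D ∧ algebraMap A _ d = δ := by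
  obtain ⟨d, hd⟩ := IsIntegrallyClosed.exists_algebraMap_eq_of_isIntegral_pow (R := A)
    (K := FractionRing A) (x := δ) (n := 2) two_pos (h ▸ isIntegral_algebraMap)
  refine ⟨d, IsFractionRing.injective A (FractionRing A) ?_, hd⟩
  rw [map_pow, hd, h]

namespace IsIrreducibleBiquadratic

variable {α β γ : MvPolynomial (Fin 2) k} (h : IsIrreducibleBiquadratic α β γ)
include h

/-- A square root in `k(t, b)` of a polynomial is a polynomial, and it stays a square root after
setting `t = 1`; so the one-variable non-square conditions suffice. -/
lemma irreducible_map : Irreducible ((finSuccEquiv k 2 (biquadraticForm α β γ)).map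
    (algebraMap (MvPolynomial (Fin 2) k) (FractionRing (MvPolynomial (Fin 2) k)))) := by
  simp only [finSuccEquiv_biquadraticForm, Polynomial.map_add, Polynomial.map_mul,
    Polynomial.map_pow, Polynomial.map_C, Polynomial.map_X]
  refine irreducible_biquadratic (by simpa using h.ne_zero) ?_ ?_
  · rintro ⟨δ, hδ⟩
    obtain ⟨d, hd, -⟩ := exists_algebraMap_eq_of_sq_eq (A := MvPolynomial (Fin 2) k)
      (D := β ^ 2 - 4 * α * γ) (δ := δ) (by
        rw [sq, ← hδ, map_sub, map_mul, map_mul, map_pow, map_ofNat])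
    refine h.not_isSquare_discr ⟨dehomogenize d, ?_⟩
    rw [← sq, ← map_pow dehomogenize d, hd, map_sub, map_mul, map_mul, map_pow, map_ofNat]
  · rintro δ hδ ⟨ε, hε⟩
    rw [← map_mul] at hδ
    obtain ⟨d, hd, rfl⟩ := exists_algebraMap_eq_of_sq_eq hδ
    obtain ⟨e, he, -⟩ := exists_algebraMap_eq_of_sq_eq (A := MvPolynomial (Fin 2) k)
      (D := α * (2 * d - β)) (δ := ε) (by
        rw [sq, ← hε, map_mul, map_sub, map_mul, map_ofNat])
    refine h.not_isSquare (dehomogenize d) (by rw [← map_pow, hd, map_mul])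
      ⟨dehomogenize e, ?_⟩
    rw [← sq, ← map_pow, he, map_mul, map_sub, map_mul, map_ofNat]

lemma isPrimitive : (finSuccEquiv k 2 (biquadraticForm α β γ)).IsPrimitive := by
  intro r hr
  by_contra hu
  rw [finSuccEquiv_biquadraticForm, Polynomial.C_dvd_iff_dvd_coeff] at hr
  have hα : r ∣ α := by simpa [Polynomial.coeff_X_pow, Polynomial.coeff_C] using hr 4
  have hβ : r ∣ β := by simpa [Polynomial.coeff_X_pow, Polynomial.coeff_C] using hr 2
  have hγ : r ∣ γ := by simpa [Polynomial.coeff_X_pow, Polynomial.coeff_C] using hr 0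
  obtain ⟨π, hπ, hπr⟩ := WfDvdMonoid.exists_irreducible_factor hu
    (ne_zero_of_dvd_ne_zero h.ne_zero hα)
  exact h.primitive π hπ.prime (hπr.trans hα) (hπr.trans hβ) (hπr.trans hγ)

lemma irreducible_finSuccEquiv : Irreducible (finSuccEquiv k 2 (biquadraticForm α β γ)) :=
  h.isPrimitive.irreducible_iff_irreducible_map_fraction_map.mpr h.irreducible_map

lemma irreducible : Irreducible (biquadraticForm α β γ) :=
  (MulEquiv.irreducible_iff (finSuccEquiv k 2)).mp h.irreducible_finSuccEquiv

end IsIrreducibleBiquadratic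

section Substitution

variable {K : Type*} [Field K] [Algebra k K]

/-- The homomorphism from `k[t, b]` to `K[T]` with `t ↦ T` and `b ↦ u T`. -/
def homogeneousSubstitution (u : K) : MvPolynomial (Fin 2) k →ₐ[k] Polynomial K :=
  aeval ![.X, .X * .C u]

lemma coeff_coeff_aeval (p : MvPolynomial (Fin 2) k) (d : Fin 2 →₀ ℕ) :
    ((aeval ![.X, .X * .C .X] p : Polynomial (Polynomial k)).coeff (d 0 + d 1)).coeff (d 1) =
      p.coeff d := by
  induction p using MvPolynomial.induction_on' with
  | add p q hp hq => rw [map_add, Polynomial.coeff_add, Polynomial.coeff_add, hp, hq, coeff_add]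
  | monomial n a =>
    have : (aeval ![.X, .X * .C .X] (monomial n a) : Polynomial (Polynomial k)) =
        .monomial (n 0 + n 1) (.monomial (n 1) a) := by
      rw [aeval_monomial, Finsupp.prod_fintype _ _ (by simp), Fin.prod_univ_two]
      simp only [Matrix.cons_val_zero, Matrix.cons_val_one, ← Polynomial.C_mul_X_pow_eq_monomial,
        Polynomial.algebraMap_apply, Algebra.algebraMap_self, RingHom.id_apply, map_mul, map_pow]
      ring
    rw [this, Polynomial.coeff_monomial, coeff_monomial]
    by_cases h : n = d
    · simp [h]
    · rw [if_neg h]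
      split_ifs with h'
      · rw [Polynomial.coeff_monomial, if_neg]
        intro h1
        exact h (Finsupp.ext fun i => by fin_cases i <;> simp <;> lia)
      · simp

/-- The substitution factors through `k[U][T]` by `t ↦ T`, `b ↦ TU`, where the monomial `t^i b^j`
becomes `T^(i+j) U^j`, so no coefficients are merged. -/
lemma homogeneousSubstitution_injective {u : K} (hu : Transcendental k u) :
    Function.Injective (homogeneousSubstitution (k := k) u) := by
  have h : (homogeneousSubstitution (k := k) u : MvPolynomial (Fin 2) k → Polynomial K) =
      Polynomial.map (Polynomial.aeval u : Polynomial k →ₐ[k] K).toRingHom ∘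
        (aeval ![.X, .X * .C .X] : MvPolynomial (Fin 2) k →ₐ[k] Polynomial (Polynomial k)) := by
    funext p
    induction p using MvPolynomial.induction_on with
    | C a =>
      simp only [homogeneousSubstitution, Function.comp_apply, algHom_C]
      simp [Polynomial.algebraMap_apply]
    | add p q hp hq => simp_all
    | mul_X p i hp =>
      simp only [Function.comp_apply, map_mul, Polynomial.map_mul] at hp ⊢
      rw [hp]
      congr 1
      fin_cases i <;> simp [homogeneousSubstitution]
  rw [h]
  refine (Polynomial.map_injective _ (transcendental_iff_injective.mp hu)).comp ?_
  intro p q hpq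
  ext d
  rw [← coeff_coeff_aeval, hpq, coeff_coeff_aeval]

lemma eval₂_finSuccEquiv {w u : K} (G : MvPolynomial (Fin 3) k) :
    (finSuccEquiv k 2 G).eval₂ (homogeneousSubstitution u).toRingHom (.X * .C w) =
      aeval (fun i => .X * .C ((![w, 1, u] : Fin 3 → K) i)) G := by
  induction G using MvPolynomial.induction_on with
  | C a => simp [finSuccEquiv_apply, homogeneousSubstitution]
  | add p q hp hq => rw [map_add, Polynomial.eval₂_add, hp, hq, map_add]
  | mul_X p i hp =>
    rw [map_mul, Polynomial.eval₂_mul, hp, map_mul]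
    congr 1
    refine Fin.cases ?_ (fun j => ?_) i
    · rw [finSuccEquiv_X_zero, Polynomial.eval₂_X, aeval_X, Matrix.cons_val_zero]
    · rw [finSuccEquiv_X_succ]
      fin_cases j <;> simp [homogeneousSubstitution]

lemma eval₂_finSuccEquiv_eq_zero {w u : K} {G : MvPolynomial (Fin 3) k} {m : ℕ}
    (hG : G.IsHomogeneous m) (h : aeval ![w, 1, u] G = 0) :
    (finSuccEquiv k 2 G).eval₂ (homogeneousSubstitution u).toRingHom (.X * .C w) = 0 := by
  rw [eval₂_finSuccEquiv, aeval_mul_of_isHomogeneous _ hG]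
  have : aeval (fun i => .C ((![w, 1, u] : Fin 3 → K) i)) G =
      Polynomial.CAlgHom (R := k) (aeval ![w, 1, u] G) := by
    exact (comp_aeval_apply (f := ![w, 1, u]) (Polynomial.CAlgHom (R := k) (A := K)) G).symm
  rw [this, h, map_zero, mul_zero]

/-- Forms vanishing at `(w, 1, u)` vanish at `(Tw, T, Tu)` for an indeterminate `T`. As `t ↦ T`, `b
↦ Tu` is injective on `k[t, b]`, both forms become polynomials in `V` over `k[t, b]` with the common
root `Tw`. -/
lemma IsIrreducibleBiquadratic.dvd {α β γ : MvPolynomial (Fin 2) k}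
    (h : IsIrreducibleBiquadratic α β γ) {w u : K} (hu : Transcendental k u) {d : ℕ}
    (hF : (biquadraticForm α β γ).IsHomogeneous d)
    (hFc : aeval ![w, 1, u] (biquadraticForm α β γ) = 0)
    (m : ℕ) (G : MvPolynomial (Fin 3) k) (hG : G.IsHomogeneous m)
    (hGc : aeval ![w, 1, u] G = 0) : biquadraticForm α β γ ∣ G := by
  rw [← map_dvd_iff (finSuccEquiv k 2)]
  have hι : Function.Injective ((algebraMap (Polynomial K) (FractionRing (Polynomial K))).comp
      (homogeneousSubstitution (k := k) u).toRingHom) :=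
    (IsFractionRing.injective (Polynomial K) (FractionRing (Polynomial K))).comp
      (homogeneousSubstitution_injective hu)
  refine dvd_of_eval₂_eq_zero h.irreducible_finSuccEquiv h.irreducible_map ?_ hι
    (ω := algebraMap (Polynomial K) (FractionRing (Polynomial K)) (.X * .C w)) ?_ ?_
  · have : (.C α * .X ^ 4 + .C β * .X ^ 2 + .C γ :
        Polynomial (MvPolynomial (Fin 2) k)).natDegree = 4 := by
      compute_degree!
      exact h.ne_zero
    rw [finSuccEquiv_biquadraticForm, this]
    exact four_pos
  · rw [← Polynomial.hom_eval₂, eval₂_finSuccEquiv_eq_zero hF hFc, map_zero]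
  · rw [← Polynomial.hom_eval₂, eval₂_finSuccEquiv_eq_zero hG hGc, map_zero]

end Substitution

end BiquadraticForm

end PlaneSextic
end

noncomputable section
namespace PlaneSextic
attribute [local instance] MvPolynomial.gradedAlgebra

section Nonsquare

variable {R : Type*} [CommRing R]

lemma not_isSquare_of_squarefree {f : R} (hf : Squarefree f) (hu : ¬ IsUnit f) : ¬ IsSquare f := by
  rintro ⟨d, hd⟩
  have := hf d (dvd_of_eq hd.symm)
  exact hu (hd ▸ this.mul this)

end Nonsquare

section FormLemmas

open _root_.MvPolynomial

variable {k : Type*} [Field k]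

lemma isHomogeneous_biquadraticForm {α β γ : MvPolynomial (Fin 2) k} {d : ℕ}
    (hα : α.IsHomogeneous d) (hβ : β.IsHomogeneous (d + 2)) (hγ : γ.IsHomogeneous (d + 4)) :
    (biquadraticForm α β γ).IsHomogeneous (d + 4) :=
  (((hα.rename_isHomogeneous).mul (isHomogeneous_X_pow _ _)).add
    ((hβ.rename_isHomogeneous).mul (isHomogeneous_X_pow _ _))).add hγ.rename_isHomogeneous

lemma pderiv_ofNat {σ : Type*} (i : σ) (n : ℕ) [n.AtLeastTwo] :
    pderiv i (no_index (OfNat.ofNat n) : MvPolynomial σ k) = 0 :=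
  Derivation.map_natCast _ n

lemma not_prime_dvd_X {π : MvPolynomial (Fin 2) k} (hπ : Prime π) (h0 : π ∣ X 0)
    (h1 : π ∣ X 1) : False := by
  have := (X_dvd_X (R := k)).mp
    (((hπ.irreducible.associated_of_dvd (X_prime (R := k)).irreducible h0).symm.dvd).trans h1)
  simp at this

end FormLemmas

/-! ### The sextic with two, three or four double points. -/

section ProductModel

open _root_.MvPolynomial

variable {k : Type u} [Field k]

/-- The sextic `t² V⁴ - (b⁴ + m t⁴) V² + t² (p b² + q t²)²`, a model of the function field of
`y² = x⁴ + 2 p x² + m + 2 q`, `z² = x⁴ - 2 p x² + m - 2 q` with `V = (y + z) / 2` and `b = x`. -/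
def productSextic (p q m : k) : MvPolynomial (Fin 3) k :=
  biquadraticForm (X 0 ^ 2) (-(X 1 ^ 4 + C m * X 0 ^ 4))
    (X 0 ^ 2 * (C p * X 1 ^ 2 + C q * X 0 ^ 2) ^ 2)

lemma productSextic_eq (p q m : k) : productSextic p q m =
    X 1 ^ 2 * X 0 ^ 4 - (X 2 ^ 4 + C m * X 1 ^ 4) * X 0 ^ 2 +
      X 1 ^ 2 * (C p * X 2 ^ 2 + C q * X 1 ^ 2) ^ 2 := by
  simp only [productSextic, biquadraticForm, map_mul, map_pow, map_add, map_neg, rename_X,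
    rename_C, Fin.succ_zero_eq_one, Fin.succ_one_eq_two]
  ring

variable (p q m : k) (w : Fin 3 → k)

lemma isHomogeneous_productSextic : (productSextic p q m).IsHomogeneous 6 := by
  have hX (i : Fin 2) (n : ℕ) : (X i ^ n : MvPolynomial (Fin 2) k).IsHomogeneous n :=
    isHomogeneous_X_pow _ _
  have hC (a : k) (i : Fin 2) (n : ℕ) : (C a * X i ^ n : MvPolynomial (Fin 2) k).IsHomogeneous n :=
    (hX i n).C_mul a
  exact isHomogeneous_biquadraticForm (hX 0 2) ((hX 1 4).add (hC m 0 4)).neg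
    ((hX 0 2).mul (((hC p 1 2).add (hC q 0 2)).pow 2))

lemma eval_productSextic : eval w (productSextic p q m) =
    w 1 ^ 2 * w 0 ^ 4 - (w 2 ^ 4 + m * w 1 ^ 4) * w 0 ^ 2 +
      w 1 ^ 2 * (p * w 2 ^ 2 + q * w 1 ^ 2) ^ 2 := by
  simp [productSextic_eq]

lemma pderiv_zero_productSextic : pderiv 0 (productSextic p q m) =
    4 * X 1 ^ 2 * X 0 ^ 3 - 2 * (X 2 ^ 4 + C m * X 1 ^ 4) * X 0 := by
  simp [productSextic_eq, pderiv_X]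
  ring

lemma pderiv_one_productSextic : pderiv 1 (productSextic p q m) =
    2 * X 1 * X 0 ^ 4 - 4 * C m * X 1 ^ 3 * X 0 ^ 2 +
      2 * X 1 * (C p * X 2 ^ 2 + C q * X 1 ^ 2) ^ 2 +
      4 * C q * X 1 ^ 3 * (C p * X 2 ^ 2 + C q * X 1 ^ 2) := by
  simp [productSextic_eq, pderiv_X]
  ring

lemma pderiv_two_productSextic : pderiv 2 (productSextic p q m) =
    - 4 * X 2 ^ 3 * X 0 ^ 2 + 4 * C p * X 2 * X 1 ^ 2 * (C p * X 2 ^ 2 + C q * X 1 ^ 2) := by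
  simp [productSextic_eq, pderiv_X]
  ring

lemma eval_pderiv_pderiv_zero_productSextic :
    eval w (pderiv 0 (pderiv 0 (productSextic p q m))) =
      12 * w 1 ^ 2 * w 0 ^ 2 - 2 * (w 2 ^ 4 + m * w 1 ^ 4) := by
  simp [pderiv_zero_productSextic, pderiv_X, pderiv_ofNat]
  ring

lemma eval_pderiv_pderiv_one_productSextic (h1 : w 1 = 0) (h2 : w 2 = 0) :
    eval w (pderiv 1 (pderiv 1 (productSextic p q m))) = 2 * w 0 ^ 4 := by
  simp [pderiv_one_productSextic, pderiv_X, pderiv_ofNat, h1, h2]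
  ring

variable {p q m w}

section

variable (hpair : IsBiquadraticPair (2 * p) 0 (m + 2 * q) (-2 * p) 0 (m - 2 * q))

include hpair

/-- On `t = 0` the form is `-b⁴V²`. Elsewhere put `v = V/t`, `x = b/t`, `N = p x² + q`. At a
singular point with `v ≠ 0`, vanishing of the form and of its `V`-derivative gives `v² = ±N` and `x⁴
+ m = ±2N`, so `x` is a root of one quartic; the `b`-derivative makes it a double root. Hence `v =
0`, and then `N = 0`. -/
lemma singular_productSextic_iff :
    (eval w (productSextic p q m) = 0 ∧ ∀ i, eval w (pderiv i (productSextic p q m)) = 0) ↔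
      w 1 = 0 ∧ (w 0 = 0 ∨ w 2 = 0) ∨ w 1 ≠ 0 ∧ w 0 = 0 ∧ p * w 2 ^ 2 + q * w 1 ^ 2 = 0 := by
  have h2 := hpair.two_ne_zero
  rw [Fin.forall_fin_succ, Fin.forall_fin_succ, Fin.forall_fin_one]
  simp only [Fin.succ_zero_eq_one, Fin.succ_one_eq_two, eval_productSextic,
    pderiv_zero_productSextic, pderiv_one_productSextic, pderiv_two_productSextic]
  simp only [map_add, map_sub, map_mul, map_pow, map_neg, map_ofNat, eval_X, eval_C]
  generalize w 0 = V
  generalize w 1 = t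
  generalize w 2 = b
  constructor
  · rintro ⟨e, eV, -, eb⟩
    by_cases ht : t = 0
    · left
      refine ⟨ht, ?_⟩
      simp only [ht] at e
      have : (V * b ^ 2) ^ 2 = 0 := by linear_combination -e
      have := mul_eq_zero.mp (pow_eq_zero_iff two_ne_zero |>.mp this)
      simpa using this
    · right
      obtain ⟨v, rfl⟩ : ∃ v, V = t * v := ⟨V / t, by field_simp⟩
      obtain ⟨x, rfl⟩ : ∃ x, b = t * x := ⟨b / t, by field_simp⟩
      replace e : v ^ 4 - (x ^ 4 + m) * v ^ 2 + (p * x ^ 2 + q) ^ 2 = 0 :=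
        mul_left_cancel₀ (pow_ne_zero 6 ht) (by linear_combination e)
      replace eV : v * (2 * v ^ 2 - (x ^ 4 + m)) = 0 :=
        mul_left_cancel₀ (mul_ne_zero h2 (pow_ne_zero 5 ht)) (by linear_combination eV)
      replace eb : 4 * (p * x * (p * x ^ 2 + q) - x ^ 3 * v ^ 2) = 0 :=
        mul_left_cancel₀ (pow_ne_zero 5 ht) (by linear_combination eb)
      have hv : v = 0 := by
        by_contra hv
        have he := (mul_eq_zero.mp eV).resolve_left hv
        have : (v ^ 2 - (p * x ^ 2 + q)) * (v ^ 2 + (p * x ^ 2 + q)) = 0 := by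
          linear_combination - e + v ^ 2 * he
        obtain h | h := mul_eq_zero.mp this
        · refine hpair.separable_right x (by linear_combination 2 * h - he)
            (mul_left_cancel₀ (pow_ne_zero 2 hv) (by linear_combination -eb - 4 * p * x * h))
        · refine hpair.separable_left x (by linear_combination 2 * h - he)
            (mul_left_cancel₀ (pow_ne_zero 2 hv) (by linear_combination -eb + 4 * p * x * h))
      subst hv
      have hN : p * x ^ 2 + q = 0 := by simpa using e
      exact ⟨ht, mul_zero _, by linear_combination t ^ 2 * hN⟩
  · rintro (⟨rfl, rfl | rfl⟩ | ⟨-, rfl, hN⟩)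
    · simp
    · simp
    · simp [hN]

lemma exists_pderiv_pderiv_productSextic_ne_zero (hw : w ≠ 0)
    (h : eval w (productSextic p q m) = 0)
    (h' : ∀ i, eval w (pderiv i (productSextic p q m)) = 0) :
    ∃ i, eval w (pderiv i (pderiv i (productSextic p q m))) ≠ 0 := by
  have h2 := hpair.two_ne_zero
  obtain ⟨h1, h0 | h0⟩ | ⟨ht, h0, hN⟩ := (singular_productSextic_iff hpair).mp ⟨h, h'⟩
  · have hb : w 2 ≠ 0 := fun hb => hw (funext fun i => by fin_cases i <;> assumption)
    refine ⟨0, ?_⟩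
    rw [eval_pderiv_pderiv_zero_productSextic, h0, h1]
    simpa [h2] using hb
  · have hV : w 0 ≠ 0 := fun hb => hw (funext fun i => by fin_cases i <;> assumption)
    refine ⟨1, ?_⟩
    rw [eval_pderiv_pderiv_one_productSextic _ _ _ _ h1 h0]
    simpa [h2] using hV
  · refine ⟨0, ?_⟩
    rw [eval_pderiv_pderiv_zero_productSextic, h0]
    generalize w 1 = t at *
    obtain ⟨x, hx⟩ : ∃ x, w 2 = t * x := ⟨w 2 / t, by field_simp⟩
    rw [hx] at hN ⊢
    replace hN : p * x ^ 2 + q = 0 := mul_left_cancel₀ (pow_ne_zero 2 ht) (by linear_combination hN)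
    intro he
    replace he : x ^ 4 + m = 0 :=
      mul_left_cancel₀ (mul_ne_zero h2 (pow_ne_zero 4 ht)) (by linear_combination -he)
    -- The quartics are `x⁴ + m ± 2N`, so `N = 0` and `x⁴ + m = 0` would give a common root.
    exact hpair.coprime x (by linear_combination he + 2 * hN) (by linear_combination he - 2 * hN)

lemma encard_singularPoints_productSextic {r : ℕ} (ρ : Fin r → k) (hρ : Function.Injective ρ)
    (hroots : ∀ x, p * x ^ 2 + q = 0 ↔ ∃ i, ρ i = x) :
    (singularPoints (productSextic p q m)).encard = (r + 2 : ℕ) := by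
  refine encard_singularPoints
    (Fin.cons ![1, 0, 0] (Fin.cons ![0, 0, 1] fun i => ![0, 1, ρ i]) : Fin (r + 2) → Fin 3 → k)
    ?_ ?_ ?_
  · refine Fin.cases ?_ (Fin.cases ?_ fun i => ?_) <;> simp
  · refine Fin.cases (Fin.cases ?_ (Fin.cases ?_ fun i => ?_))
      (Fin.cases (Fin.cases ?_ (Fin.cases ?_ fun i => ?_))
        fun i => (Fin.cases ?_ (Fin.cases ?_ fun j => ?_))) <;>
      simp [funext_iff, Fin.forall_fin_succ]
    exact fun h => hρ h.symm
  · intro w hw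
    rw [singular_productSextic_iff hpair, Fin.exists_fin_succ, Fin.exists_fin_succ]
    simp only [Fin.cons_zero, Fin.cons_succ, funext_iff, Fin.forall_fin_succ]
    simp
    constructor
    · rintro (⟨h1, h0 | h2⟩ | ⟨h1, h0, hN⟩)
      · exact .inr (.inl ⟨h0.symm, h1.symm⟩)
      · exact .inl ⟨h1.symm, h2.symm⟩
      · obtain ⟨i, hi⟩ := (hroots (w 2 / w 1)).mp (by
          field_simp
          linear_combination hN)
        exact .inr (.inr ⟨h0.symm, i, by rw [hi]; field_simp⟩)
    · rintro (⟨h1, h2⟩ | ⟨h0, h1⟩ | ⟨h0, i, hi⟩)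
      · exact .inl ⟨h1.symm, .inr h2.symm⟩
      · exact .inl ⟨h1.symm, .inl h0.symm⟩
      · by_cases h1 : w 1 = 0
        · exact .inl ⟨h1, .inl h0.symm⟩
        · refine .inr ⟨h1, h0.symm, ?_⟩
          rw [← hi]
          linear_combination w 1 ^ 2 * (hroots (ρ i)).mpr ⟨i, rfl⟩

variable [IsAlgClosed k]

/-- Call the two quartics `f` and `g`. The discriminant is `f g`, and `δ = ±N` turns `α(2δ - β)`
into `f` or `g`; all three are squarefree nonunits. -/
lemma isIrreducibleBiquadratic_productSextic : IsIrreducibleBiquadratic (k := k) (X 0 ^ 2)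
    (-(X 1 ^ 4 + C m * X 0 ^ 4)) (X 0 ^ 2 * (C p * X 1 ^ 2 + C q * X 0 ^ 2) ^ 2) := by
  have hf := (separable_quartic hpair.separable_left).squarefree
  have hg := (separable_quartic hpair.separable_right).squarefree
  have hcop := isCoprime_quartic hpair.coprime
  have hfu := not_isUnit_of_natDegree (natDegree_quartic (2 * p) 0 (m + 2 * q))
  have hgu := not_isUnit_of_natDegree (natDegree_quartic (-2 * p) 0 (m - 2 * q))
  have ef : quartic (2 * p) 0 (m + 2 * q) =
      .X ^ 4 + .C m + 2 * (.C p * .X ^ 2 + .C q) := by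
    simp only [quartic, Polynomial.C_add, Polynomial.C_mul, Polynomial.C_0, Polynomial.C_ofNat]
    ring
  have eg : quartic (-2 * p) 0 (m - 2 * q) =
      .X ^ 4 + .C m - 2 * (.C p * .X ^ 2 + .C q) := by
    simp only [quartic, Polynomial.C_sub, Polynomial.C_mul, Polynomial.C_0, Polynomial.C_ofNat,
      Polynomial.C_neg]
    ring
  have hα : dehomogenize (k := k) (X 0 ^ 2) = 1 := by simp [dehomogenize]
  have hβ : dehomogenize (-(X 1 ^ 4 + C m * X 0 ^ 4)) = -(.X ^ 4 + .C m) := by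
    simp [dehomogenize]
  have hγ : dehomogenize (X 0 ^ 2 * (C p * X 1 ^ 2 + C q * X 0 ^ 2) ^ 2) =
      (.C p * .X ^ 2 + .C q) ^ 2 := by
    simp [dehomogenize]
  refine ⟨pow_ne_zero 2 (X_ne_zero 0), ?_, ?_, ?_⟩
  · rw [hα, hβ, hγ, show (-(.X ^ 4 + .C m)) ^ 2 - 4 * 1 * (.C p * .X ^ 2 + .C q) ^ 2 =
      quartic (2 * p) 0 (m + 2 * q) * quartic (-2 * p) 0 (m - 2 * q) by rw [ef, eg]; ring]
    exact not_isSquare_of_squarefree (squarefree_mul_iff.mpr ⟨hcop.isRelPrime, hf, hg⟩)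
      (fun h => hfu (isUnit_of_mul_isUnit_left h))
  · intro δ hδ
    rw [hα, hγ, one_mul, sq_eq_sq_iff_eq_or_eq_neg] at hδ
    rw [hα, hβ]
    obtain hδ | hδ := hδ
    · rw [hδ, show 1 * (2 * (.C p * .X ^ 2 + .C q) - -(.X ^ 4 + .C m)) =
        quartic (2 * p) 0 (m + 2 * q) by rw [ef]; ring]
      exact not_isSquare_of_squarefree hf hfu
    · rw [hδ, show 1 * (2 * -(.C p * .X ^ 2 + .C q) - -(.X ^ 4 + .C m)) =
        quartic (-2 * p) 0 (m - 2 * q) by rw [eg]; ring]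
      exact not_isSquare_of_squarefree hg hgu
  · intro π hπ h0 h1 _
    have h0 := hπ.dvd_of_dvd_pow h0
    rw [dvd_neg, dvd_add_left ((dvd_pow h0 four_ne_zero).mul_left _)] at h1
    exact not_prime_dvd_X hπ h0 (hπ.dvd_of_dvd_pow h1)

lemma irreducible_productSextic : Irreducible (productSextic p q m) :=
  (isIrreducibleBiquadratic_productSextic hpair).irreducible

end

lemma birationalOver_productSextic [IsAlgClosed k] {K : Type u} [Field K] [Algebra k K] {x y z : K}
    (h : IsCurveGenerators (2 * p) 0 (m + 2 * q) (-2 * p) 0 (m - 2 * q) x y z) :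
    Scheme.BirationalOver (canonicalCurve k x y z).hom (planeCurve (productSextic p q m)).hom := by
  have h2 : (2 : K) ≠ 0 := by
    have := (map_ne_zero (algebraMap k K)).mpr h.pair.two_ne_zero
    rwa [map_ofNat] at this
  have hy := h.sq_left
  have hz := h.sq_right
  simp only [aeval_quartic, map_add, map_sub, map_mul, map_neg, map_ofNat, map_zero] at hy hz
  set P := algebraMap k K p
  set Q := algebraMap k K q
  set M := algebraMap k K m
  obtain ⟨w, hw⟩ : ∃ w, 2 * w = y + z := ⟨(y + z) / 2, by field_simp⟩
  have hw0 : w ≠ 0 := by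
    rintro rfl
    obtain ⟨-, h1, -⟩ := h.isBiquadratic.coeff_eq_zero h.pair.two_ne_zero
      (a := 0) (b := 1) (c := 1) (d := 0) (by simp; linear_combination -hw)
    exact one_ne_zero h1
  -- `(y + z)/2` and `(y - z)/2` have product `P x² + Q`, and their squares add up to `x⁴ + M`.
  have key : w ^ 4 - (x ^ 4 + M) * w ^ 2 + (P * x ^ 2 + Q) ^ 2 = 0 := by
    refine mul_left_cancel₀ (pow_ne_zero 4 h2) ?_
    obtain rfl : y = 2 * w - z := by linear_combination -hw
    generalize hs : (2 * w - z) ^ 2 + z ^ 2 - 2 * (x ^ 4 + M) + 4 * (2 * w - z) * z = s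
    linear_combination (s + 4 * z ^ 2) * hy + (s + 4 * (x ^ 4 + 2 * P * x ^ 2 + M + 2 * Q)) * hz +
      (z ^ 2 + (2 * w - z) ^ 2 - 2 * (x ^ 4 + M)) * hs
  have hF : aeval ![w, 1, x] (productSextic p q m) = 0 := by
    simp [productSextic_eq]
    linear_combination key
  refine h.birationalOver_planeCurve ![w, 1, x] (j := 1) (by simp) ?_
    (isHomogeneous_productSextic p q m) (by norm_num) hF
    ((isIrreducibleBiquadratic_productSextic h.pair).dvd h.transcendental
      (isHomogeneous_productSextic p q m) hF)
  set E := IntermediateField.adjoin k (Set.range fun i => (![w, 1, x] : Fin 3 → K) i / ![w, 1, x] 1)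
  have hwE : w ∈ E := IntermediateField.subset_adjoin _ _ ⟨0, by simp⟩
  have hxE : x ∈ E := IntermediateField.subset_adjoin _ _ ⟨2, by simp⟩
  have hdE : (P * x ^ 2 + Q) / w ∈ E :=
    div_mem (add_mem (mul_mem (E.algebraMap_mem _) (pow_mem hxE 2)) (E.algebraMap_mem _)) hwE
  have hd : (y - z) = 2 * ((P * x ^ 2 + Q) / w) := by
    field_simp
    refine mul_left_cancel₀ h2 ?_
    linear_combination (y - z) * hw + hy - hz
  -- This recovers `y` and `z` from `w` and `x`, so the plane coordinates generate the function
  -- field.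
  have hyE : y = w + (P * x ^ 2 + Q) / w :=
    mul_left_cancel₀ h2 (by linear_combination hd - hw)
  have hzE : z = w - (P * x ^ 2 + Q) / w :=
    mul_left_cancel₀ h2 (by linear_combination -hd - hw)
  rintro _ (rfl | rfl | rfl)
  · exact hxE
  · exact hyE ▸ add_mem hwE hdE
  · exact hzE ▸ sub_mem hwE hdE

end ProductModel

end PlaneSextic
end

noncomputable section
namespace PlaneSextic
attribute [local instance] MvPolynomial.gradedAlgebra

section Nonsquare

open Polynomial

lemma not_isSquare_of_coeff_ne_zero {k : Type*} [Field k] (h2 : (2 : k) ≠ 0) {a b : k}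
    (ha : a ≠ 0) (hb : b ≠ 0) (c : k) : ¬ IsSquare (C a * X ^ 6 + C b * X ^ 2 + C c) := by
  rintro ⟨d, hd⟩
  have hdeg : d.natDegree = 3 := by
    have := congr(($hd).natDegree)
    rw [← sq, natDegree_pow] at this
    have h6 : (C a * X ^ 6 + C b * X ^ 2 + C c).natDegree = 6 := by compute_degree!
    lia
  have e (n : ℕ) := congr(($hd).coeff n)
  have d4 : d.coeff 4 = 0 := coeff_eq_zero_of_natDegree_lt (by lia)
  have d5 : d.coeff 5 = 0 := coeff_eq_zero_of_natDegree_lt (by lia)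
  have d6 : d.coeff 6 = 0 := coeff_eq_zero_of_natDegree_lt (by lia)
  have e6 := e 6
  have e5 := e 5
  have e4 := e 4
  have e2 := e 2
  simp [coeff_mul, Finset.Nat.antidiagonal_succ, d4, d5, d6, coeff_X_pow, coeff_C]
    at e6 e5 e4 e2
  have h3 : d.coeff 3 ≠ 0 := fun h3 => ha (by rw [e6, h3, mul_zero])
  have h2' : d.coeff 2 = 0 := (mul_eq_zero.mp (show 2 * d.coeff 3 * d.coeff 2 = 0 by
    linear_combination -e5)).resolve_left (mul_ne_zero h2 h3)
  have h1 : d.coeff 1 = 0 := (mul_eq_zero.mp (show 2 * d.coeff 3 * d.coeff 1 = 0 by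
    rw [h2'] at e4
    linear_combination -e4)).resolve_left (mul_ne_zero h2 h3)
  exact hb (by rw [e2, h1, h2']; ring)

end Nonsquare

/-! ### The sextic with five double points. -/

section QuotientModel

open _root_.MvPolynomial

variable {k : Type u} [Field k]

/-- The sextic `b (b + r t) V⁴ + (16 r² t⁴ - 2 b² N) V² + b (b - r t) N²` with `N = b² + 8 t²`,
a model of the function field of `y² = x⁴ + r x + 1`, `z² = x⁴ - r x + 1` with
`V = (y + z - 2 x² - 2) / x` and `b = (y - z) / x`. -/
def quotientSextic (r : k) : MvPolynomial (Fin 3) k :=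
  biquadraticForm (X 1 * (X 1 + C r * X 0))
    (C (16 * r ^ 2) * X 0 ^ 4 - C 2 * X 1 ^ 2 * (X 1 ^ 2 + C 8 * X 0 ^ 2))
    (X 1 * (X 1 - C r * X 0) * (X 1 ^ 2 + C 8 * X 0 ^ 2) ^ 2)

lemma quotientSextic_eq (r : k) : quotientSextic r =
    X 2 * (X 2 + C r * X 1) * X 0 ^ 4 +
      (16 * C r ^ 2 * X 1 ^ 4 - 2 * X 2 ^ 2 * (X 2 ^ 2 + 8 * X 1 ^ 2)) * X 0 ^ 2 +
      X 2 * (X 2 - C r * X 1) * (X 2 ^ 2 + 8 * X 1 ^ 2) ^ 2 := by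
  simp only [quotientSextic, biquadraticForm, map_mul, map_pow, map_add, map_sub, rename_X,
    rename_C, Fin.succ_zero_eq_one, Fin.succ_one_eq_two, map_ofNat]

variable (r : k) (w : Fin 3 → k)

lemma isHomogeneous_quotientSextic : (quotientSextic r).IsHomogeneous 6 := by
  have hX (i : Fin 2) (n : ℕ) : (X i ^ n : MvPolynomial (Fin 2) k).IsHomogeneous n :=
    isHomogeneous_X_pow _ _
  have hC (a : k) (i : Fin 2) (n : ℕ) : (C a * X i ^ n : MvPolynomial (Fin 2) k).IsHomogeneous n :=
    (hX i n).C_mul a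
  have hC1 (a : k) (i : Fin 2) : (C a * X i : MvPolynomial (Fin 2) k).IsHomogeneous 1 :=
    (isHomogeneous_X k i).C_mul a
  have hN := (hX 1 2).add (hC 8 0 2)
  exact isHomogeneous_biquadraticForm ((isHomogeneous_X k 1).mul ((isHomogeneous_X k 1).add
    (hC1 r 0))) ((hC _ 0 4).sub ((hC 2 1 2).mul hN))
    (((isHomogeneous_X k 1).mul ((isHomogeneous_X k 1).sub (hC1 r 0))).mul (hN.pow 2))

lemma eval_quotientSextic : eval w (quotientSextic r) =
    w 2 * (w 2 + r * w 1) * w 0 ^ 4 +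
      (16 * r ^ 2 * w 1 ^ 4 - 2 * w 2 ^ 2 * (w 2 ^ 2 + 8 * w 1 ^ 2)) * w 0 ^ 2 +
      w 2 * (w 2 - r * w 1) * (w 2 ^ 2 + 8 * w 1 ^ 2) ^ 2 := by
  simp [quotientSextic_eq]

lemma pderiv_zero_quotientSextic : pderiv 0 (quotientSextic r) =
    4 * X 2 * (X 2 + C r * X 1) * X 0 ^ 3 +
      2 * (16 * C r ^ 2 * X 1 ^ 4 - 2 * X 2 ^ 2 * (X 2 ^ 2 + 8 * X 1 ^ 2)) * X 0 := by
  simp [quotientSextic_eq, pderiv_X, pderiv_ofNat]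
  ring

lemma pderiv_one_quotientSextic : pderiv 1 (quotientSextic r) =
    C r * X 2 * X 0 ^ 4 + (64 * C r ^ 2 * X 1 ^ 3 - 32 * X 2 ^ 2 * X 1) * X 0 ^ 2 -
      C r * X 2 * (X 2 ^ 2 + 8 * X 1 ^ 2) ^ 2 +
      32 * X 2 * (X 2 - C r * X 1) * (X 2 ^ 2 + 8 * X 1 ^ 2) * X 1 := by
  simp [quotientSextic_eq, pderiv_X, pderiv_ofNat]
  ring

lemma pderiv_two_quotientSextic : pderiv 2 (quotientSextic r) =
    (2 * X 2 + C r * X 1) * X 0 ^ 4 - (4 * X 2 * (X 2 ^ 2 + 8 * X 1 ^ 2) + 4 * X 2 ^ 3) * X 0 ^ 2 +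
      (2 * X 2 - C r * X 1) * (X 2 ^ 2 + 8 * X 1 ^ 2) ^ 2 +
      4 * X 2 ^ 2 * (X 2 - C r * X 1) * (X 2 ^ 2 + 8 * X 1 ^ 2) := by
  simp [quotientSextic_eq, pderiv_X, pderiv_ofNat]
  ring

lemma eval_pderiv_pderiv_zero_quotientSextic :
    eval w (pderiv 0 (pderiv 0 (quotientSextic r))) =
      12 * w 2 * (w 2 + r * w 1) * w 0 ^ 2 +
        2 * (16 * r ^ 2 * w 1 ^ 4 - 2 * w 2 ^ 2 * (w 2 ^ 2 + 8 * w 1 ^ 2)) := by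
  simp [pderiv_zero_quotientSextic, pderiv_X, pderiv_ofNat]
  ring

lemma eval_pderiv_pderiv_two_quotientSextic (h1 : w 1 = 0) (h2 : w 2 = 0) :
    eval w (pderiv 2 (pderiv 2 (quotientSextic r))) = 2 * w 0 ^ 4 := by
  simp [pderiv_two_quotientSextic, pderiv_X, pderiv_ofNat, h1, h2]
  ring

variable {r w}

section

variable (h2 : (2 : k) ≠ 0) (hr : 3 * r = 4)

include h2 hr

lemma ne_zero_of_three_mul_eq_four : r ≠ 0 := by
  rintro rfl
  exact pow_ne_zero 2 h2 (by linear_combination -hr)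

lemma three_ne_zero_of_three_mul_eq_four : (3 : k) ≠ 0 := by
  intro h
  rw [h] at hr
  exact pow_ne_zero 2 h2 (by linear_combination -hr)

/-- Up to sign the only candidate for a double root is `±1`, and it would force `2 = 0`. The value
`r = 4/3` makes the discriminant `256 - 27 r⁴ = 512/3` nonzero once 2 and 3 are invertible. -/
lemma isBiquadraticPair_quotientSextic : IsBiquadraticPair 0 r 1 0 (-r) 1 where
  two_ne_zero := h2
  left_ne_zero := one_ne_zero
  right_ne_zero := one_ne_zero
  separable_left t h h' := by
    have h3 : 3 * t ^ 3 + 1 = 0 :=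
      mul_left_cancel₀ (pow_ne_zero 2 h2) (by linear_combination 3 * h' - hr)
    obtain rfl : t = -1 := mul_left_cancel₀ (three_ne_zero_of_three_mul_eq_four h2 hr)
      (by linear_combination 3 * h - t * h3 - t * hr)
    exact h2 (by linear_combination -h3)
  separable_right t h h' := by
    have h3 : 3 * t ^ 3 - 1 = 0 :=
      mul_left_cancel₀ (pow_ne_zero 2 h2) (by linear_combination 3 * h' + hr)
    obtain rfl : t = 1 := mul_left_cancel₀ (three_ne_zero_of_three_mul_eq_four h2 hr)
      (by linear_combination -3 * h + t * h3 - t * hr)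
    exact h2 (by linear_combination h3)
  coprime t h h' := by
    have ht : t = 0 := by
      refine (mul_eq_zero.mp ?_).resolve_left
        (mul_ne_zero h2 (ne_zero_of_three_mul_eq_four h2 hr))
      linear_combination h - h'
    rw [ht] at h
    simp at h

/-- On `t = 0` the form is the square of `b(V - b)(V + b)`. In the affine part write it as `α v⁴ + β
v² + γ`. At a singular point with `v ≠ 0`, either `α = β = 0`, which is impossible, or the
discriminant `4r²(x⁶ - 64x² + 64r²)` and its derivative in `x` vanish together, which the choice of
`r` excludes. -/
lemma singular_quotientSextic_iff :
    (eval w (quotientSextic r) = 0 ∧ ∀ i, eval w (pderiv i (quotientSextic r)) = 0) ↔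
      w 1 = 0 ∧ (w 2 = 0 ∨ w 0 = w 2 ∨ w 0 = -w 2) ∨
        w 1 ≠ 0 ∧ w 0 = 0 ∧ w 2 ^ 2 + 8 * w 1 ^ 2 = 0 := by
  have hr0 := ne_zero_of_three_mul_eq_four h2 hr
  rw [Fin.forall_fin_succ, Fin.forall_fin_succ, Fin.forall_fin_one]
  simp only [Fin.succ_zero_eq_one, Fin.succ_one_eq_two, eval_quotientSextic,
    pderiv_zero_quotientSextic, pderiv_one_quotientSextic, pderiv_two_quotientSextic]
  simp only [map_add, map_sub, map_mul, map_pow, map_ofNat, eval_X, eval_C]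
  generalize w 0 = V
  generalize w 1 = t
  generalize w 2 = b
  constructor
  · rintro ⟨e, eV, -, eb⟩
    by_cases ht : t = 0
    · left
      refine ⟨ht, ?_⟩
      simp only [ht] at e
      have : (b * ((V - b) * (V + b))) ^ 2 = 0 := by linear_combination e
      have := pow_eq_zero_iff two_ne_zero |>.mp this
      rwa [mul_eq_zero, mul_eq_zero, sub_eq_zero, add_eq_zero_iff_eq_neg] at this
    · right
      obtain ⟨v, rfl⟩ : ∃ v, V = t * v := ⟨V / t, by field_simp⟩
      obtain ⟨x, rfl⟩ : ∃ x, b = t * x := ⟨b / t, by field_simp⟩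
      replace e : x * (x + r) * v ^ 4 + (16 * r ^ 2 - 2 * x ^ 2 * (x ^ 2 + 8)) * v ^ 2 +
          x * (x - r) * (x ^ 2 + 8) ^ 2 = 0 :=
        mul_left_cancel₀ (pow_ne_zero 6 ht) (by linear_combination e)
      replace eV : v * (2 * x * (x + r) * v ^ 2 + (16 * r ^ 2 - 2 * x ^ 2 * (x ^ 2 + 8))) = 0 :=
        mul_left_cancel₀ (mul_ne_zero h2 (pow_ne_zero 5 ht)) (by linear_combination eV)
      replace eb : (2 * x + r) * v ^ 4 - (4 * x * (x ^ 2 + 8) + 4 * x ^ 3) * v ^ 2 +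
          (2 * x - r) * (x ^ 2 + 8) ^ 2 + 4 * x ^ 2 * (x - r) * (x ^ 2 + 8) = 0 :=
        mul_left_cancel₀ (pow_ne_zero 5 ht) (by linear_combination eb)
      have hv : v = 0 := by
        by_contra hv
        have he := (mul_eq_zero.mp eV).resolve_left hv
        by_cases hα : x * (x + r) = 0
        · have hβ : 16 * r ^ 2 - 2 * x ^ 2 * (x ^ 2 + 8) = 0 := by
            linear_combination he - 2 * v ^ 2 * hα
          obtain hx | hx := mul_eq_zero.mp hα
          · rw [hx] at hβ
            refine mul_ne_zero (pow_ne_zero 4 h2) (pow_ne_zero 2 hr0) ?_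
            linear_combination hβ
          · rw [show x = -r by linear_combination hx] at hβ
            refine mul_ne_zero h2 (pow_ne_zero 4 hr0) ?_
            linear_combination -hβ
        · have hd : x ^ 6 - 64 * x ^ 2 + 64 * r ^ 2 = 0 := by
            refine mul_left_cancel₀ (mul_ne_zero (pow_ne_zero 2 h2) (pow_ne_zero 2 hr0)) ?_
            linear_combination -4 * (x * (x + r)) * e +
              (2 * x * (x + r) * v ^ 2 + (16 * r ^ 2 - 2 * x ^ 2 * (x ^ 2 + 8))) * he
          -- The derivative of the discriminant, up to the factor `8r²`: differentiate `4α(αv⁴ + βv²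
          -- + γ) = (2αv² + β)² - (β² - 4αγ)`.
          have hd' : x * (3 * x ^ 4 - 64) = 0 := by
            refine mul_left_cancel₀ (mul_ne_zero hα
              (mul_ne_zero (pow_ne_zero 3 h2) (pow_ne_zero 2 hr0))) ?_
            linear_combination -4 * (x * (x + r)) ^ 2 * eb +
              (4 * (x * (x + r)) * (2 * x + r) * v ^ 2 -
                2 * (x * (x + r)) * (4 * x * (x ^ 2 + 8) + 4 * x ^ 3)) * he -
              4 * (x * (x + r)) * (2 * x + r) * e
          obtain hx | hx := mul_eq_zero.mp hd'
          · rw [hx] at hd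
            refine mul_ne_zero (pow_ne_zero 6 h2) (pow_ne_zero 2 hr0) ?_
            linear_combination hd
          · have h3 : 2 * x ^ 2 = 3 * r ^ 2 := by
              refine mul_left_cancel₀ (pow_ne_zero 6 h2) ?_
              linear_combination -3 * hd + x ^ 2 * hx
            -- `3x⁴ = 64`, `2x² = 3r²` and `3r = 4` together yield `2⁹ = 0`.
            refine pow_ne_zero 9 h2 ?_
            linear_combination -12 * hx + 9 * (2 * x ^ 2 + 3 * r ^ 2) * h3 +
              (9 * r ^ 2 + 16) * (3 * r + 4) * hr
      subst hv
      refine ⟨ht, mul_zero _, ?_⟩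
      suffices hN : x ^ 2 + 8 = 0 by linear_combination t ^ 2 * hN
      by_contra hN
      have e' : x * (x - r) = 0 := by
        refine (mul_eq_zero.mp ?_).resolve_right (pow_ne_zero 2 hN)
        linear_combination e
      have eb' : 2 * x - r = 0 := by
        refine (mul_eq_zero.mp ?_).resolve_right (pow_ne_zero 2 hN)
        linear_combination eb - 4 * x * (x ^ 2 + 8) * e'
      refine mul_ne_zero hr0 hr0 ?_
      linear_combination -4 * e' + (2 * x - r) * eb'
  · rintro (⟨rfl, rfl | rfl | rfl⟩ | ⟨-, rfl, hN⟩)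
    · simp
    · refine ⟨?_, ?_, ?_, ?_⟩ <;> ring
    · refine ⟨?_, ?_, ?_, ?_⟩ <;> ring
    · simp [hN]

lemma exists_pderiv_pderiv_quotientSextic_ne_zero (hw : w ≠ 0)
    (h : eval w (quotientSextic r) = 0)
    (h' : ∀ i, eval w (pderiv i (quotientSextic r)) = 0) :
    ∃ i, eval w (pderiv i (pderiv i (quotientSextic r))) ≠ 0 := by
  have hr0 := ne_zero_of_three_mul_eq_four h2 hr
  by_cases h12 : w 1 = 0 ∧ w 2 = 0
  · have hV : w 0 ≠ 0 := fun hb => hw (funext fun i => by fin_cases i <;> simp [h12, hb])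
    refine ⟨2, ?_⟩
    rw [eval_pderiv_pderiv_two_quotientSextic _ _ h12.1 h12.2]
    exact mul_ne_zero h2 (pow_ne_zero 4 hV)
  refine ⟨0, ?_⟩
  rw [eval_pderiv_pderiv_zero_quotientSextic]
  obtain ⟨h1, h0⟩ | ⟨h1, h0, hN⟩ := (singular_quotientSextic_iff h2 hr).mp ⟨h, h'⟩
  · have hb : w 2 ≠ 0 := fun hb => h12 ⟨h1, hb⟩
    have h0 : w 0 ^ 2 = w 2 ^ 2 := sq_eq_sq_iff_eq_or_eq_neg.mpr (h0.resolve_left hb)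
    rw [h0, h1]
    convert mul_ne_zero (pow_ne_zero 3 h2) (pow_ne_zero 4 hb) using 1
    ring
  · rw [h0, hN]
    convert mul_ne_zero (pow_ne_zero 5 h2) (mul_ne_zero (pow_ne_zero 2 hr0) (pow_ne_zero 4 h1))
      using 1
    ring

lemma encard_singularPoints_quotientSextic {ε : k} (hε : ε ^ 2 = -8) :
    (singularPoints (quotientSextic r)).encard = (5 : ℕ) := by
  have hε0 : ε ≠ 0 := by
    rintro rfl
    exact pow_ne_zero 3 h2 (by linear_combination hε)
  refine encard_singularPoints ![![1, 0, 0], ![1, 0, 1], ![-1, 0, 1], ![0, 1, ε], ![0, 1, -ε]]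
    ?_ ?_ ?_
  · intro i
    fin_cases i <;> simp
  · have h1 : (1 : k) ≠ -1 := fun h => h2 (by linear_combination h)
    have h1' : (-1 : k) ≠ 1 := h1.symm
    have h3 : ε ≠ -ε := fun h => mul_ne_zero h2 hε0 (by linear_combination h)
    have h3' : -ε ≠ ε := h3.symm
    intro i j a h
    fin_cases i <;> fin_cases j <;> simp [_root_.funext_iff, Fin.forall_fin_succ] at h ⊢ <;> grind
  · intro w hw
    rw [singular_quotientSextic_iff h2 hr]
    simp only [Fin.exists_fin_succ, _root_.funext_iff, Fin.forall_fin_succ]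
    simp
    constructor
    · rintro (⟨h1, h | h | h⟩ | ⟨h1, h0, hN⟩)
      · exact .inl ⟨h1.symm, h.symm⟩
      · exact .inr (.inl ⟨h1.symm, h⟩)
      · exact .inr (.inr (.inl ⟨h.symm, h1.symm⟩))
      · have : (w 1 * ε - w 2) * (-(w 1 * ε) - w 2) = 0 := by
          linear_combination hN - w 1 ^ 2 * hε
        obtain h | h := mul_eq_zero.mp this
        · exact .inr (.inr (.inr (.inl ⟨h0.symm, sub_eq_zero.mp h⟩)))
        · exact .inr (.inr (.inr (.inr ⟨h0.symm, sub_eq_zero.mp h⟩)))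
    · have hsing {e : k} (h0 : 0 = w 0) (he : w 1 * e = w 2) (he' : e ^ 2 = -8) :
          w 1 = 0 ∧ (w 2 = 0 ∨ w 0 = w 2 ∨ w 0 = -w 2) ∨
            ¬w 1 = 0 ∧ w 0 = 0 ∧ w 2 ^ 2 + 8 * w 1 ^ 2 = 0 := by
        by_cases h1 : w 1 = 0
        · exact .inl ⟨h1, .inl (by rw [← he, h1, zero_mul])⟩
        · exact .inr ⟨h1, h0.symm, by rw [← he]; linear_combination w 1 ^ 2 * he'⟩
      rintro (⟨h1, h⟩ | ⟨h1, h⟩ | ⟨h, h1⟩ | ⟨h0, h⟩ | ⟨h0, h⟩)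
      · exact .inl ⟨h1.symm, .inl h.symm⟩
      · exact .inl ⟨h1.symm, .inr (.inl h)⟩
      · exact .inl ⟨h1.symm, .inr (.inr h.symm)⟩
      · exact hsing h0 h hε
      · exact hsing h0 (e := -ε) (by rw [mul_neg, h]) (by rw [neg_sq, hε])

lemma isIrreducibleBiquadratic_quotientSextic : IsIrreducibleBiquadratic (k := k)
    (X 1 * (X 1 + C r * X 0))
    (C (16 * r ^ 2) * X 0 ^ 4 - C 2 * X 1 ^ 2 * (X 1 ^ 2 + C 8 * X 0 ^ 2))
    (X 1 * (X 1 - C r * X 0) * (X 1 ^ 2 + C 8 * X 0 ^ 2) ^ 2) := by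
  have hr0 := ne_zero_of_three_mul_eq_four h2 hr
  have hα : dehomogenize (k := k) (X 1 * (X 1 + C r * X 0)) = .X * (.X + .C r) := by
    simp [dehomogenize]
  have hβ : dehomogenize
      (C (16 * r ^ 2) * X 0 ^ 4 - C 2 * X 1 ^ 2 * (X 1 ^ 2 + C 8 * X 0 ^ 2)) =
        (16 * .C r ^ 2 - 2 * .X ^ 2 * (.X ^ 2 + 8)) := by
    simp [dehomogenize, Polynomial.C_ofNat]
  have hγ : dehomogenize (X 1 * (X 1 - C r * X 0) * (X 1 ^ 2 + C 8 * X 0 ^ 2) ^ 2) =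
      .X * (.X - .C r) * (.X ^ 2 + 8) ^ 2 := by
    simp [dehomogenize, Polynomial.C_ofNat]
  have hdvd {π : MvPolynomial (Fin 2) k} (hπ : Prime π) {a : k} (ha : a ≠ 0)
      (h : π ∣ C a * X 0 ^ 4) : π ∣ X 0 := by
    refine hπ.dvd_of_dvd_pow (n := 4) ?_
    exact (IsUnit.dvd_mul_left ((isUnit_iff_ne_zero.mpr ha).map C)).mp h
  have hr1 : X 1 + C r * X 0 ≠ (0 : MvPolynomial (Fin 2) k) := by
    intro h
    simpa using congr(eval ![0, 1] $h)
  refine ⟨mul_ne_zero (X_ne_zero 1) hr1, ?_, ?_, ?_⟩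
  · rw [hα, hβ, hγ]
    convert not_isSquare_of_coeff_ne_zero h2 (mul_ne_zero (pow_ne_zero 2 h2) (pow_ne_zero 2 hr0))
      (neg_ne_zero.mpr (mul_ne_zero (pow_ne_zero 8 h2) (pow_ne_zero 2 hr0))) (256 * r ^ 4) using 2
    simp only [map_mul, map_pow, map_ofNat, map_neg]
    ring
  · intro δ hδ
    exfalso
    -- No such `δ` exists: `αγ` is a square times `X² - r²`, which is squarefree of degree 2.
    rw [hα, hγ, show (.X * (.X + .C r) * (.X * (.X - .C r) * (.X ^ 2 + 8) ^ 2) : Polynomial k) =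
      (.X * (.X ^ 2 + 8)) ^ 2 * (.X ^ 2 - .C (r ^ 2)) by rw [Polynomial.C_pow]; ring] at hδ
    obtain ⟨d, rfl⟩ := (IsIntegrallyClosed.pow_dvd_pow_iff two_ne_zero).mp (Dvd.intro _ hδ.symm)
    have hX : (.X * (.X ^ 2 + 8) : Polynomial k) ≠ 0 := by
      refine mul_ne_zero Polynomial.X_ne_zero ?_
      rw [← map_ofNat Polynomial.C]
      exact Polynomial.X_pow_add_C_ne_zero two_pos _
    rw [mul_pow] at hδ
    refine not_isSquare_of_squarefree
      (Polynomial.separable_X_pow_sub_C (r ^ 2) (n := 2) (by exact_mod_cast h2)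
        (pow_ne_zero 2 hr0)).squarefree ?_ ⟨d, by
          rw [← sq]; exact (mul_left_cancel₀ (pow_ne_zero 2 hX) hδ).symm⟩
    exact Polynomial.not_isUnit_of_natDegree_pos _ (by rw [Polynomial.natDegree_X_pow_sub_C]; simp)
  · intro π hπ h0 h1 _
    obtain h0 | h0 := hπ.dvd_or_dvd h0
    · rw [dvd_sub_left (((dvd_pow h0 two_ne_zero).mul_left _).mul_right _)] at h1
      exact not_prime_dvd_X hπ
        (hdvd hπ (mul_ne_zero (by convert pow_ne_zero 4 h2 using 1; norm_num)
          (pow_ne_zero 2 hr0)) h1) h0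
    · have key : (C (16 * r ^ 2) * X 0 ^ 4 - C 2 * X 1 ^ 2 * (X 1 ^ 2 + C 8 * X 0 ^ 2) :
          MvPolynomial (Fin 2) k) =
          C (-2 * r ^ 4) * X 0 ^ 4 - (X 1 + C r * X 0) * ((X 1 - C r * X 0) *
            (2 * (C r ^ 2 * X 0 ^ 2 + X 1 ^ 2) + 16 * X 0 ^ 2)) := by
        simp only [map_mul, map_pow, map_ofNat, map_neg]
        ring
      rw [key, dvd_sub_left (h0.mul_right _)] at h1
      have hX0 := hdvd hπ (mul_ne_zero (neg_ne_zero.mpr h2) (pow_ne_zero 4 hr0)) h1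
      exact not_prime_dvd_X hπ hX0 ((dvd_add_left (hX0.mul_left _)).mp h0)

lemma irreducible_quotientSextic : Irreducible (quotientSextic r) :=
  (isIrreducibleBiquadratic_quotientSextic h2 hr).irreducible

lemma birationalOver_quotientSextic [IsAlgClosed k] {K : Type u} [Field K] [Algebra k K] {x y z : K}
    (h : IsCurveGenerators 0 r 1 0 (-r) 1 x y z) :
    Scheme.BirationalOver (canonicalCurve k x y z).hom (planeCurve (quotientSextic r)).hom := by
  have h2' : (2 : K) ≠ 0 := by
    have := (map_ne_zero (algebraMap k K)).mpr h.pair.two_ne_zero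
    rwa [map_ofNat] at this
  have hx0 := h.x_ne_zero
  have hy := h.sq_left
  have hz := h.sq_right
  simp only [aeval_quartic, map_neg, map_zero, map_one] at hy hz
  have hR0 := (map_ne_zero (algebraMap k K)).mpr (ne_zero_of_three_mul_eq_four h2 hr)
  set R := algebraMap k K r
  obtain ⟨b, hb⟩ : ∃ b, x * b = y - z := ⟨(y - z) / x, by field_simp⟩
  obtain ⟨v, hv⟩ : ∃ v, x * v = y + z - 2 * x ^ 2 - 2 :=
    ⟨(y + z - 2 * x ^ 2 - 2) / x, by field_simp⟩
  -- Were `b` algebraic it would be a constant `a`, and `y - z = a x` would contradict the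
  -- independence of `1, y, z`.
  have htr : Transcendental k b := by
    intro halg
    obtain ⟨a, rfl⟩ := minpoly.mem_range_of_degree_eq_one k b
      (IsAlgClosed.degree_eq_one_of_irreducible k (minpoly.irreducible halg.isIntegral))
    obtain ⟨-, h1, -⟩ := h.isBiquadratic.coeff_eq_zero h.pair.two_ne_zero
      (a := .C a * .X) (b := -1) (c := 1) (d := 0) (by simp; linear_combination hb)
    exact one_ne_zero (neg_eq_zero.mp h1)
  have hS : (y + z) * b = 2 * R :=
    mul_left_cancel₀ hx0 (by linear_combination (y + z) * hb + hy - hz)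
  have hq : x * (v ^ 2 - (b ^ 2 + 8)) = 2 * (y + z) * v := by
    refine mul_left_cancel₀ hx0 ?_
    linear_combination (x * v - (y + z) - 2 * x ^ 2 - 2) * hv - (x * b + (y - z)) * hb -
      2 * hy - 2 * hz
  -- This relation, linear in `x`, recovers `x` from `v` and `b`; inserted into the quadratic
  -- relation `hE2` it gives twice the sextic.
  have hE1 : b * x * (v ^ 2 - (b ^ 2 + 8)) = 4 * R * v := by
    linear_combination b * hq + 2 * v * hS
  have hE2 : 2 * b * x ^ 2 + b * v * x + 2 * b - 2 * R = 0 := by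
    linear_combination hS + b * hv
  have hF : aeval ![v, 1, b] (quotientSextic r) = 0 := by
    simp [quotientSextic_eq]
    refine mul_left_cancel₀ h2' ?_
    linear_combination b * (v ^ 2 - (b ^ 2 + 8)) ^ 2 * hE2 -
      (2 * (b * x * (v ^ 2 - (b ^ 2 + 8)) + 4 * R * v) + b * v * (v ^ 2 - (b ^ 2 + 8))) * hE1
  have hb0 : b ≠ 0 := by
    rintro rfl
    exact mul_ne_zero h2' hR0 (by linear_combination -hS)
  have hD0 : v ^ 2 - (b ^ 2 + 8) ≠ 0 := by
    intro hD
    have hv0 : v = 0 := by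
      refine (mul_eq_zero.mp ?_).resolve_left (mul_ne_zero (pow_ne_zero 2 h2') hR0)
      linear_combination -hE1 + b * x * hD
    refine htr ⟨.X ^ 2 + .C 8, Polynomial.X_pow_add_C_ne_zero two_pos _, ?_⟩
    simp only [map_add, map_pow, Polynomial.aeval_X, map_ofNat]
    linear_combination -hD + v * hv0
  refine h.birationalOver_planeCurve ![v, 1, b] (j := 1) (by simp) ?_
    (isHomogeneous_quotientSextic r) (by norm_num) hF
    ((isIrreducibleBiquadratic_quotientSextic h2 hr).dvd htr
      (isHomogeneous_quotientSextic r) hF)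
  set E := IntermediateField.adjoin k (Set.range fun i => (![v, 1, b] : Fin 3 → K) i / ![v, 1, b] 1)
  have hvE : v ∈ E := IntermediateField.subset_adjoin _ _ ⟨0, by simp⟩
  have hbE : b ∈ E := IntermediateField.subset_adjoin _ _ ⟨2, by simp⟩
  have hRE : R ∈ E := E.algebraMap_mem _
  have hxE : x ∈ E := by
    rw [show x = 4 * R * v / (b * (v ^ 2 - (b ^ 2 + 8))) by
      rw [eq_div_iff (mul_ne_zero hb0 hD0)]; linear_combination hE1]
    exact div_mem (mul_mem (mul_mem (ofNat_mem E 4) hRE) hvE)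
      (mul_mem hbE (sub_mem (pow_mem hvE 2) (add_mem (pow_mem hbE 2) (ofNat_mem E 8))))
  have hyE : y = (2 * R / b + x * b) / 2 := by
    rw [eq_div_iff h2', ← hS, hb]
    field_simp
    ring
  have hzE : z = (2 * R / b - x * b) / 2 := by
    rw [eq_div_iff h2', ← hS, hb]
    field_simp
    ring
  have h1E : 2 * R / b ∈ E := div_mem (mul_mem (ofNat_mem E 2) hRE) hbE
  rintro _ (rfl | rfl | rfl)
  · exact hxE
  · exact hyE ▸ div_mem (add_mem h1E (mul_mem hxE hbE)) (ofNat_mem E 2)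
  · exact hzE ▸ div_mem (sub_mem h1E (mul_mem hxE hbE)) (ofNat_mem E 2)

end

end QuotientModel

end PlaneSextic
end

/-! ### Assembly and the choice of parameters. -/

noncomputable section
namespace PlaneSextic

lemma natCast_ne_zero_of_charP {k : Type*} [Field k] (p : ℕ) [CharP k p] (hp : p = 0 ∨ 5 ≤ p) {n : ℕ} (h0 : n ≠ 0)
    (hn : n < 5) : (n : k) ≠ 0 := by
  rw [Ne, CharP.cast_eq_zero_iff k p]
  obtain rfl | hp := hp
  · simpa using h0
  · exact fun h => absurd (Nat.le_of_dvd (Nat.pos_of_ne_zero h0) h) (by lia)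

variable {k : Type u} [Field k] [IsAlgClosed k]

lemma IsBiquadraticPair.exists_curve {a b c a' b' c' : k} (h : IsBiquadraticPair a b c a' b' c')
    {F : MvPolynomial (Fin 3) k} {s : ℕ} (hF : F.IsHomogeneous 6) (hirr : Irreducible F)
    (hbir : ∀ (K : Type u) [Field K] [Algebra k K] (x y z : K),
      IsCurveGenerators a b c a' b' c' x y z →
        Scheme.BirationalOver (canonicalCurve k x y z).hom (planeCurve F).hom)
    (hs : (singularPoints F).encard = s)
    (hmult : ∀ w : Fin 3 → k, w ≠ 0 → MvPolynomial.eval w F = 0 →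
      (∀ i, MvPolynomial.eval w (MvPolynomial.pderiv i F) = 0) →
        ∃ i, MvPolynomial.eval w (MvPolynomial.pderiv i (MvPolynomial.pderiv i F)) ≠ 0) :
    ∃ (H : Over (Spec (.of k))) (_ : IsNonsingularCurve H),
      genus H = 5 ∧ ¬ IsHyperelliptic H ∧ (∃ V : Subgroup (Aut H), IsKleinFour V) ∧
      ∃ F : MvPolynomial (Fin 3) k,
        F.IsHomogeneous 6 ∧ Irreducible F ∧
        Scheme.BirationalOver H.hom (planeCurve F).hom ∧
        (singularPoints F).encard = s ∧ ∀ P ∈ singularPoints F, multiplicityAt F P = 2 := by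
  obtain ⟨K, _, _, x, y, z, hg⟩ := h.exists_isCurveGenerators
  exact ⟨canonicalCurve k x y z, hg.isNonsingularCurve, hg.genus_eq_five, hg.not_isHyperelliptic,
    hg.exists_isKleinFour, F, hF, hirr, hbir K x y z hg, hs,
    fun P hP => multiplicityAt_eq_two hmult hP⟩

lemma exists_curve_productSextic {p q m : k}
    (h : IsBiquadraticPair (2 * p) 0 (m + 2 * q) (-2 * p) 0 (m - 2 * q)) {r : ℕ} (ρ : Fin r → k)
    (hρ : Function.Injective ρ) (hroots : ∀ x, p * x ^ 2 + q = 0 ↔ ∃ i, ρ i = x) :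
    ∃ (H : Over (Spec (.of k))) (_ : IsNonsingularCurve H),
      genus H = 5 ∧ ¬ IsHyperelliptic H ∧ (∃ V : Subgroup (Aut H), IsKleinFour V) ∧
      ∃ F : MvPolynomial (Fin 3) k,
        F.IsHomogeneous 6 ∧ Irreducible F ∧
        Scheme.BirationalOver H.hom (planeCurve F).hom ∧
        (singularPoints F).encard = (r + 2 : ℕ) ∧
        ∀ P ∈ singularPoints F, multiplicityAt F P = 2 :=
  h.exists_curve (isHomogeneous_productSextic p q m) (irreducible_productSextic h)
    (fun _ _ _ _ _ _ hg => birationalOver_productSextic hg)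
    (encard_singularPoints_productSextic h ρ hρ hroots)
    (fun _ hw => exists_pderiv_pderiv_productSextic_ne_zero h hw)

end PlaneSextic
end

theorem mainTheorem4 {k : Type u} [Field k] [IsAlgClosed k] (p : ℕ) [CharP k p]
    (hp : p = 0 ∨ 5 ≤ p) (s : ℕ) (hs : s ∈ ({2, 3, 4, 5} : Set ℕ)) :
    ∃ (H : Over (Spec (.of k))) (_ : PlaneSextic.IsNonsingularCurve H),
      PlaneSextic.genus H = 5 ∧
      ¬ PlaneSextic.IsHyperelliptic H ∧
      (∃ V : Subgroup (Aut H), IsKleinFour V) ∧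
      ∃ F : MvPolynomial (Fin 3) k,
        F.IsHomogeneous 6 ∧ Irreducible F ∧
        Scheme.BirationalOver H.hom (PlaneSextic.planeCurve F).hom ∧
        (PlaneSextic.singularPoints F).encard = s ∧
        ∀ P ∈ PlaneSextic.singularPoints F, PlaneSextic.multiplicityAt F P = 2 := by
  have h2 : (2 : k) ≠ 0 := by
    exact_mod_cast PlaneSextic.natCast_ne_zero_of_charP (k := k) p hp (n := 2) (by simp) (by simp)
  have h3 : (3 : k) ≠ 0 := by
    exact_mod_cast PlaneSextic.natCast_ne_zero_of_charP (k := k) p hp (n := 3) (by simp) (by simp)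
  obtain rfl | rfl | rfl | rfl := hs
  -- `N = 1` has no root; the quartics are `x⁴ ± 2`.
  · refine PlaneSextic.exists_curve_productSextic (p := 0) (q := 1) (m := 0) ?_ (r := 0)
      (fun _ => 0) (Function.injective_of_subsingleton _) (by simp)
    refine ⟨h2, by simpa using h2, by simpa using h2, fun t h h' => ?_, fun t h h' => ?_,
      fun t h h' => ?_⟩
    · exact mul_ne_zero (pow_ne_zero 2 h2) h2 (by linear_combination 4 * h - t * h')
    · exact mul_ne_zero (pow_ne_zero 2 h2) h2 (by linear_combination -4 * h + t * h')
    · exact pow_ne_zero 2 h2 (by linear_combination h - h')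
  -- `N = 2x²` has the single root 0; the quartics are `x⁴ ± 4x² + 1`.
  · refine PlaneSextic.exists_curve_productSextic (p := 2) (q := 0) (m := 1) ?_ (r := 1)
      (fun _ => 0) (Function.injective_of_subsingleton _) (by simp [h2, eq_comm (a := (0 : k))])
    refine ⟨h2, by simp, by simp, fun t h h' => ?_, fun t h h' => ?_, fun t h h' => ?_⟩
    · have : t * (t ^ 2 + 2) = 0 :=
        mul_left_cancel₀ (pow_ne_zero 2 h2) (by linear_combination h')
      obtain ht | ht := mul_eq_zero.mp this
      · exact one_ne_zero (by linear_combination h - (t ^ 3 + 4 * t) * ht)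
      · exact h3 (by linear_combination -h + (t ^ 2 + 2) * ht)
    · have : t * (t ^ 2 - 2) = 0 :=
        mul_left_cancel₀ (pow_ne_zero 2 h2) (by linear_combination h')
      obtain ht | ht := mul_eq_zero.mp this
      · exact one_ne_zero (by linear_combination h - (t ^ 3 - 4 * t) * ht)
      · exact h3 (by linear_combination -h + (t ^ 2 - 2) * ht)
    · have ht : t = 0 := by
        refine pow_eq_zero_iff two_ne_zero |>.mp (mul_left_cancel₀ (pow_ne_zero 3 h2) ?_)
        linear_combination h - h'
      exact one_ne_zero (by linear_combination h - (t ^ 3 + 4 * t) * ht)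
  -- `N = x² - 1` has the roots `±1`; the quartics are `x⁴ ± (2x² - 2)`.
  · refine PlaneSextic.exists_curve_productSextic (p := 1) (q := -1) (m := 0) ?_ (r := 2)
      ![1, -1] ?_ ?_
    · refine ⟨h2, by simpa using h2, by simpa using h2, fun t h h' => ?_, fun t h h' => ?_,
        fun t h h' => ?_⟩
      · have : t * (t ^ 2 + 1) = 0 :=
          mul_left_cancel₀ (pow_ne_zero 2 h2) (by linear_combination h')
        obtain ht | ht := mul_eq_zero.mp this
        · exact h2 (by linear_combination -h + (t ^ 3 + 2 * t) * ht)
        · exact h3 (by linear_combination -h + (t ^ 2 + 1) * ht)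
      · have : t * (t ^ 2 - 1) = 0 :=
          mul_left_cancel₀ (pow_ne_zero 2 h2) (by linear_combination h')
        obtain ht | ht := mul_eq_zero.mp this
        · exact h2 (by linear_combination h - (t ^ 3 - 2 * t) * ht)
        · exact one_ne_zero (by linear_combination h - (t ^ 2 - 1) * ht)
      · have ht : t = 0 := by
          refine pow_eq_zero_iff (n := 4) four_ne_zero |>.mp (mul_left_cancel₀ h2 ?_)
          linear_combination h + h'
        exact h2 (by linear_combination -h + (t ^ 3 + 2 * t) * ht)
    · have h1 : (1 : k) ≠ -1 := fun h => h2 (by linear_combination h)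
      have h1' : (-1 : k) ≠ 1 := h1.symm
      intro i j h
      fin_cases i <;> fin_cases j <;> simp_all
    · intro x
      rw [Fin.exists_fin_two, Matrix.cons_val_zero, Matrix.cons_val_one, eq_comm (b := x),
        eq_comm (b := x), Matrix.cons_val_zero, ← sq_eq_one_iff, one_mul, add_neg_eq_zero]
  · have hr : 3 * (4 / 3 : k) = 4 := by field_simp
    -- `±ε` are the two roots of `b² + 8`, which give the singular points on `V = 0`.
    obtain ⟨ε, hε⟩ := IsAlgClosed.exists_pow_nat_eq (-8 : k) two_pos
    exact (PlaneSextic.isBiquadraticPair_quotientSextic h2 hr).exists_curve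
      (PlaneSextic.isHomogeneous_quotientSextic _) (PlaneSextic.irreducible_quotientSextic h2 hr)
      (fun _ _ _ _ _ _ hg => PlaneSextic.birationalOver_quotientSextic h2 hr hg)
      (PlaneSextic.encard_singularPoints_quotientSextic h2 hr hε)
      (fun _ hw => PlaneSextic.exists_pderiv_pderiv_quotientSextic_ne_zero h2 hr hw)
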